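/- **Setting.** Let $M$ be a smooth (Hausdorff, finite-dimensional) manifold, $f_0,f_1,\dots,f_m$ smooth vector fields on $M$, and $\pi:T^*M\to M$ the cotangent bundle with Liouville form $\varsigma(\ell)=\ell\circ\pi_*$ and symplectic form $\sigma=d\varsigma$. The Hamiltonian vector field $\vec F$ of a smooth function $F$ is defined by $\langle dF(\ell),\cdot\rangle=\sigma_\ell(\cdot,\vec F(\ell))$, and $\{F,G\}=\langle dG,\vec F\rangle$. Put $F_i(\ell)=\langle \ell,f_i(\pi\ell)\rangle$ for $i=0,\dots,m$, $F_{ij}=\{F_i,F_j\}$, $F_{ijk}=\{F_i,\{F_j,F_k\}\}$. Let $\mathrm{Lie}(\mathfrak f)$ be the Lie algebra of vector fields generated by $f_1,\dots,f_m$, and set $$\Sigma=\{\ell: \langle \ell,f(\pi\ell)\rangle=0\ \ \forall f\in \mathrm{Lie}(\mathfrak f)\},\qquad S=\{\ell\in\Sigma: \langle \ell,[f_0,f](\pi\ell)\rangle=0\ \ \forall f\in \mathrm{Lie}(\mathfrak f)\},$$ and let $\mathbb L_\ell$ be the quadratic form on $\mathbb R^m$ with matrix $(F_{ij0}(\ell))_{i,j=1}^m$.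 **Assumptions.** Let $T>0$, let $\hat u\in L^\infty([0,T],\mathbb R^m)$ take values, for a.e. $t$, in the interior of the control set, and let $\hat\lambda:[0,T]\to T^*M$ be a Lipschitz, nowhere zero curve with $\dot{\hat\lambda}(t)=\vec F_0(\hat\lambda(t))+\sum_i\hat u_i(t)\vec F_i(\hat\lambda(t))$ for a.e. $t$, $F_i(\hat\lambda(t))=0$ for $i=1,\dots,m$ and $F_0(\hat\lambda(t))=1$ for all $t$ (a normal singular Pontryagin extremal). Assume: 1. on a neighbourhood of $\pi\hat\lambda([0,T])$ the fields $f_1,\dots,f_m$ are linearly independent at every point and $\dim\{f(q):f\in\mathrm{Lie}(\mathfrak f)\}$ is constant; 2. (High Order Goh Condition) $\hat\lambda(t)\in\Sigma$ for all $t\in[0,T]$; 3. (Strengthened Generalized Legendre Condition) there is $c>0$ with $\mathbb L_{\hat\lambda(t)}[v]^2\le -c|v|^2$ for all $t\in[0,T]$, $v\in\mathbb R^m$; 4. in a neighbourhood of $\hat\lambda([0,T])$, $S$ is an embedded submanifold of constant codimension $m$ in $\Sigma$. **The map $\phi$ and the super-Hamiltonian.** Call $(U,\vartheta,\phi)$ *admissible*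 if $U$ is an open neighbourhood of $\hat\lambda([0,T])$ on which $\mathbb L_\ell$ is negative definite, $\vartheta_1,\dots,\vartheta_m:U\to\mathbb R$ are smooth, for each $\ell\in U$ the solution of $\dot p=\sum_i\vartheta_i(\ell)\vec F_i(p)$ (coefficients frozen at $\ell$), $p(0)=\ell$, exists on $[0,1]$ and $\phi(\ell)=p(1)$, and moreover $\phi(U)\subset U$, $\phi(\Sigma\cap U)\subset S$, $\vartheta=0$ on $S\cap U$, and for $\ell\in S\cap U$ and $\delta\ell\in T_\ell T^*M$ $$\big(\langle d\vartheta_i(\ell),\delta\ell\rangle\big)_{i=1}^m=\mathbb L_\ell^{-1}\big(\langle dF_{0i}(\ell),\delta\ell\rangle\big)_{i=1}^m .$$ **Theorem.** Admissible triples $(U,\vartheta,\phi)$ exist. For every admissible triple, put $H_0=F_0\circ\phi:U\to\mathbb R$. Then, possibly after replacing $U$ by a smaller open neighbourhood $U'\subset U$ of $\hat\lambda([0,T])$, $H_0$ is smooth on $U'$ and 1. $H_0=F_0$ and $\vec H_0=\vec F_0$ on $S\cap U'$; 2. $\vec H_0(\ell)$ is tangent to $\Sigma$ at every $\ell\in\Sigma\cap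 U'$; 3. $F_0\le H_0$ on $\Sigma\cap U'$. -/

import Mathlib

open Set Filter Topology MeasureTheory
open scoped Manifold ContDiff Matrix

noncomputable section

/-- The cotangent bundle `T*M` of a manifold `M` modelled on `E`. -/
abbrev Cotangent (E M : Type*) [NormedAddCommGroup E] [NormedSpace ℝ E]
    [TopologicalSpace M] [ChartedSpace E M] : Type _ :=
  Bundle.TotalSpace (E →L[ℝ] ℝ)
    (fun x : M => TangentSpace 𝓘(ℝ, E) x →L[ℝ] Bundle.Trivial M ℝ x)

/-- The model with corners of `T*M`. -/
abbrev cotModel (E : Type*) [NormedAddCommGroup E] [NormedSpace ℝ E] :=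
  (𝓘(ℝ, E)).prod 𝓘(ℝ, E →L[ℝ] ℝ)

/-- (Not necessarily continuous) vector fields on `M`. -/
abbrev VField (E M : Type*) [NormedAddCommGroup E] [NormedSpace ℝ E]
    [TopologicalSpace M] [ChartedSpace E M] : Type _ :=
  (x : M) → TangentSpace 𝓘(ℝ, E) x

section

variable {E M : Type*} [NormedAddCommGroup E] [NormedSpace ℝ E]
  [TopologicalSpace M] [ChartedSpace E M] [IsManifold 𝓘(ℝ, E) ∞ M]

/-- Smoothness of a vector field on `M`, as a section of the tangent bundle. -/
def IsSmoothVField (f : VField E M) : Prop :=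
  ContMDiff 𝓘(ℝ, E) (𝓘(ℝ, E)).tangent ∞
    (fun x => (⟨x, f x⟩ : TangentBundle 𝓘(ℝ, E) M))

/-- The Liouville one-form `ς(ℓ) = ℓ ∘ π_*` on `T*M`. -/
def liouvilleForm (ℓ : Cotangent E M) : TangentSpace (cotModel E) ℓ →L[ℝ] ℝ :=
  ContinuousLinearMap.comp (M₂ := TangentSpace 𝓘(ℝ, E) ℓ.1) (M₃ := ℝ) ℓ.2
    (mfderiv (cotModel E) 𝓘(ℝ, E) (fun p : Cotangent E M => p.1) ℓ)

/-- The Liouville form in the preferred chart at `ℓ₀`, i.e. its pull-back by the inverse chart. -/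
def liouvilleInChart (ℓ₀ : Cotangent E M) (z : E × (E →L[ℝ] ℝ)) :
    (E × (E →L[ℝ] ℝ)) →L[ℝ] ℝ :=
  (liouvilleForm ((extChartAt (cotModel E) ℓ₀).symm z)).comp
    (mfderiv 𝓘(ℝ, E × (E →L[ℝ] ℝ)) (cotModel E) (extChartAt (cotModel E) ℓ₀).symm z)

/-- The canonical symplectic form `σ = dς`, the exterior derivative being computed in the
preferred chart: `dα(v, w) = (Dα · v)(w) - (Dα · w)(v)`. -/
def symplecticForm (ℓ : Cotangent E M) (v w : TangentSpace (cotModel E) ℓ) : ℝ :=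
  let D := fderiv ℝ (liouvilleInChart ℓ) (extChartAt (cotModel E) ℓ ℓ)
  let d := mfderiv (cotModel E) 𝓘(ℝ, E × (E →L[ℝ] ℝ)) (extChartAt (cotModel E) ℓ) ℓ
  (D (d v) : (E × (E →L[ℝ] ℝ)) →L[ℝ] ℝ) (d w) - (D (d w) : (E × (E →L[ℝ] ℝ)) →L[ℝ] ℝ) (d v)

/-- The differential of a real function on `T*M`. -/
def cotDiff (F : Cotangent E M → ℝ) (ℓ : Cotangent E M) :
    TangentSpace (cotModel E) ℓ →L[ℝ] ℝ :=
  mfderiv (cotModel E) 𝓘(ℝ, ℝ) F ℓ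

/-- The Hamiltonian vector field of `F`: the vector `X` with `dF(ℓ)(v) = σ_ℓ(v, X)` for all `v`
(it exists and is unique because `σ` is nondegenerate). -/
def hamVec (F : Cotangent E M → ℝ) (ℓ : Cotangent E M) : TangentSpace (cotModel E) ℓ :=
  Classical.epsilon fun X : TangentSpace (cotModel E) ℓ =>
    ∀ v : TangentSpace (cotModel E) ℓ, cotDiff F ℓ v = symplecticForm ℓ v X

/-- The Poisson bracket `{F, G} = dG(F⃗) = σ(F⃗, G⃗)`; with this sign the bracket of the lifts of
`f` and `g` is the lift of `[f, g]`. -/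
def poisson (F G : Cotangent E M → ℝ) (ℓ : Cotangent E M) : ℝ :=
  cotDiff G ℓ (hamVec F ℓ)

/-- The Hamiltonian `F(ℓ) = ⟨ℓ, f(π ℓ)⟩` of a vector field `f`. -/
def hamLift (f : VField E M) (ℓ : Cotangent E M) : ℝ := ℓ.2 (f ℓ.1)

/-- `Lie(𝔣)`: the real Lie algebra of vector fields generated by `f_1, …, f_m`. -/
inductive LieGen {m : ℕ} (f : Fin m → VField E M) : VField E M → Prop
  | basic (i : Fin m) : LieGen f (f i)
  | zero : LieGen f (fun _ => 0)
  | add {g h : VField E M} : LieGen f g → LieGen f h → LieGen f (fun x => g x + h x)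
  | smul (c : ℝ) {g : VField E M} : LieGen f g → LieGen f (fun x => c • g x)
  | bracket {g h : VField E M} : LieGen f g → LieGen f h →
      LieGen f (VectorField.mlieBracket 𝓘(ℝ, E) g h)

/-- `Lie_q(𝔣) = span {g(q) : g ∈ Lie(𝔣)}`. -/
def lieAt {m : ℕ} (f : Fin m → VField E M) (q : M) :
    Submodule ℝ (TangentSpace 𝓘(ℝ, E) q) :=
  Submodule.span ℝ {v | ∃ g : VField E M, LieGen f g ∧ g q = v}

/-- On `O` the fields `f_1, …, f_m` are pointwise linearly independent and `Lie(𝔣)` has constant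
dimension `R`. -/
def LieRegularOn {m : ℕ} (f : Fin m → VField E M) (R : ℕ) (O : Set M) : Prop :=
  ∀ q ∈ O, LinearIndependent ℝ (fun i => f i q) ∧ Module.finrank ℝ (lieAt f q) = R

/-- `Σ = {ℓ : ⟨ℓ, g(π ℓ)⟩ = 0 for all g ∈ Lie(𝔣)}`. -/
def sigmaSet {m : ℕ} (f : Fin m → VField E M) : Set (Cotangent E M) :=
  {ℓ | ∀ g : VField E M, LieGen f g → hamLift g ℓ = 0}

/-- `S = {ℓ ∈ Σ : ⟨ℓ, [f_0, g](π ℓ)⟩ = 0 for all g ∈ Lie(𝔣)}`. -/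
def singSet {m : ℕ} (f₀ : VField E M) (f : Fin m → VField E M) : Set (Cotangent E M) :=
  {ℓ | ℓ ∈ sigmaSet f ∧ ∀ g : VField E M, LieGen f g →
    hamLift (VectorField.mlieBracket 𝓘(ℝ, E) f₀ g) ℓ = 0}

/-- The matrix `(F_{ij0}(ℓ))` of the form `𝕃_ℓ`, where `F_{ij0} = {F_i, {F_j, F_0}}`. -/
def legendreMatrix {m : ℕ} (f₀ : VField E M) (f : Fin m → VField E M) (ℓ : Cotangent E M) :
    Matrix (Fin m) (Fin m) ℝ :=
  Matrix.of fun i j =>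
    poisson (hamLift (f i)) (poisson (hamLift (f j)) (hamLift f₀)) ℓ

/-- The quadratic form `𝕃_ℓ[v]² = ∑ v_i v_j F_{ij0}(ℓ)`. -/
def legendreForm {m : ℕ} (f₀ : VField E M) (f : Fin m → VField E M) (ℓ : Cotangent E M)
    (v : Fin m → ℝ) : ℝ :=
  ∑ i, ∑ j, v i * v j * legendreMatrix f₀ f ℓ i j

/-- `v` is the velocity at `p` of a smooth curve lying in `A`; for an embedded submanifold `A`
this says `v ∈ T_p A`. -/
def IsTangentVector (A : Set (Cotangent E M)) (p : Cotangent E M)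
    (v : TangentSpace (cotModel E) p) : Prop :=
  ∃ γ : ℝ → Cotangent E M, γ 0 = p ∧ (∀ᶠ s in 𝓝 (0 : ℝ), γ s ∈ A) ∧
    ContMDiffAt 𝓘(ℝ, ℝ) (cotModel E) ∞ γ 0 ∧
    HasMFDerivAt 𝓘(ℝ, ℝ) (cotModel E) γ 0
      ((1 : ℝ →L[ℝ] ℝ).smulRight (v : E × (E →L[ℝ] ℝ)))

/-- `S ⊆ A` is an embedded submanifold of `A` of constant codimension `k`: near each of its points
`S` is the zero set in `A` of a smooth `ℝ^k`-valued map whose differential maps the tangent vectors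
of `A` onto `ℝ^k`. -/
def IsSubmanifoldOfCodimIn (k : ℕ) (S A : Set (Cotangent E M)) : Prop :=
  S ⊆ A ∧ ∀ ℓ ∈ S, ∃ W : Set (Cotangent E M), IsOpen W ∧ ℓ ∈ W ∧
    ∃ g : Cotangent E M → (Fin k → ℝ), ContMDiffOn (cotModel E) 𝓘(ℝ, Fin k → ℝ) ∞ g W ∧
      (∀ p ∈ W, p ∈ S ↔ p ∈ A ∧ g p = 0) ∧
      ∀ p ∈ S ∩ W, ∀ w : Fin k → ℝ, ∃ v : TangentSpace (cotModel E) p,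
        IsTangentVector A p v ∧ mfderiv (cotModel E) 𝓘(ℝ, Fin k → ℝ) g p v = w

/-- `lam`, on `[0, T]`, is a normal singular Pontryagin extremal of the system
`ξ' = f_0(ξ) + ∑ u_i f_i(ξ)`, `u ∈ Uc`, with reference control `u` valued in the interior
of `Uc`. The reference trajectory is `π ∘ lam`.
Lipschitz continuity on the manifold is tested on smooth functions. -/
structure IsNormalSingularExtremal {m : ℕ} (f₀ : VField E M) (f : Fin m → VField E M)
    (Uc : Set (EuclideanSpace ℝ (Fin m))) (T : ℝ) (u : ℝ → EuclideanSpace ℝ (Fin m))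
    (lam : ℝ → Cotangent E M) : Prop where
  time_pos : 0 < T
  control_bdd : MemLp u ⊤ (volume.restrict (Icc 0 T))
  control_int : ∀ᵐ t ∂(volume.restrict (Icc 0 T)), u t ∈ interior Uc
  cont : ContinuousOn lam (Icc 0 T)
  lipschitz : ∀ g : Cotangent E M → ℝ, ContMDiff (cotModel E) 𝓘(ℝ, ℝ) ∞ g →
    ∃ K, LipschitzOnWith K (fun t => g (lam t)) (Icc 0 T)
  ne_zero : ∀ t ∈ Icc 0 T, (lam t).2 ≠ 0
  ode : ∀ᵐ t ∂(volume.restrict (Icc 0 T)), HasMFDerivAt 𝓘(ℝ, ℝ) (cotModel E) lam t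
    ((1 : ℝ →L[ℝ] ℝ).smulRight
      (hamVec (fun ℓ => hamLift f₀ ℓ + ∑ i, u t i * hamLift (f i) ℓ) (lam t)))
  singular : ∀ t ∈ Icc 0 T, ∀ i, hamLift (f i) (lam t) = 0
  normal : ∀ t ∈ Icc 0 T, hamLift f₀ (lam t) = 1

/-- `ℓ' = exp(∑ c_i F⃗_i)(ℓ)`: the solution of `ℓ̇ = ∑ c_i F⃗_i(ℓ)` issuing from `ℓ` exists up to
time `1` and its value at time `1` is `ℓ'`. -/
def IsExp {m : ℕ} (f : Fin m → VField E M) (c : Fin m → ℝ) (ℓ ℓ' : Cotangent E M) : Prop :=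
  ∃ γ : ℝ → Cotangent E M, γ 0 = ℓ ∧ γ 1 = ℓ' ∧
    IsMIntegralCurveOn (I := cotModel E) γ
      (fun p => ∑ i, c i • hamVec (hamLift (f i)) p) (Icc 0 1)

/-- `φ(ℓ) = exp(∑ ϑ_i(ℓ) F⃗_i)(ℓ)`, `ℓ ∈ U`, is the map used to define the super-Hamiltonian:
the `ϑ_i` are smooth on the open set `U`, where `𝕃_ℓ` is negative definite; they vanish on `S`;
`φ` maps `U` to `U` and `Σ` into `S`; and `dϑ = 𝕃_ℓ⁻¹ (dF_{01}, …, dF_{0m})` at the points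
`ℓ` of `S`. -/
structure IsSingularProjection {m : ℕ} (f₀ : VField E M) (f : Fin m → VField E M)
    (U : Set (Cotangent E M)) (θ : Cotangent E M → Fin m → ℝ)
    (φ : Cotangent E M → Cotangent E M) : Prop where
  isOpen : IsOpen U
  legendre : ∀ ℓ ∈ U, ∀ v : Fin m → ℝ, v ≠ 0 → legendreForm f₀ f ℓ v < 0
  smooth : ∀ i, ContMDiffOn (cotModel E) 𝓘(ℝ, ℝ) ∞ (fun ℓ => θ ℓ i) U
  flow : ∀ ℓ ∈ U, IsExp f (θ ℓ) ℓ (φ ℓ)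
  mapsTo : MapsTo φ U U
  mapsTo_sing : MapsTo φ (sigmaSet f ∩ U) (singSet f₀ f)
  zero_sing : ∀ ℓ ∈ singSet f₀ f ∩ U, θ ℓ = 0
  diff_sing : ∀ ℓ ∈ singSet f₀ f ∩ U, ∀ v : TangentSpace (cotModel E) ℓ,
    (fun i => cotDiff (fun p => θ p i) ℓ v) =
      (legendreMatrix f₀ f ℓ)⁻¹ *ᵥ
        (fun i => cotDiff (poisson (hamLift f₀) (hamLift (f i))) ℓ v)

/-- The super-Hamiltonian `H_0 = F_0 ∘ φ`. -/
def superHam (f₀ : VField E M) (φ : Cotangent E M → Cotangent E M) (ℓ : Cotangent E M) : ℝ :=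
  hamLift f₀ (φ ℓ)

end

end

/-! The flows of the `F⃗ᵢ` preserve `Σ`, and the Legendre condition makes `F₀` concave along them.
The map `φ` moves a point of `Σ` along such a flow to a critical point of `F₀`, where all `{Fᵢ, F₀}`
vanish. Everything is local near points of `S`, and the extremal lies in `S`: differentiating
`F_g(λ(t)) = 0` for `g ∈ Lie(𝔣)` leaves `{F₀, F_g} = 0`, since the brackets `{Fᵢ, F_g}` vanish on
`Σ` (`IsNormalSingularExtremal.mem_singSet`).

Locally, let `G_k` be the lifts of a frame of `Lie(𝔣)`. Then `Σ = {G = 0}`, and the ideal generated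
by the `G_k` contains the `Fᵢ` and is stable under brackets with them (`IsHamFrame`,
`exists_isHamFrame`). Hence `G` satisfies a linear equation along the flows, which therefore stay in
`Σ` (`IsHamFrame.flow_mem`).

Existence. The derivative at `c = 0` of `c ↦ {F₀, Fᵢ}(exp(∑ cⱼ F⃗ⱼ)(ℓ))` is minus the Legendre
matrix up to transposition, hence invertible, and the implicit function theorem gives `ϑ`. The
endpoint lies in `Σ ∩ {{F₀, Fᵢ} = 0}`. The codimension hypothesis shows that this set is locally no
larger than `S` (`IsHamFrame.eventually_sing`). Small solutions are unique, so local ones agree on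
overlaps and glue along the compact extremal (`exists_isSingularProjection`). Differentiating the
defining equation on `S` yields the formula for `dϑ` (`IsHamFrame.fderiv_theta`).

Properties of an arbitrary admissible triple. Uniqueness of integral curves identifies `φ` with the
local exponential. On `S`, `ϑ = 0` and the contribution of `dϑ` to `dH₀` is a combination of `⟨dF₀,
F⃗ᵢ⟩ = {Fᵢ, F₀} = 0`. Tangency to `Σ` means `⟨dH₀, G⃗_k⟩ = 0`: on `Σ` the linearised flow transports
the span of the `G⃗_l` into itself, and that span contains the `F⃗ᵢ`, so the claim reduces to `{G_l,
F₀} = 0` at the endpoint, which is in `S` (`IsHamFrame.fderiv_comp_exp_eq_zero`). Finally `t ↦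
F₀(exp(t ∑ ϑᵢ F⃗ᵢ)(ℓ))` is concave with zero derivative at `t = 1`, so it is nondecreasing
(`IsHamFrame.le_exp`).

The smooth dependence of flows on the point and on `c` comes from the implicit function theorem
applied to the integral equation in `C([0, 1], P)` (`exists_local_exp`). -/

noncomputable section

/-! ### Smoothness of composition operators on spaces of continuous maps -/

/-- Pointwise application `(L, h) ↦ (t ↦ L t (h t))` on spaces of continuous maps. -/
def pointwiseApplyL (K X Y : Type*) [TopologicalSpace K] [CompactSpace K]
    [NormedAddCommGroup X] [NormedSpace ℝ X] [NormedAddCommGroup Y] [NormedSpace ℝ Y] :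
    C(K, X →L[ℝ] Y) →L[ℝ] C(K, X) →L[ℝ] C(K, Y) :=
  LinearMap.mkContinuous₂
    (LinearMap.mk₂ ℝ (fun (L : C(K, X →L[ℝ] Y)) (h : C(K, X)) =>
      (⟨fun t => L t (h t), by fun_prop⟩ : C(K, Y)))
      (fun _ _ _ => by ext; simp) (fun _ _ _ => by ext; simp)
      (fun _ _ _ => by ext; simp) (fun _ _ _ => by ext; simp)) 1 (fun L h => by
        rw [ContinuousMap.norm_le _ (by positivity)]
        intro t
        rw [one_mul]
        refine ((L t).le_opNorm _).trans ?_
        gcongr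
        exacts [L.norm_coe_le_norm t, h.norm_coe_le_norm t])

@[simp] lemma pointwiseApplyL_apply {K X Y : Type*} [TopologicalSpace K] [CompactSpace K]
    [NormedAddCommGroup X] [NormedSpace ℝ X] [NormedAddCommGroup Y] [NormedSpace ℝ Y]
    (L : C(K, X →L[ℝ] Y)) (h : C(K, X)) (t : K) : pointwiseApplyL K X Y L h t = L t (h t) := rfl

/-- The mean value inequality is applied at each parameter; compactness of `K` makes the estimate
uniform. -/
lemma hasFDerivAt_comp_left {K X Y : Type*} [TopologicalSpace K] [CompactSpace K]
    [NormedAddCommGroup X] [NormedSpace ℝ X] [NormedAddCommGroup Y] [NormedSpace ℝ Y]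
    {f : X → Y} (hf : ContDiff ℝ 1 f) (γ : C(K, X)) :
    HasFDerivAt (fun γ : C(K, X) => (⟨f, hf.continuous⟩ : C(X, Y)).comp γ)
      (pointwiseApplyL K X Y ((⟨fderiv ℝ f, hf.continuous_fderiv one_ne_zero⟩ :
        C(X, X →L[ℝ] Y)).comp γ)) γ := by
  rw [hasFDerivAt_iff_isLittleO_nhds_zero, Asymptotics.isLittleO_iff]
  intro ε hε
  set D : C(X, X →L[ℝ] Y) := ⟨fderiv ℝ f, hf.continuous_fderiv one_ne_zero⟩ with hD
  have hc : Continuous fun γ' : C(K, X) => D.comp γ' := ContinuousMap.continuous_postcomp D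
  -- Postcomposition with `Df` is continuous for the sup distance, so one `δ` controls `Df` along
  -- all the segments from `γ t` to `γ t + k t`: each of their points is the value at `t` of some
  -- curve `γ + s • k`.
  obtain ⟨δ, hδ, h⟩ := (Metric.tendsto_nhds_nhds (f := fun γ' : C(K, X) => D.comp γ')
    (a := γ) (b := D.comp γ)).1 (hc.tendsto γ) ε hε
  filter_upwards [Metric.ball_mem_nhds (0 : C(K, X)) hδ] with k hk
  rw [ContinuousMap.norm_le _ (by positivity)]
  intro t
  have key := (convex_segment (γ t) (γ t + k t)).norm_image_sub_le_of_norm_fderiv_le'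
    (f := f) (φ := fderiv ℝ f (γ t)) (C := ε)
    (fun x _ => (hf.differentiable one_ne_zero) x) (fun x hx => ?_)
    (left_mem_segment _ _ _) (right_mem_segment _ _ _)
  · refine le_trans ?_ (key.trans ?_)
    · simp [hD]
    · rw [add_sub_cancel_left]
      exact mul_le_mul_of_nonneg_left (k.norm_coe_le_norm t) hε.le
  · rw [segment_eq_image'] at hx
    obtain ⟨s, hs, rfl⟩ := hx
    have hlt : dist (γ + s • k) γ < δ := by
      rw [dist_eq_norm, add_sub_cancel_left, norm_smul, Real.norm_of_nonneg hs.1]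
      rw [mem_ball_zero_iff] at hk
      exact (mul_le_of_le_one_left (norm_nonneg _) hs.2).trans_lt hk
    have := (ContinuousMap.dist_lt_iff hε).1 (h hlt) t
    rw [dist_eq_norm] at this
    simpa [hD] using this.le

/-- The derivative is composition with `Df` followed by a bounded linear operator, so induction on
the order applies with target `X →L[ℝ] Y`. The target therefore varies in the induction, and sharing
the universe of `X` keeps it in range. -/
lemma contDiff_comp_left.{v, w} {K : Type v} {X : Type w} [TopologicalSpace K] [CompactSpace K]
    [NormedAddCommGroup X] [NormedSpace ℝ X] (n : ℕ) :
    ∀ {Y : Type w} [NormedAddCommGroup Y] [NormedSpace ℝ Y] {f : X → Y}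
    (hf : ContDiff ℝ ∞ f),
    ContDiff ℝ n (fun γ : C(K, X) => (⟨f, hf.continuous⟩ : C(X, Y)).comp γ) := by
  induction n with
  | zero =>
    intro Y _ _ f hf
    exact contDiff_zero.2 (ContinuousMap.continuous_postcomp _)
  | succ n ih =>
    intro Y _ _ f hf
    have h1 : ContDiff ℝ 1 f := hf.of_le (by exact_mod_cast le_top)
    have hd := fun γ : C(K, X) => hasFDerivAt_comp_left h1 γ
    push_cast
    refine contDiff_succ_iff_fderiv.2 ⟨fun γ => (hd γ).differentiableAt, by simp, ?_⟩
    have : fderiv ℝ (fun γ : C(K, X) => (⟨f, hf.continuous⟩ : C(X, Y)).comp γ) =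
        fun γ => pointwiseApplyL K X Y ((⟨fderiv ℝ f, h1.continuous_fderiv one_ne_zero⟩ :
        C(X, X →L[ℝ] Y)).comp γ) := funext fun γ => (hd γ).fderiv
    rw [this]
    exact (pointwiseApplyL K X Y).contDiff.comp (ih (hf.fderiv_right (m := ∞) (by simp)))

/-- The Volterra operator `γ ↦ (t ↦ ∫₀ᵗ γ)` on `C([0, 1], P)`. -/
def volterraL (P : Type*) [NormedAddCommGroup P] [NormedSpace ℝ P] :
    C(Icc (0 : ℝ) 1, P) →L[ℝ] C(Icc (0 : ℝ) 1, P) :=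
  LinearMap.mkContinuous
    { toFun := fun γ => ⟨fun t => ∫ s in (0 : ℝ)..t, γ (projIcc 0 1 zero_le_one s), by
        have : Continuous fun t : ℝ => ∫ s in (0 : ℝ)..t, γ (projIcc 0 1 zero_le_one s) :=
          intervalIntegral.continuous_primitive
            (fun a b => (by fun_prop : Continuous _).intervalIntegrable a b) 0
        exact this.comp continuous_subtype_val⟩
      map_add' := fun γ δ => by
        ext t
        exact intervalIntegral.integral_add ((by fun_prop : Continuous _).intervalIntegrable _ _)
          ((by fun_prop : Continuous _).intervalIntegrable _ _)
      map_smul' := fun c γ => by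
        ext t
        exact intervalIntegral.integral_smul _ _ } 1 (fun γ => by
      rw [ContinuousMap.norm_le _ (by positivity)]
      intro t
      refine (intervalIntegral.norm_integral_le_of_norm_le_const
        (fun s _ => γ.norm_coe_le_norm _)).trans ?_
      rw [sub_zero, abs_of_nonneg t.2.1, one_mul]
      exact mul_le_of_le_one_right (norm_nonneg _) t.2.2)

lemma volterraL_apply {P : Type*} [NormedAddCommGroup P] [NormedSpace ℝ P]
    (γ : C(Icc (0 : ℝ) 1, P)) (t : Icc (0 : ℝ) 1) :
    volterraL P γ t = ∫ s in (0 : ℝ)..t, γ (projIcc 0 1 zero_le_one s) := rfl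

/-! ### A smooth implicit function -/

/-- Being `C^∞` at one point does not give `C^∞` at nearby points. The implicit function theorem is
therefore applied again at each `(x, ψ x)`, and local uniqueness identifies the new implicit
function with `ψ`. -/
lemma exists_smooth_implicit {E₁ E₂ F : Type*} [NormedAddCommGroup E₁] [NormedSpace ℝ E₁]
    [CompleteSpace E₁] [NormedAddCommGroup E₂] [NormedSpace ℝ E₂] [CompleteSpace E₂]
    [NormedAddCommGroup F] [NormedSpace ℝ F] [CompleteSpace F] {f : E₁ × E₂ → F} {u : E₁ × E₂}
    (hf : ∀ᶠ v in 𝓝 u, ContDiffAt ℝ ∞ f v) (hu : f u = 0)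
    (hinv : (fderiv ℝ f u ∘L .inr ℝ E₁ E₂).IsInvertible) :
    ∃ ψ : E₁ → E₂, ψ u.1 = u.2 ∧ (∀ᶠ x in 𝓝 u.1, ContDiffAt ℝ ∞ ψ x) ∧
      ∀ᶠ v in 𝓝 u, f v = 0 ↔ ψ v.1 = v.2 := by
  have hn : (∞ : WithTop ℕ∞) ≠ 0 := by simp
  have cdf := hf.self_of_nhds
  set ψ := cdf.implicitFunction hn hinv with hψ
  have h0 : ψ u.1 = u.2 := cdf.implicitFunction_apply_self hn hinv
  have hcd : ContDiffAt ℝ ∞ ψ u.1 := cdf.contDiffAt_implicitFunction hn hinv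
  have hev : ∀ᶠ x in 𝓝 u.1, f (x, ψ x) = 0 := by
    simpa [hu] using cdf.eventually_apply_implicitFunction hn hinv
  refine ⟨ψ, h0, ?_, by simpa [hu] using cdf.eventually_apply_eq_iff_implicitFunction hn hinv⟩
  have hψc : ∀ᶠ x in 𝓝 u.1, ContinuousAt ψ x := by
    have := (hcd.of_le (by exact_mod_cast le_top : (1 : WithTop ℕ∞) ≤ ∞)).eventually (by simp)
    exact this.mono fun x hx => hx.continuousAt
  have hpair : Tendsto (fun x => (x, ψ x)) (𝓝 u.1) (𝓝 u) := by
    have : ContinuousAt (fun x => (x, ψ x)) u.1 := continuousAt_id.prodMk hψc.self_of_nhds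
    simpa [ContinuousAt, h0] using this
  have hinv' : ∀ᶠ v in 𝓝 u, (fderiv ℝ f v ∘L .inr ℝ E₁ E₂).IsInvertible := by
    have hc : ContinuousAt (fun v => fderiv ℝ f v ∘L .inr ℝ E₁ E₂) u := by
      have := (cdf.fderiv_right (m := 0) (by simp)).continuousAt
      exact this.clm_comp continuousAt_const
    obtain ⟨e, he⟩ := hinv
    have := hc (he ▸ e.nhds)
    filter_upwards [this] with v hv
    obtain ⟨e', he'⟩ := hv
    exact ⟨e', he'⟩
  filter_upwards [hev.eventually_nhds, hψc, hpair.eventually hf, hpair.eventually hinv']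
    with x hx hxc hxf hxi
  have h1 := hxf.contDiffAt_implicitFunction hn hxi
  have h2 := hxf.eventually_apply_eq_iff_implicitFunction hn hxi
  have hpx : Tendsto (fun y => (y, ψ y)) (𝓝 x) (𝓝 (x, ψ x)) :=
    (continuousAt_id.prodMk hxc : ContinuousAt (fun y => (y, ψ y)) x)
  refine h1.congr_of_eventuallyEq ?_
  filter_upwards [hpx.eventually h2, hx] with y hy hy0
  exact (hy.1 (by rw [hy0, hx.self_of_nhds])).symm

/-- A bump function makes the field global, as required for a composition operator on all of `C([0,
1], P)`. -/
lemma exists_contDiff_eventuallyEq {P Y : Type*} [NormedAddCommGroup P] [NormedSpace ℝ P]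
    [FiniteDimensional ℝ P] [NormedAddCommGroup Y] [NormedSpace ℝ Y] {X : P → Y} {z₀ : P}
    (hX : ∀ᶠ z in 𝓝 z₀, ContDiffAt ℝ ∞ X z) :
    ∃ X' : P → Y, ContDiff ℝ ∞ X' ∧ X' =ᶠ[𝓝 z₀] X := by
  obtain ⟨ε, hε, h⟩ := Metric.eventually_nhds_iff_ball.1 hX
  let φ : ContDiffBump z₀ := ⟨ε / 4, ε / 2, by positivity, by linarith⟩
  refine ⟨fun z => φ z • X z, contDiff_iff_contDiffAt.2 fun z => ?_, ?_⟩
  · by_cases hz : z ∈ Metric.ball z₀ ε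
    · exact φ.contDiffAt.smul (h z hz)
    · have hz' : z ∉ tsupport φ := by
        rw [φ.tsupport_eq]
        intro h'
        have := Metric.mem_closedBall.1 h'
        simp only [Metric.mem_ball, not_lt] at hz
        simp only [φ] at this
        linarith
      have : (fun z => φ z • X z) =ᶠ[𝓝 z] fun _ => 0 := by
        filter_upwards [notMem_tsupport_iff_eventuallyEq.1 hz'] with y hy
        simp [hy]
      exact contDiffAt_const.congr_of_eventuallyEq this
  · filter_upwards [φ.eventuallyEq_one] with z hz
    simp [hz]

end

noncomputable section

/-! ### Smooth local exponential of a finite family of vector fields -/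

/-- Balls around `0` are star-shaped. -/
lemma eventually_forall_smul {P : Type*} [NormedAddCommGroup P] {m : ℕ} {z₀ : P}
    {p : P × (Fin m → ℝ) → Prop} (h : ∀ᶠ v in 𝓝 (z₀, (0 : Fin m → ℝ)), p v) :
    ∀ᶠ v in 𝓝 (z₀, (0 : Fin m → ℝ)), ∀ t ∈ Icc (0 : ℝ) 1, p (v.1, t • v.2) := by
  rw [nhds_prod_eq] at h ⊢
  obtain ⟨U, hU, B, hB, h⟩ := Filter.eventually_prod_iff.1 h
  obtain ⟨δ, hδ, hδB⟩ := Metric.eventually_nhds_iff_ball.1 hB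
  refine Filter.eventually_prod_iff.2 ⟨U, hU, fun c => c ∈ Metric.ball 0 δ,
    Metric.ball_mem_nhds _ hδ, fun {z} hz {c} hc t ht => h hz (hδB _ ?_)⟩
  replace hc : ‖c‖ < δ := mem_ball_zero_iff.1 hc
  rw [mem_ball_zero_iff, norm_smul, Real.norm_of_nonneg ht.1]
  exact (mul_le_of_le_one_left (norm_nonneg _) ht.2).trans_lt hc

/-- Constant maps, as a continuous linear map. -/
def constMapL (K P : Type*) [TopologicalSpace K] [CompactSpace K] [NormedAddCommGroup P]
    [NormedSpace ℝ P] : P →L[ℝ] C(K, P) :=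
  LinearMap.mkContinuous
    { toFun := fun z => ContinuousMap.const K z
      map_add' := fun _ _ => by ext; simp
      map_smul' := fun _ _ => by ext; simp } 1 (fun z => by
      rw [ContinuousMap.norm_le _ (by positivity)]
      simp)

@[simp] lemma constMapL_apply {K P : Type*} [TopologicalSpace K] [CompactSpace K]
    [NormedAddCommGroup P] [NormedSpace ℝ P] (z : P) (t : K) : constMapL K P z t = z := rfl

section

variable {P : Type*} [NormedAddCommGroup P] [NormedSpace ℝ P] {m : ℕ}

/-- The map whose zeros are the solutions on `[0, 1]` of the integral equation
`γ(t) = z + ∑ cᵢ ∫₀ᵗ Xᵢ(γ)`. -/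
def integralDefect (X : Fin m → C(P, P)) (v : (P × (Fin m → ℝ)) × C(Icc (0 : ℝ) 1, P)) :
    C(Icc (0 : ℝ) 1, P) :=
  v.2 - constMapL _ P v.1.1 - ∑ i, v.1.2 i • volterraL P ((X i).comp v.2)

lemma contDiff_integralDefect {X : Fin m → C(P, P)} (hX : ∀ i, ContDiff ℝ ∞ (X i)) :
    ContDiff ℝ ∞ (integralDefect X) := by
  rw [contDiff_infty]
  intro n
  have h1 : ContDiff ℝ n fun v : (P × (Fin m → ℝ)) × C(Icc (0 : ℝ) 1, P) => v.1.1 := by fun_prop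
  have h2 : ∀ i, ContDiff ℝ n fun v : (P × (Fin m → ℝ)) × C(Icc (0 : ℝ) 1, P) => v.1.2 i := by
    fun_prop
  exact (contDiff_snd.sub ((constMapL _ P).contDiff.comp h1)).sub
    (ContDiff.sum fun i _ => (h2 i).smul ((volterraL P).contDiff.comp
      ((contDiff_comp_left n (hX i)).comp contDiff_snd)))

lemma integralDefect_eq_zero_iff {X : Fin m → C(P, P)} {z : P} {c : Fin m → ℝ}
    {γ : C(Icc (0 : ℝ) 1, P)} : integralDefect X ((z, c), γ) = 0 ↔
    ∀ t : Icc (0 : ℝ) 1, γ t =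
      z + ∑ i, c i • ∫ s in (0 : ℝ)..t, X i (γ (projIcc 0 1 zero_le_one s)) := by
  rw [ContinuousMap.ext_iff]
  refine forall_congr' fun t => ?_
  simp only [integralDefect, ContinuousMap.sub_apply, constMapL_apply, ContinuousMap.coe_sum,
    Finset.sum_apply, ContinuousMap.coe_smul, Pi.smul_apply, volterraL_apply,
    ContinuousMap.comp_apply, ContinuousMap.zero_apply]
  rw [sub_sub, sub_eq_zero]

/-- Reparametrisation `t ↦ γ(s t)`, for `s ∈ [0, 1]`. -/
def rescale (s : Icc (0 : ℝ) 1) (γ : C(Icc (0 : ℝ) 1, P)) : C(Icc (0 : ℝ) 1, P) :=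
  ⟨fun t => γ ⟨s * t, mul_nonneg s.2.1 t.2.1, mul_le_one₀ s.2.2 t.2.1 t.2.2⟩, by fun_prop⟩

/-- Slowing time by the factor `s` is the same as scaling the coefficients by `s`. This makes the
time-one map recover the whole trajectory. -/
lemma integralDefect_rescale {X : Fin m → C(P, P)} {z : P} {c : Fin m → ℝ}
    {γ : C(Icc (0 : ℝ) 1, P)} (h : integralDefect X ((z, c), γ) = 0) (s : Icc (0 : ℝ) 1) :
    integralDefect X ((z, (s : ℝ) • c), rescale s γ) = 0 := by
  rw [integralDefect_eq_zero_iff] at h ⊢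
  intro t
  have := h ⟨s * t, mul_nonneg s.2.1 t.2.1, mul_le_one₀ s.2.2 t.2.1 t.2.2⟩
  rw [rescale, ContinuousMap.coe_mk, this]
  congr 1
  refine Finset.sum_congr rfl fun i _ => ?_
  rw [Pi.smul_apply, smul_eq_mul, mul_comm (s : ℝ) (c i), mul_smul]
  congr 1
  have h2 := intervalIntegral.smul_integral_comp_mul_left (a := 0) (b := t)
    (fun τ => X i (γ (projIcc 0 1 zero_le_one τ))) (s : ℝ)
  rw [mul_zero] at h2
  change ∫ τ in (0 : ℝ)..(s * t : ℝ), X i (γ (projIcc 0 1 zero_le_one τ)) = _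
  rw [← h2]
  congr 1
  refine intervalIntegral.integral_congr fun τ hτ => ?_
  rw [uIcc_of_le t.2.1] at hτ
  have hτ1 : τ ∈ Icc (0 : ℝ) 1 := ⟨hτ.1, hτ.2.trans t.2.2⟩
  have hsτ : (s : ℝ) * τ ∈ Icc (0 : ℝ) 1 :=
    ⟨mul_nonneg s.2.1 hτ1.1, mul_le_one₀ s.2.2 hτ1.1 hτ1.2⟩
  simp only [projIcc_of_mem zero_le_one hτ1, projIcc_of_mem zero_le_one hsτ]

/-- The curve solving the integral equation is a smooth implicit function `ψ(z, c)` near the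
constant curve, and `e` is its value at time `1`. -/
lemma exists_local_exp [FiniteDimensional ℝ P] {X : Fin m → P → P} {z₀ : P}
    (hX : ∀ i, ∀ᶠ z in 𝓝 z₀, ContDiffAt ℝ ∞ (X i) z) :
    ∃ e : P × (Fin m → ℝ) → P, (∀ᶠ z in 𝓝 z₀, e (z, 0) = z) ∧
      (∀ᶠ v in 𝓝 (z₀, (0 : Fin m → ℝ)), ContDiffAt ℝ ∞ e v) ∧
      ∀ᶠ v in 𝓝 (z₀, (0 : Fin m → ℝ)), ∀ t ∈ Icc (0 : ℝ) 1,
        HasDerivAt (fun s : ℝ => e (v.1, s • v.2)) (∑ i, v.2 i • X i (e (v.1, t • v.2))) t := by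
  have : CompleteSpace P := FiniteDimensional.complete ℝ P
  choose Xt hXt hXe using fun i => exists_contDiff_eventuallyEq (hX i)
  set Xc : Fin m → C(P, P) := fun i => ⟨Xt i, (hXt i).continuous⟩ with hXc
  have hsm : ContDiff ℝ ∞ (integralDefect Xc) := contDiff_integralDefect hXt
  set u : (P × (Fin m → ℝ)) × C(Icc (0 : ℝ) 1, P) := ((z₀, 0), constMapL _ P z₀) with hu
  have hconst : ∀ z : P, integralDefect Xc ((z, 0), constMapL _ P z) = 0 := fun z => by
    simp [integralDefect]
  -- At `c = 0` the integral terms vanish, so the partial derivative in `γ` is the identity.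
  have hinv : (fderiv ℝ (integralDefect Xc) u ∘L .inr ℝ _ _).IsInvertible := by
    have h1 : HasFDerivAt (fun γ : C(Icc (0 : ℝ) 1, P) => integralDefect Xc ((z₀, 0), γ))
        (fderiv ℝ (integralDefect Xc) u ∘L .inr ℝ _ _) u.2 :=
      HasFDerivAt.comp (g := integralDefect Xc) (f := fun γ => ((z₀, (0 : Fin m → ℝ)), γ)) u.2
        (hsm.differentiable (by simp) u).hasFDerivAt (hasFDerivAt_prodMk_right _ _)
    have h2 : (fun γ : C(Icc (0 : ℝ) 1, P) => integralDefect Xc ((z₀, 0), γ)) =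
        fun γ => γ - constMapL _ P z₀ := by
      ext γ : 1
      simp [integralDefect]
    rw [h2] at h1
    rw [h1.unique ((hasFDerivAt_id _).sub_const _)]
    exact ⟨ContinuousLinearEquiv.refl ℝ _, rfl⟩
  obtain ⟨ψ, hψ0, hψs, hψi⟩ := exists_smooth_implicit
    (Eventually.of_forall fun v => hsm.contDiffAt) (hconst z₀) hinv
  have hu1 : u.1 = (z₀, (0 : Fin m → ℝ)) := rfl
  rw [hu1] at hψ0 hψs
  have one_mem : (1 : ℝ) ∈ Icc (0 : ℝ) 1 := ⟨zero_le_one, le_rfl⟩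
  have hevC : ContDiff ℝ ∞ fun γ : C(Icc (0 : ℝ) 1, P) => γ ⟨1, one_mem⟩ :=
    ContinuousLinearMap.contDiff (LinearMap.mkContinuous
      { toFun := fun γ : C(Icc (0 : ℝ) 1, P) => γ ⟨1, one_mem⟩
        map_add' := fun _ _ => rfl
        map_smul' := fun _ _ => rfl } 1 fun γ => by
      rw [one_mul]
      exact γ.norm_coe_le_norm _)
  refine ⟨fun v => ψ v ⟨1, one_mem⟩, ?_, hψs.mono fun v hv => hevC.contDiffAt.comp v hv, ?_⟩
  · have ht : Tendsto (fun z : P => ((z, (0 : Fin m → ℝ)), constMapL (Icc (0 : ℝ) 1) P z))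
        (𝓝 z₀) (𝓝 u) := Continuous.tendsto (by fun_prop) z₀
    filter_upwards [ht.eventually hψi] with z hz
    rw [hz.1 (hconst z)]
    rfl
  · have hψc : ContinuousAt ψ (z₀, 0) := hψs.self_of_nhds.continuousAt
    obtain ⟨A, hA, B, hB, hAB⟩ := Filter.eventually_prod_iff.1
      (show ∀ᶠ v in 𝓝 u.1 ×ˢ 𝓝 u.2, integralDefect Xc v = 0 ↔ ψ v.1 = v.2 by
        rw [← nhds_prod_eq]; exact hψi)
    have hXe' : ∀ᶠ z in 𝓝 z₀, ∀ i, Xt i z = X i z := eventually_all.2 hXe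
    obtain ⟨ρ, hρ, hρX⟩ := Metric.eventually_nhds_iff_ball.1 hXe'
    obtain ⟨ε, hε, hεB⟩ := Metric.eventually_nhds_iff_ball.1 hB
    have hr : 0 < min ρ ε := lt_min hρ hε
    have hψu : Tendsto (fun v => (v, ψ v)) (𝓝 (z₀, (0 : Fin m → ℝ))) (𝓝 u) := by
      have : ContinuousAt (fun v => (v, ψ v)) (z₀, (0 : Fin m → ℝ)) := continuousAt_id.prodMk hψc
      simpa [ContinuousAt, hψ0, hu] using this
    have hnear : ∀ᶠ v in 𝓝 (z₀, (0 : Fin m → ℝ)),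
        ψ v ∈ Metric.ball (constMapL (Icc (0 : ℝ) 1) P z₀) (min ρ ε) :=
      hψc.eventually (by rw [hψ0]; exact Metric.ball_mem_nhds _ hr)
    filter_upwards [eventually_forall_smul hA, hψu.eventually hψi, hnear,
      eventually_forall_smul hψs] with v hvA hvi hvn hvs t ht
    obtain ⟨z, c⟩ := v
    have hzero : integralDefect Xc ((z, c), ψ (z, c)) = 0 := hvi.2 rfl
    have hpt : ∀ τ, ψ (z, c) τ ∈ Metric.ball z₀ (min ρ ε) := fun τ => by
      have := (ContinuousMap.dist_lt_iff hr).1 (Metric.mem_ball.1 hvn) τ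
      simpa using this
    -- The rescaled curve solves the equation for `s • c` and stays close to the constant curve, so
    -- local uniqueness identifies it with `ψ`. Hence `e (z, s • c)` is the trajectory at time `s`.
    have hresc : ∀ s (hs : s ∈ Icc (0 : ℝ) 1), ψ (z, s • c) = rescale ⟨s, hs⟩ (ψ (z, c)) := by
      intro s hs
      refine (hAB (x := (z, s • c)) (y := rescale ⟨s, hs⟩ (ψ (z, c))) (hvA s hs)
        (hεB _ ?_)).1 (integralDefect_rescale hzero ⟨s, hs⟩)
      refine Metric.mem_ball.2 ((ContinuousMap.dist_lt_iff hε).2 fun τ => ?_)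
      exact (Metric.mem_ball.1 (hpt _)).trans_le (min_le_right _ _)
    have heval : ∀ s (hs : s ∈ Icc (0 : ℝ) 1), ψ (z, s • c) ⟨1, one_mem⟩ = ψ (z, c) ⟨s, hs⟩ := by
      intro s hs
      rw [hresc s hs]
      simp [rescale]
    have hd : HasDerivAt (fun s : ℝ => z + ∑ i, c i •
        ∫ τ in (0 : ℝ)..s, Xc i (ψ (z, c) (projIcc 0 1 zero_le_one τ)))
        (∑ i, c i • Xc i (ψ (z, c) (projIcc 0 1 zero_le_one t))) t := by
      refine (HasDerivAt.fun_sum fun i _ => HasDerivAt.const_smul (c i) ?_).const_add z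
      exact ((by fun_prop : Continuous fun τ =>
        Xc i (ψ (z, c) (projIcc 0 1 zero_le_one τ))).integral_hasStrictDerivAt 0 t).hasDerivAt
    -- The integral equation only gives a derivative within `[0, 1]`. Smoothness of `e` supplies the
    -- two-sided derivative, also at the endpoints, and the two must agree.
    have hdiff : DifferentiableAt ℝ (fun s : ℝ => ψ (z, s • c) ⟨1, one_mem⟩) t := by
      have h1 : ContDiffAt ℝ ∞ (fun v => ψ v ⟨1, one_mem⟩) (z, t • c) :=
        hevC.contDiffAt.comp _ (hvs t ht)
      have h2 : DifferentiableAt ℝ (fun s : ℝ => (z, s • c)) t := by fun_prop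
      exact (h1.differentiableAt (by simp)).comp t h2
    have hwithin : HasDerivWithinAt (fun s : ℝ => ψ (z, s • c) ⟨1, one_mem⟩)
        (∑ i, c i • Xc i (ψ (z, c) (projIcc 0 1 zero_le_one t))) (Icc 0 1) t := by
      refine hd.hasDerivWithinAt.congr (fun s hs => ?_) ?_
      · rw [heval s hs]
        exact integralDefect_eq_zero_iff.1 hzero ⟨s, hs⟩
      · rw [heval t ht]
        exact integralDefect_eq_zero_iff.1 hzero ⟨t, ht⟩
    have huniq := (uniqueDiffOn_Icc (zero_lt_one' ℝ)) t ht
    have := hdiff.hasDerivAt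
    rw [huniq.eq_deriv _ this.hasDerivWithinAt hwithin] at this
    convert this using 1
    refine Finset.sum_congr rfl fun i _ => ?_
    rw [projIcc_of_mem zero_le_one ht, ← heval t ht]
    congr 1
    refine (hρX _ ?_ i).symm
    rw [heval t ht]
    exact Metric.ball_subset_ball (min_le_left _ _) (hpt _)

end

end

noncomputable section

/-! ### Linear differential equations -/

lemma eq_zero_of_linear_ode_of_left {R : ℕ} {q : ℝ → Fin R → ℝ} {A : ℝ → Fin R → Fin R → ℝ}
    (hq : ∀ t ∈ Icc (0 : ℝ) 1, ∀ k, HasDerivAt (fun s => q s k) (∑ l, A t k l * q t l) t)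
    (hA : ∀ k l, ContinuousOn (fun t => A t k l) (Icc 0 1)) (h0 : ∀ k, q 0 k = 0) :
    ∀ t ∈ Icc (0 : ℝ) 1, ∀ k, q t k = 0 := by
  have hAc : ContinuousOn A (Icc 0 1) :=
    continuousOn_pi.2 fun k => continuousOn_pi.2 fun l => hA k l
  obtain ⟨C, hC⟩ := isCompact_Icc.exists_bound_of_continuousOn hAc
  have hd : ∀ t ∈ Icc (0 : ℝ) 1, HasDerivAt q (fun k => ∑ l, A t k l * q t l) t :=
    fun t ht => hasDerivAt_pi.2 (hq t ht)
  have := eq_zero_of_abs_deriv_le_mul_abs_self_of_eq_zero_right (K := R * C)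
    (fun t ht => (hd t ht).continuousAt.continuousWithinAt)
    (fun t ht => (hd t ⟨ht.1, ht.2.le⟩).hasDerivWithinAt) (funext h0) (fun t ht => ?_)
  · exact fun t ht k => congrFun (this t ht) k
  · have hCt := hC t ⟨ht.1, ht.2.le⟩
    have hC0 : 0 ≤ C := (norm_nonneg _).trans hCt
    refine (pi_norm_le_iff_of_nonneg (by positivity)).2 fun k => ?_
    refine (norm_sum_le _ _).trans ?_
    have : ∀ l ∈ Finset.univ, ‖A t k l * q t l‖ ≤ C * ‖q t‖ := fun l _ => by
      rw [norm_mul]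
      exact mul_le_mul (((norm_le_pi_norm _ l).trans (norm_le_pi_norm (A t) k)).trans hCt)
        (norm_le_pi_norm _ l) (norm_nonneg _) hC0
    refine (Finset.sum_le_card_nsmul _ _ _ this).trans ?_
    simp [mul_assoc]

/-- Time reversal turns the final condition into an initial one. -/
lemma eq_zero_of_linear_ode_of_right {R : ℕ} {q : ℝ → Fin R → ℝ} {A : ℝ → Fin R → Fin R → ℝ}
    (hq : ∀ t ∈ Icc (0 : ℝ) 1, ∀ k, HasDerivAt (fun s => q s k) (∑ l, A t k l * q t l) t)
    (hA : ∀ k l, ContinuousOn (fun t => A t k l) (Icc 0 1)) (h1 : ∀ k, q 1 k = 0) :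
    ∀ t ∈ Icc (0 : ℝ) 1, ∀ k, q t k = 0 := by
  have hmem : ∀ t ∈ Icc (0 : ℝ) 1, 1 - t ∈ Icc (0 : ℝ) 1 := fun t ht =>
    ⟨by linarith [ht.2], by linarith [ht.1]⟩
  have := eq_zero_of_linear_ode_of_left (q := fun t => q (1 - t))
    (A := fun t k l => - A (1 - t) k l) (fun t ht k => ?_) (fun k l => ?_) (by simpa using h1)
  · intro t ht k
    simpa using this (1 - t) (hmem t ht) k
  · have h := (hq (1 - t) (hmem t ht) k).scomp t ((hasDerivAt_id t).const_sub 1)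
    simpa [Function.comp_def, Finset.sum_neg_distrib] using h
  · exact ((hA k l).comp (by fun_prop) hmem).neg

/-! ### Hamiltonian vector fields on a vector space -/

section Hamiltonian

variable {P : Type*} [NormedAddCommGroup P] [NormedSpace ℝ P]
  (J : (P →L[ℝ] ℝ) →L[ℝ] P)

/-- The Hamiltonian vector field of `F` for the Poisson tensor `J`. -/
def hv (F : P → ℝ) (z : P) : P := J (fderiv ℝ F z)

/-- The Poisson bracket for the Poisson tensor `J`. -/
def pb (F G : P → ℝ) (z : P) : ℝ := fderiv ℝ G z (hv J F z)

variable {J} {F G H : P → ℝ} {z : P}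

lemma ContDiffAt.hv (hF : ContDiffAt ℝ ∞ F z) : ContDiffAt ℝ ∞ (hv J F) z :=
  J.contDiff.contDiffAt.comp z (hF.fderiv_right (m := ∞) (by simp))

lemma ContDiffAt.pb (hF : ContDiffAt ℝ ∞ F z) (hG : ContDiffAt ℝ ∞ G z) :
    ContDiffAt ℝ ∞ (pb J F G) z :=
  (hG.fderiv_right (m := ∞) (by simp)).clm_apply hF.hv

lemma pb_skew (hJ : ∀ α β : P →L[ℝ] ℝ, α (J β) = -β (J α)) (F G : P → ℝ) (z : P) :
    pb J F G z = -pb J G F z := hJ _ _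

lemma fderiv_hv (hF : ContDiffAt ℝ ∞ F z) (v : P) :
    fderiv ℝ (hv J F) z v = J (fderiv ℝ (fderiv ℝ F) z v) := by
  have h := (hF.fderiv_right (m := ∞) (by simp)).differentiableAt (by simp)
  have : HasFDerivAt (hv J F) (J ∘L fderiv ℝ (fderiv ℝ F) z) z :=
    J.hasFDerivAt.comp z h.hasFDerivAt
  rw [this.fderiv]
  rfl

lemma fderiv_pb (hF : ContDiffAt ℝ ∞ F z) (hG : ContDiffAt ℝ ∞ G z) (v : P) :
    fderiv ℝ (pb J F G) z v =
      fderiv ℝ (fderiv ℝ G) z v (hv J F z) + fderiv ℝ G z (fderiv ℝ (hv J F) z v) := by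
  have h := ((hG.fderiv_right (m := ∞) (by simp)).differentiableAt (by simp)).hasFDerivAt
  have h' := ((hF.hv (J := J)).differentiableAt (by simp)).hasFDerivAt
  have : HasFDerivAt (pb J F G) _ z := h.clm_apply h'
  rw [this.fderiv]
  simp [add_comm]

lemma ContDiffAt.fderiv_fderiv_comm {Y : Type*} [NormedAddCommGroup Y] [NormedSpace ℝ Y]
    {F : P → Y} (hF : ContDiffAt ℝ ∞ F z) (v w : P) :
    fderiv ℝ (fderiv ℝ F) z v w = fderiv ℝ (fderiv ℝ F) z w v :=
  (hF.isSymmSndFDerivAt (by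
    simpa using (by exact_mod_cast le_top : ((2 : ℕ∞) : WithTop ℕ∞) ≤ ∞))) v w

/-- As `J` is constant, only second derivatives of `F` and `G` occur; their symmetry and the
skewness of `J` give the commutator identity `[F⃗, G⃗] = {F, G}⃗`. -/
lemma fderiv_hv_comm (hJ : ∀ α β : P →L[ℝ] ℝ, α (J β) = -β (J α)) (hF : ContDiffAt ℝ ∞ F z)
    (hG : ContDiffAt ℝ ∞ G z) :
    fderiv ℝ (hv J G) z (hv J F z) - fderiv ℝ (hv J F) z (hv J G z) = hv J (pb J F G) z := by
  rw [fderiv_hv hG, fderiv_hv hF, ← map_sub]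
  refine congrArg J (ContinuousLinearMap.ext fun v => ?_)
  rw [fderiv_pb hF hG, fderiv_hv hF, sub_apply, hG.fderiv_fderiv_comm,
    hF.fderiv_fderiv_comm, hJ]
  rw [sub_eq_add_neg]
  rfl

/-- Both sides are the derivative of `H` along `[F⃗, G⃗]`; the second derivatives of `H` cancel by
symmetry. -/
lemma pb_jacobi (hJ : ∀ α β : P →L[ℝ] ℝ, α (J β) = -β (J α)) (hF : ContDiffAt ℝ ∞ F z)
    (hG : ContDiffAt ℝ ∞ G z) (hH : ContDiffAt ℝ ∞ H z) :
    pb J F (pb J G H) z - pb J G (pb J F H) z = pb J (pb J F G) H z := by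
  change fderiv ℝ (pb J G H) z _ - fderiv ℝ (pb J F H) z _ = fderiv ℝ H z (hv J (pb J F G) z)
  rw [fderiv_pb hG hH, fderiv_pb hF hH, ← fderiv_hv_comm hJ hF hG, map_sub,
    hH.fderiv_fderiv_comm]
  ring

lemma fderiv_sum_mul {R : ℕ} {b G : Fin R → P → ℝ} (hb : ∀ k, DifferentiableAt ℝ (b k) z)
    (hG : ∀ k, DifferentiableAt ℝ (G k) z) (h0 : ∀ k, G k z = 0) :
    fderiv ℝ (fun y => ∑ k, b k y * G k y) z = ∑ k, b k z • fderiv ℝ (G k) z := by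
  have : HasFDerivAt (fun y => ∑ k, b k y * G k y) _ z :=
    HasFDerivAt.fun_sum fun k _ => (hb k).hasFDerivAt.mul (hG k).hasFDerivAt
  rw [this.fderiv]
  simp [h0]

end Hamiltonian

/-! ### Local exponentials -/

section LocalExp

variable {P : Type*} [NormedAddCommGroup P] [NormedSpace ℝ P] {m : ℕ}

/-- On `U × B(0, δ)` the map `e` is the smooth time-one map `e (z, c) = exp(∑ cᵢ Xᵢ)(z)`, the
trajectories staying in `Ω`. -/
structure IsLocalExp (X : Fin m → P → P) (e : P × (Fin m → ℝ) → P) (U : Set P) (δ : ℝ)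
    (Ω : Set P) : Prop where
  isOpen : IsOpen U
  pos : 0 < δ
  smooth : ∀ v ∈ U ×ˢ Metric.ball (0 : Fin m → ℝ) δ, ContDiffAt ℝ ∞ e v
  mem : ∀ v ∈ U ×ˢ Metric.ball (0 : Fin m → ℝ) δ, e v ∈ Ω
  zero : ∀ z ∈ U, e (z, 0) = z
  deriv : ∀ v ∈ U ×ˢ Metric.ball (0 : Fin m → ℝ) δ, ∀ t ∈ Icc (0 : ℝ) 1,
    HasDerivAt (fun s : ℝ => e (v.1, s • v.2)) (∑ i, v.2 i • X i (e (v.1, t • v.2))) t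
  unit : ∀ v ∈ U ×ˢ Metric.ball (0 : Fin m → ℝ) δ, IsUnit (fderiv ℝ e v ∘L .inl ℝ P (Fin m → ℝ))

lemma smul_mem_ball_zero {V : Type*} [NormedAddCommGroup V] [NormedSpace ℝ V] {δ : ℝ} {c : V}
    (hc : c ∈ Metric.ball (0 : V) δ) {t : ℝ} (ht : t ∈ Icc (0 : ℝ) 1) :
    t • c ∈ Metric.ball (0 : V) δ := by
  rw [mem_ball_zero_iff] at hc ⊢
  rw [norm_smul, Real.norm_of_nonneg ht.1]
  exact (mul_le_of_le_one_left (norm_nonneg _) ht.2).trans_lt hc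

/-- The map `e` is fixed before the predicate `p`, so that its domain can be shrunk again according
to objects constructed from `e`. -/
lemma exists_isLocalExp [FiniteDimensional ℝ P] {X : Fin m → P → P} {z₀ : P} {Ω : Set P}
    (hΩ : Ω ∈ 𝓝 z₀) (hX : ∀ i, ∀ᶠ z in 𝓝 z₀, ContDiffAt ℝ ∞ (X i) z) :
    ∃ e : P × (Fin m → ℝ) → P, (∀ᶠ v in 𝓝 (z₀, (0 : Fin m → ℝ)), ContDiffAt ℝ ∞ e v) ∧
      (∀ᶠ z in 𝓝 z₀, e (z, 0) = z) ∧
      ∀ p : P × (Fin m → ℝ) → Prop, (∀ᶠ v in 𝓝 (z₀, (0 : Fin m → ℝ)), p v) →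
      ∃ U δ, z₀ ∈ U ∧ IsLocalExp X e U δ Ω ∧
        ∀ v ∈ U ×ˢ Metric.ball (0 : Fin m → ℝ) δ, p v := by
  have : CompleteSpace P := FiniteDimensional.complete ℝ P
  obtain ⟨e, he0, hes, hed⟩ := exists_local_exp hX
  refine ⟨e, hes, he0, fun p hp => ?_⟩
  have hz : e (z₀, 0) = z₀ := he0.self_of_nhds
  have hcd := hes.self_of_nhds
  have hmem : ∀ᶠ v in 𝓝 (z₀, (0 : Fin m → ℝ)), e v ∈ Ω :=
    hcd.continuousAt.eventually (by rw [hz]; exact hΩ)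
  have hunit : ∀ᶠ v in 𝓝 (z₀, (0 : Fin m → ℝ)),
      IsUnit (fderiv ℝ e v ∘L .inl ℝ P (Fin m → ℝ)) := by
    have hc : ContinuousAt (fun v => fderiv ℝ e v ∘L .inl ℝ P (Fin m → ℝ)) (z₀, 0) :=
      ((hcd.fderiv_right (m := 0) (by simp)).continuousAt).clm_comp continuousAt_const
    have h1 : fderiv ℝ e (z₀, 0) ∘L .inl ℝ P (Fin m → ℝ) = 1 := by
      have h2 : HasFDerivAt (fun z => e (z, (0 : Fin m → ℝ)))
          (fderiv ℝ e (z₀, 0) ∘L .inl ℝ P (Fin m → ℝ)) z₀ :=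
        HasFDerivAt.comp (g := e) (f := fun z => (z, (0 : Fin m → ℝ))) z₀
          (hcd.differentiableAt (by simp)).hasFDerivAt (hasFDerivAt_prodMk_left _ _)
      exact h2.unique ((hasFDerivAt_id z₀).congr_of_eventuallyEq he0)
    exact hc.eventually (by beta_reduce; rw [h1]; exact Units.nhds (1 : (P →L[ℝ] P)ˣ))
  have hall := (hes.and hmem).and (hed.and (hunit.and hp))
  rw [nhds_prod_eq] at hall
  obtain ⟨A, hA, B, hB, hAB⟩ := Filter.eventually_prod_iff.1 hall
  obtain ⟨U, hUA, hU, hzU⟩ := eventually_nhds_iff.1 (hA.and he0)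
  obtain ⟨δ, hδ, hδB⟩ := Metric.eventually_nhds_iff_ball.1 hB
  have key := fun v (hv : v ∈ U ×ˢ Metric.ball (0 : Fin m → ℝ) δ) =>
    hAB (hUA v.1 hv.1).1 (hδB v.2 hv.2)
  exact ⟨U, δ, hzU, ⟨hU, hδ, fun v hv => (key v hv).1.1, fun v hv => (key v hv).1.2,
    fun z hz => (hUA z hz).2, fun v hv => (key v hv).2.1, fun v hv => (key v hv).2.2.1⟩,
    fun v hv => (key v hv).2.2.2⟩

namespace IsLocalExp

variable {X : Fin m → P → P} {e : P × (Fin m → ℝ) → P} {U : Set P} {δ : ℝ} {Ω : Set P}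

lemma isOpen_prod (he : IsLocalExp X e U δ Ω) :
    IsOpen (U ×ˢ Metric.ball (0 : Fin m → ℝ) δ) := he.isOpen.prod Metric.isOpen_ball

variable {z : P} {c : Fin m → ℝ}

lemma hasDerivAt_fderiv (he : IsLocalExp X e U δ Ω) (hz : z ∈ U) (hc : c ∈ Metric.ball 0 δ)
    {t : ℝ} (ht : t ∈ Icc (0 : ℝ) 1) : HasDerivAt (fun s : ℝ => fderiv ℝ e (z, s • c))
      (fderiv ℝ (fderiv ℝ e) (z, t • c) (0, c)) t := by
  have h1 := ((he.smooth (z, t • c) ⟨hz, smul_mem_ball_zero hc ht⟩).fderiv_right (m := ∞) (by simp)).differentiableAt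
    (by simp)
  have h2 : HasDerivAt (fun s : ℝ => (z, s • c)) ((0 : P), c) t := by
    simpa using (hasDerivAt_const t z).prodMk ((hasDerivAt_id t).smul_const c)
  exact h1.hasFDerivAt.comp_hasDerivAt t h2

lemma fderiv_apply_self (he : IsLocalExp X e U δ Ω) (hz : z ∈ U) (hc : c ∈ Metric.ball 0 δ)
    {t : ℝ} (ht : t ∈ Icc (0 : ℝ) 1) :
    fderiv ℝ e (z, t • c) (0, c) = ∑ i, c i • X i (e (z, t • c)) := by
  have h1 := (he.smooth (z, t • c) ⟨hz, smul_mem_ball_zero hc ht⟩).differentiableAt (by simp)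
  have h2 : HasDerivAt (fun s : ℝ => (z, s • c)) ((0 : P), c) t := by
    simpa using (hasDerivAt_const t z).prodMk ((hasDerivAt_id t).smul_const c)
  exact (h1.hasFDerivAt.comp_hasDerivAt t h2).unique (he.deriv (z, c) ⟨hz, hc⟩ t ht)

/-- The variational equation. -/
lemma variation (he : IsLocalExp X e U δ Ω) (hX : ∀ i, ∀ y ∈ Ω, ContDiffAt ℝ ∞ (X i) y)
    (hz : z ∈ U) (hc : c ∈ Metric.ball 0 δ) {t : ℝ} (ht : t ∈ Icc (0 : ℝ) 1) (v : P)
    (w : Fin m → ℝ) :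
    HasDerivAt (fun s : ℝ => fderiv ℝ e (z, s • c) (v, s • w))
      (∑ i, (c i • fderiv ℝ (X i) (e (z, t • c)) (fderiv ℝ e (z, t • c) (v, t • w)) +
        w i • X i (e (z, t • c)))) t := by
  have hm : (z, t • c) ∈ U ×ˢ Metric.ball (0 : Fin m → ℝ) δ := ⟨hz, smul_mem_ball_zero hc ht⟩
  have hsm := he.smooth _ hm
  have h1 : HasDerivAt (fun s : ℝ => fderiv ℝ e (z, s • c) (v, s • w))
      (fderiv ℝ (fderiv ℝ e) (z, t • c) (0, c) (v, t • w) +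
        fderiv ℝ e (z, t • c) (0, w)) t := by
    have h2 : HasDerivAt (fun s : ℝ => (v, s • w)) ((0 : P), w) t := by
      simpa using (hasDerivAt_const t v).prodMk ((hasDerivAt_id t).smul_const w)
    exact (he.hasDerivAt_fderiv hz hc ht).clm_apply h2
  convert h1 using 1
  -- differentiate `De(z, tc)(0, c) = ∑ cᵢ Xᵢ(e(z, tc))` with respect to `(z, c)`
  let S : P × (Fin m → ℝ) →L[ℝ] P × (Fin m → ℝ) :=
    (ContinuousLinearMap.fst ℝ _ _).prod (t • ContinuousLinearMap.snd ℝ _ _)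
  let T : P × (Fin m → ℝ) →L[ℝ] P × (Fin m → ℝ) :=
    (0 : P × (Fin m → ℝ) →L[ℝ] P).prod (ContinuousLinearMap.snd ℝ _ _)
  have hS : ∀ y, S y = (y.1, t • y.2) := fun y => rfl
  have hT : ∀ y, T y = (0, y.2) := fun y => rfl
  have hev : (fun y => fderiv ℝ e (S y) (T y)) =ᶠ[𝓝 (z, c)]
      fun y => ∑ i, y.2 i • X i (e (S y)) := by
    filter_upwards [he.isOpen_prod.mem_nhds (x := (z, c)) ⟨hz, hc⟩] with y hy
    exact he.fderiv_apply_self hy.1 hy.2 ht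
  have hL : HasFDerivAt (fun y => fderiv ℝ e (S y) (T y)) _ (z, c) :=
    HasFDerivAt.clm_apply
      (HasFDerivAt.comp (z, c) (g := fderiv ℝ e)
        ((hsm.fderiv_right (m := ∞) (by simp)).differentiableAt (by simp)).hasFDerivAt
        S.hasFDerivAt) T.hasFDerivAt
  have hR : HasFDerivAt (fun y : P × (Fin m → ℝ) => ∑ i, y.2 i • X i (e (S y))) _ (z, c) :=
    HasFDerivAt.fun_sum fun i _ => HasFDerivAt.smul
      ((ContinuousLinearMap.proj i ∘L ContinuousLinearMap.snd ℝ P (Fin m → ℝ)).hasFDerivAt)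
      (HasFDerivAt.comp (z, c) (g := X i)
        ((hX i _ (he.mem _ hm)).differentiableAt (by simp)).hasFDerivAt
        (HasFDerivAt.comp (z, c) (g := e) (hsm.differentiableAt (by simp)).hasFDerivAt
          S.hasFDerivAt))
  have := DFunLike.congr_fun (hL.unique (hR.congr_of_eventuallyEq hev)) (v, w)
  simp only [add_apply, ContinuousLinearMap.comp_apply,
    ContinuousLinearMap.flip_apply, sum_apply, smul_apply,
    ContinuousLinearMap.smulRight_apply, ContinuousLinearMap.proj_apply,
    ContinuousLinearMap.coe_snd', hS, hT] at this
  rw [← this, hsm.fderiv_fderiv_comm, add_comm]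

end IsLocalExp

end LocalExp

end

/-! ### Hamiltonian frames, invariance of `{G = 0}` and transport of its characteristic directions
-/

noncomputable section

section

variable {P : Type*} [NormedAddCommGroup P] [NormedSpace ℝ P] {m R : ℕ}

namespace IsLocalExp

variable {X : Fin m → P → P} {e : P × (Fin m → ℝ) → P} {U : Set P} {δ : ℝ} {Ω : Set P} {z : P}

lemma zero_mem (he : IsLocalExp X e U δ Ω) (hz : z ∈ U) :
    (z, (0 : Fin m → ℝ)) ∈ U ×ˢ Metric.ball (0 : Fin m → ℝ) δ :=
  ⟨hz, Metric.mem_ball_self he.pos⟩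

lemma fderiv_zero (he : IsLocalExp X e U δ Ω) (hz : z ∈ U) (v : P) (w : Fin m → ℝ) :
    fderiv ℝ e (z, 0) (v, w) = v + ∑ i, w i • X i z := by
  have hd := ((he.smooth _ (he.zero_mem hz)).differentiableAt (by simp)).hasFDerivAt
  have h1 : fderiv ℝ e (z, 0) (v, 0) = v := by
    have h2 : HasFDerivAt (fun y => e (y, (0 : Fin m → ℝ)))
        (fderiv ℝ e (z, 0) ∘L .inl ℝ P (Fin m → ℝ)) z :=
      HasFDerivAt.comp (g := e) (f := fun y => (y, (0 : Fin m → ℝ))) z hd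
        (hasFDerivAt_prodMk_left _ _)
    have h3 := h2.unique ((hasFDerivAt_id z).congr_of_eventuallyEq
      (by filter_upwards [he.isOpen.mem_nhds hz] with y hy using he.zero y hy))
    exact DFunLike.congr_fun h3 v
  have h2 : fderiv ℝ e (z, 0) (0, w) = ∑ i, w i • X i z := by
    -- The flow equation is available only for small coefficients; both sides are linear in `w`, so
    -- a small positive multiple suffices.
    obtain ⟨r, hr, hrw⟩ : ∃ r : ℝ, 0 < r ∧ r • w ∈ Metric.ball (0 : Fin m → ℝ) δ := by
      have ht : Tendsto (fun r : ℝ => r • w) (𝓝[>] 0) (𝓝 0) := by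
        have : Continuous fun r : ℝ => r • w := by fun_prop
        simpa using (this.tendsto 0).mono_left nhdsWithin_le_nhds
      obtain ⟨r, h, hr⟩ := ((ht.eventually (Metric.ball_mem_nhds _ he.pos)).and
        self_mem_nhdsWithin).exists
      exact ⟨r, hr, h⟩
    have h := he.fderiv_apply_self hz hrw (t := 0) ⟨le_rfl, zero_le_one⟩
    rw [zero_smul, he.zero z hz] at h
    have h0 : ((0 : P), r • w) = r • ((0 : P), w) := by simp
    rw [h0, map_smul] at h
    simp only [Pi.smul_apply, smul_eq_mul, mul_smul, ← Finset.smul_sum] at h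
    exact smul_right_injective P hr.ne' h
  rw [← h2]
  conv_rhs => rw [← h1]
  rw [← map_add]
  simp

/-- At `c = 0` the derivative in `c` of `Q(e(z, c))` is `w ↦ dQ(∑ wⱼ Xⱼ)`, an endomorphism of `ℝ^m`,
so its injectivity is enough for the implicit function theorem. -/
lemma exists_implicit [CompleteSpace P] (he : IsLocalExp X e U δ Ω) (hz : z ∈ U)
    {Q : Fin m → P → ℝ}
    (hQ : ∀ i, ∀ᶠ y in 𝓝 z, ContDiffAt ℝ ∞ (Q i) y) (hQ0 : ∀ i, Q i z = 0)
    (hinj : ∀ w : Fin m → ℝ, (∀ i, fderiv ℝ (Q i) z (∑ j, w j • X j z) = 0) → w = 0) :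
    ∃ ψ : P → Fin m → ℝ, ψ z = 0 ∧ (∀ᶠ y in 𝓝 z, ContDiffAt ℝ ∞ ψ y) ∧
      ∀ᶠ v in 𝓝 (z, (0 : Fin m → ℝ)), (∀ i, Q i (e v) = 0) ↔ ψ v.1 = v.2 := by
  have hm := he.zero_mem hz
  set f : P × (Fin m → ℝ) → (Fin m → ℝ) := fun v i => Q i (e v) with hf
  have hec : Tendsto e (𝓝 (z, 0)) (𝓝 z) := by
    have := (he.smooth _ hm).continuousAt.tendsto
    rwa [he.zero z hz] at this
  have hsm : ∀ᶠ v in 𝓝 (z, (0 : Fin m → ℝ)), ContDiffAt ℝ ∞ f v := by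
    filter_upwards [hec.eventually (eventually_all.2 hQ), he.isOpen_prod.mem_nhds hm] with v h1 h2
    exact contDiffAt_pi.2 fun i => (h1 i).comp v (he.smooth v h2)
  have hfd : ∀ w, (fderiv ℝ f (z, 0) ∘L .inr ℝ P (Fin m → ℝ)) w =
      fun i => fderiv ℝ (Q i) z (∑ j, w j • X j z) := by
    intro w
    ext i
    have h1 : HasFDerivAt (Q i) (fderiv ℝ (Q i) z) (e (z, 0)) := by
      rw [he.zero z hz]
      exact ((hQ i).self_of_nhds.differentiableAt (by simp)).hasFDerivAt
    have h2 := h1.comp (z, (0 : Fin m → ℝ))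
      ((he.smooth _ hm).differentiableAt (by simp)).hasFDerivAt
    have h3 := hasFDerivAt_pi'.1 ((hsm.self_of_nhds).differentiableAt (by simp)).hasFDerivAt i
    have h4 := DFunLike.congr_fun (h3.unique h2) (0, w)
    simp only [ContinuousLinearMap.comp_apply, he.fderiv_zero hz, zero_add] at h4
    exact h4
  have hinv : (fderiv ℝ f (z, 0) ∘L .inr ℝ P (Fin m → ℝ)).IsInvertible := by
    have hi : Function.Injective
        (fderiv ℝ f (z, 0) ∘L .inr ℝ P (Fin m → ℝ) : (Fin m → ℝ) →ₗ[ℝ] (Fin m → ℝ)) := by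
      refine (injective_iff_map_eq_zero _).2 fun w hw => hinj w fun i => ?_
      exact congrFun ((hfd w).symm.trans hw) i
    refine ⟨(LinearEquiv.ofInjectiveEndo _ hi).toContinuousLinearEquiv, ?_⟩
    ext1 w
    rfl
  obtain ⟨ψ, h0, h1, h2⟩ := exists_smooth_implicit hsm
    (funext fun i => by simp [hf, he.zero z hz, hQ0]) hinv
  refine ⟨ψ, h0, h1, ?_⟩
  filter_upwards [h2] with v hv
  rw [← hv, funext_iff]
  rfl

end IsLocalExp

variable (J : (P →L[ℝ] ℝ) →L[ℝ] P)

/-- `H` is a combination of the `G k` with smooth coefficients on `Ω`. -/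
def InSmoothSpan (Ω : Set P) (G : Fin R → P → ℝ) (H : P → ℝ) : Prop :=
  ∃ b : Fin R → P → ℝ, (∀ k, ∀ z ∈ Ω, ContDiffAt ℝ ∞ (b k) z) ∧
    ∀ z ∈ Ω, H z = ∑ k, b k z * G k z

/-- Functions `F₀`, `F i` and independent functions `G k` on `Ω` such that the ideal generated by
the `G k` contains the `F i`, their mutual brackets, and is stable under the brackets with them. -/
structure IsHamFrame (Ω : Set P) (F₀ : P → ℝ) (F : Fin m → P → ℝ) (G : Fin R → P → ℝ) :
    Prop where
  isOpen : IsOpen Ω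
  smooth₀ : ∀ z ∈ Ω, ContDiffAt ℝ ∞ F₀ z
  smooth : ∀ i, ∀ z ∈ Ω, ContDiffAt ℝ ∞ (F i) z
  smoothG : ∀ k, ∀ z ∈ Ω, ContDiffAt ℝ ∞ (G k) z
  gen : ∀ i, InSmoothSpan Ω G (F i)
  comm : ∀ i j, InSmoothSpan Ω G (pb J (F i) (F j))
  inv : ∀ i k, InSmoothSpan Ω G (pb J (F i) (G k))
  surj : ∀ z ∈ Ω, ∀ w : Fin R → ℝ, ∃ v, ∀ k, fderiv ℝ (G k) z v = w k

variable {J} {Ω : Set P} {F₀ : P → ℝ} {F : Fin m → P → ℝ} {G : Fin R → P → ℝ} {z : P}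

namespace IsHamFrame

/-- Where all `G k` vanish, the derivatives of the coefficients drop out. -/
lemma hv_eq_sum (hf : IsHamFrame J Ω F₀ F G) {H : P → ℝ} {b : Fin R → P → ℝ}
    (hb : ∀ k, ∀ z ∈ Ω, ContDiffAt ℝ ∞ (b k) z) (hH : ∀ z ∈ Ω, H z = ∑ k, b k z * G k z)
    (hz : z ∈ Ω) (h0 : ∀ k, G k z = 0) : hv J H z = ∑ k, b k z • hv J (G k) z := by
  have hev : H =ᶠ[𝓝 z] fun y => ∑ k, b k y * G k y := by
    filter_upwards [hf.isOpen.mem_nhds hz] with y hy using hH y hy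
  rw [hv, hev.fderiv_eq, fderiv_sum_mul (fun k => (hb k z hz).differentiableAt (by simp))
    (fun k => (hf.smoothG k z hz).differentiableAt (by simp)) h0, map_sum]
  simp [hv]

lemma pb_eq_zero_of_inSmoothSpan (hf : IsHamFrame J Ω F₀ F G)
    (hJ : ∀ α β : P →L[ℝ] ℝ, α (J β) = -β (J α)) {H : P → ℝ} (hH : InSmoothSpan Ω G H)
    (hz : z ∈ Ω) (h0 : ∀ k, G k z = 0) (h1 : ∀ k, pb J F₀ (G k) z = 0) : pb J H F₀ z = 0 := by
  obtain ⟨b, hb, hbH⟩ := hH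
  rw [pb, hf.hv_eq_sum hb hbH hz h0, map_sum]
  refine Finset.sum_eq_zero fun k _ => ?_
  rw [map_smul]
  change b k z • pb J (G k) F₀ z = 0
  rw [pb_skew hJ, h1, neg_zero, smul_zero]

lemma pb_eq_zero (hf : IsHamFrame J Ω F₀ F G) (hJ : ∀ α β : P →L[ℝ] ℝ, α (J β) = -β (J α))
    (hz : z ∈ Ω) (h0 : ∀ k, G k z = 0) (h1 : ∀ k, pb J F₀ (G k) z = 0) (i : Fin m) :
    pb J F₀ (F i) z = 0 := by
  rw [pb_skew hJ, hf.pb_eq_zero_of_inSmoothSpan hJ (hf.gen i) hz h0 h1, neg_zero]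

/-- By Jacobi the difference is `{{Fᵢ, Fⱼ}, F₀}`, and `{Fᵢ, Fⱼ}` lies in the ideal of the `G k`. -/
lemma legendre_symm (hf : IsHamFrame J Ω F₀ F G) (hJ : ∀ α β : P →L[ℝ] ℝ, α (J β) = -β (J α))
    (hz : z ∈ Ω) (h0 : ∀ k, G k z = 0) (h1 : ∀ k, pb J F₀ (G k) z = 0) (i j : Fin m) :
    pb J (F i) (pb J (F j) F₀) z = pb J (F j) (pb J (F i) F₀) z := by
  rw [← sub_eq_zero, pb_jacobi hJ (hf.smooth i z hz) (hf.smooth j z hz) (hf.smooth₀ z hz)]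
  exact hf.pb_eq_zero_of_inSmoothSpan hJ (hf.comm i j) hz h0 h1

variable {e : P × (Fin m → ℝ) → P} {U : Set P} {δ : ℝ} {c : Fin m → ℝ}

lemma hasDerivAt_comp (he : IsLocalExp (fun i => hv J (F i)) e U δ Ω) (hz : z ∈ U)
    (hc : c ∈ Metric.ball 0 δ) {t : ℝ} (ht : t ∈ Icc (0 : ℝ) 1) {H : P → ℝ}
    (hH : DifferentiableAt ℝ H (e (z, t • c))) :
    HasDerivAt (fun s : ℝ => H (e (z, s • c))) (∑ i, c i * pb J (F i) H (e (z, t • c))) t := by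
  have := hH.hasFDerivAt.comp_hasDerivAt t (he.deriv (z, c) ⟨hz, hc⟩ t ht)
  exact this.congr_deriv (by simp [pb])

lemma continuousOn_curve (he : IsLocalExp (fun i => hv J (F i)) e U δ Ω) (hz : z ∈ U)
    (hc : c ∈ Metric.ball 0 δ) : ContinuousOn (fun t : ℝ => e (z, t • c)) (Icc 0 1) :=
  fun t ht => (he.deriv (z, c) ⟨hz, hc⟩ t ht).continuousAt.continuousWithinAt

lemma curve_mem (he : IsLocalExp (fun i => hv J (F i)) e U δ Ω) (hz : z ∈ U)
    (hc : c ∈ Metric.ball 0 δ) {t : ℝ} (ht : t ∈ Icc (0 : ℝ) 1) : e (z, t • c) ∈ Ω :=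
  he.mem (z, t • c) ⟨hz, smul_mem_ball_zero hc ht⟩

/-- The common zero set of the `G k` is invariant under the flows of the `F i`. -/
lemma flow_mem (hf : IsHamFrame J Ω F₀ F G) (he : IsLocalExp (fun i => hv J (F i)) e U δ Ω)
    (hz : z ∈ U) (hc : c ∈ Metric.ball 0 δ) (h0 : ∀ k, G k z = 0) :
    ∀ t ∈ Icc (0 : ℝ) 1, ∀ k, G k (e (z, t • c)) = 0 := by
  -- The relations `{Fᵢ, G_k} = ∑ aᵢₖₗ G_l` make the values of `G` along the flow a solution of a
  -- linear homogeneous equation.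
  choose a ha hag using hf.inv
  refine eq_zero_of_linear_ode_of_left (q := fun t k => G k (e (z, t • c)))
    (A := fun t k l => ∑ i, c i * a i k l (e (z, t • c))) (fun t ht k => ?_) (fun k l => ?_) ?_
  · have hΩ := curve_mem he hz hc ht
    convert hasDerivAt_comp he hz hc ht ((hf.smoothG k _ hΩ).differentiableAt (by simp)) using 1
    simp only [hag _ _ _ hΩ, Finset.sum_mul, Finset.mul_sum]
    rw [Finset.sum_comm]
    exact Finset.sum_congr rfl fun i _ => Finset.sum_congr rfl fun l _ => by ring
  · refine continuousOn_finsetSum _ fun i _ => continuousOn_const.mul fun t ht => ?_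
    exact ((ha i k l _ (curve_mem he hz hc ht)).continuousAt.comp_continuousWithinAt
      (f := fun t : ℝ => e (z, t • c)) (continuousOn_curve he hz hc t ht))
  · intro k
    simp only [zero_smul, he.zero z hz, h0]

/-- Transport of the characteristic directions of `{G = 0}` by the flows of the `F i`: at a point
of `{G = 0}` that `e (·, c)` maps to a point where the `{F₀, G k}` vanish as well, the differential
of `F₀ ∘ e` kills them, and the variations of `c`. -/
lemma fderiv_comp_exp_eq_zero [CompleteSpace P] (hf : IsHamFrame J Ω F₀ F G)
    (hJ : ∀ α β : P →L[ℝ] ℝ, α (J β) = -β (J α))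
    (he : IsLocalExp (fun i => hv J (F i)) e U δ Ω)
    (hz : z ∈ U) (hc : c ∈ Metric.ball 0 δ) (h0 : ∀ k, G k z = 0)
    (h1 : ∀ k, pb J F₀ (G k) (e (z, c)) = 0) (k₀ : Fin R) (w : Fin m → ℝ) :
    fderiv ℝ F₀ (e (z, c)) (fderiv ℝ e (z, c) (hv J (G k₀) z, w)) = 0 := by
  choose a ha hag using hf.inv
  choose b hb hbF using hf.gen
  have hflow := hf.flow_mem he hz hc h0
  have hX : ∀ i, ∀ y ∈ Ω, ContDiffAt ℝ ∞ (hv J (F i)) y := fun i y hy => (hf.smooth i y hy).hv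
  have hm : ∀ t ∈ Icc (0 : ℝ) 1, (z, t • c) ∈ U ×ˢ Metric.ball (0 : Fin m → ℝ) δ :=
    fun t ht => ⟨hz, smul_mem_ball_zero hc ht⟩
  have one_mem : (1 : ℝ) ∈ Icc (0 : ℝ) 1 := ⟨zero_le_one, le_rfl⟩
  have zero_mem : (0 : ℝ) ∈ Icc (0 : ℝ) 1 := ⟨le_rfl, zero_le_one⟩
  set γ : ℝ → P := fun t => e (z, t • c) with hγ
  have hγΩ : ∀ t ∈ Icc (0 : ℝ) 1, γ t ∈ Ω := fun t ht => curve_mem he hz hc ht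
  -- the linearised flow `M`, its inverse `N`
  set M : ℝ → P →L[ℝ] P := fun t => fderiv ℝ e (z, t • c) ∘L .inl ℝ P (Fin m → ℝ) with hM
  set N : ℝ → P →L[ℝ] P := fun t => Ring.inverse (M t) with hN
  have hunit : ∀ t ∈ Icc (0 : ℝ) 1, IsUnit (M t) := fun t ht => he.unit _ (hm t ht)
  have hMN : ∀ t ∈ Icc (0 : ℝ) 1, ∀ x, M t (N t x) = x := fun t ht x =>
    DFunLike.congr_fun (Ring.mul_inverse_cancel _ (hunit t ht)) x
  set M' : ℝ → P →L[ℝ] P := fun t =>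
    fderiv ℝ (fderiv ℝ e) (z, t • c) (0, c) ∘L .inl ℝ P (Fin m → ℝ) with hM'
  have hMd : ∀ t ∈ Icc (0 : ℝ) 1, HasDerivAt M (M' t) t := fun t ht => by
    simpa using (he.hasDerivAt_fderiv hz hc ht).clm_comp
      (hasDerivAt_const t (ContinuousLinearMap.inl ℝ P (Fin m → ℝ)))
  have hM'v : ∀ t ∈ Icc (0 : ℝ) 1, ∀ x, M' t x =
      ∑ i, c i • fderiv ℝ (hv J (F i)) (γ t) (M t x) := by
    intro t ht x
    have h := he.variation hX hz hc ht x 0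
    simp only [smul_zero, Pi.zero_apply, zero_smul, add_zero] at h
    have h' := (hMd t ht).clm_apply (hasDerivAt_const t x)
    simp only [map_zero, add_zero] at h'
    exact h'.unique h
  have hNd : ∀ t ∈ Icc (0 : ℝ) 1, HasDerivAt N (-(N t * M' t * N t)) t := by
    intro t ht
    have h := (hasFDerivAt_ringInverse (𝕜 := ℝ) (hunit t ht).unit).comp_hasDerivAt t (hMd t ht)
    have hi : N t = ((hunit t ht).unit⁻¹ : (P →L[ℝ] P)ˣ) :=
      Ring.inverse_unit (hunit t ht).unit
    rw [hi]
    exact h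
  set α : P →L[ℝ] ℝ := fderiv ℝ F₀ (e (z, c)) ∘L M 1 with hα
  -- the functions `q_k = α N (hv G_k)` solve a linear equation
  have hq : ∀ t ∈ Icc (0 : ℝ) 1, ∀ k, α (N t (hv J (G k) (γ t))) = 0 := by
    refine eq_zero_of_linear_ode_of_right (q := fun t k => α (N t (hv J (G k) (γ t))))
      (A := fun t k l => ∑ i, c i * a i k l (γ t)) (fun t ht k => ?_) (fun k l => ?_) ?_
    · have hG := (hf.smoothG k _ (hγΩ t ht))
      have hd1 : HasDerivAt (fun s => hv J (G k) (γ s))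
          (fderiv ℝ (hv J (G k)) (γ t) (∑ i, c i • hv J (F i) (γ t))) t :=
        ((hG.hv (J := J)).differentiableAt (by simp)).hasFDerivAt.comp_hasDerivAt t
          (he.deriv (z, c) ⟨hz, hc⟩ t ht)
      have hd2 := α.hasFDerivAt.comp_hasDerivAt t ((hNd t ht).clm_apply hd1)
      refine hd2.congr_deriv ?_
      -- Pulling back by the inverse linearised flow leaves only the commutators of the `F⃗ᵢ` with
      -- `G⃗_k`. These are the fields of `{Fᵢ, G_k}`, hence combinations of the `G⃗_l` along the
      -- curve.
      have e1 : (-(N t * M' t * N t)) (hv J (G k) (γ t)) +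
          N t (fderiv ℝ (hv J (G k)) (γ t) (∑ i, c i • hv J (F i) (γ t))) =
          ∑ i, c i • ∑ l, a i k l (γ t) • N t (hv J (G l) (γ t)) := by
        have : (-(N t * M' t * N t)) (hv J (G k) (γ t)) =
            - N t (M' t (N t (hv J (G k) (γ t)))) := rfl
        rw [this, hM'v t ht, hMN t ht, ← map_neg, ← map_add, map_sum, ← Finset.sum_neg_distrib,
          ← Finset.sum_add_distrib, map_sum]
        refine Finset.sum_congr rfl fun i _ => ?_
        rw [map_smul, neg_add_eq_sub, ← smul_sub, map_smul,
          fderiv_hv_comm hJ (hf.smooth i _ (hγΩ t ht)) hG,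
          hf.hv_eq_sum (ha i k) (hag i k) (hγΩ t ht) (hflow t ht), map_sum]
        simp only [map_smul]
      rw [e1, map_sum]
      simp only [map_smul, map_sum, smul_eq_mul, Finset.sum_mul, Finset.mul_sum]
      rw [Finset.sum_comm]
      exact Finset.sum_congr rfl fun i _ => Finset.sum_congr rfl fun l _ => by ring
    · refine continuousOn_finsetSum _ fun i _ => continuousOn_const.mul fun t ht => ?_
      exact ((ha i k l _ (hγΩ t ht)).continuousAt.comp_continuousWithinAt
        (f := fun t : ℝ => e (z, t • c)) (continuousOn_curve he hz hc t ht))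
    -- At `t = 1` the factor `M 1` in `α` undoes `N 1`, leaving `{G_k, F₀}` at the endpoint; the
    -- linear equation is then solved backwards.
    · intro k
      have : γ 1 = e (z, c) := by simp [hγ]
      rw [hα, ContinuousLinearMap.comp_apply, hMN 1 one_mem, this]
      change pb J (G k) F₀ (e (z, c)) = 0
      rw [pb_skew hJ, h1, neg_zero]
  -- the variation `Y` along the curve
  set Y : ℝ → P := fun t => fderiv ℝ e (z, t • c) (hv J (G k₀) z, t • w) with hY
  have hs : ∀ t ∈ Icc (0 : ℝ) 1, HasDerivAt (fun t => α (N t (Y t))) 0 t := by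
    intro t ht
    have hd2 := α.hasFDerivAt.comp_hasDerivAt t
      ((hNd t ht).clm_apply (he.variation hX hz hc ht (hv J (G k₀) z) w))
    refine hd2.congr_deriv ?_
    change α ((-(N t * M' t * N t)) (Y t) + N t (∑ i, (c i • fderiv ℝ (hv J (F i)) (γ t) (Y t) +
      w i • hv J (F i) (γ t)))) = 0
    have : (-(N t * M' t * N t)) (Y t) = - N t (M' t (N t (Y t))) := rfl
    -- The homogeneous part of the variational equation cancels. The forcing terms `wᵢ F⃗ᵢ` are
    -- combinations of the `G⃗_k` on `{G = 0}`, so `α ∘ N` annihilates them.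
    rw [this, hM'v t ht, hMN t ht, Finset.sum_add_distrib, map_add (N t), neg_add_cancel_left, map_sum,
      map_sum]
    refine Finset.sum_eq_zero fun i _ => ?_
    change α (N t (w i • hv J (F i) (γ t))) = 0
    rw [hf.hv_eq_sum (hb i) (hbF i) (hγΩ t ht) (hflow t ht)]
    simp only [map_smul, map_sum, hq t ht, smul_zero, Finset.sum_const_zero]
  have hconst : α (N 1 (Y 1)) = α (N 0 (Y 0)) := by
    have := constant_of_has_deriv_right_zero (f := fun t => α (N t (Y t))) (a := 0) (b := 1)
      (fun t ht => (hs t ht).continuousAt.continuousWithinAt)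
      (fun t ht => (hs t ⟨ht.1, ht.2.le⟩).hasDerivWithinAt)
    exact this 1 one_mem
  have hY0 : Y 0 = M 0 (hv J (G k₀) z) := by simp [hY, hM]
  have hγ0 : γ 0 = z := by simp [hγ, he.zero z hz]
  have hM0 : M 0 (hv J (G k₀) z) = hv J (G k₀) z := by
    simp [hM, he.fderiv_zero hz]
  have hq0 := hq 0 zero_mem k₀
  rw [hγ0] at hq0
  rw [hY0, hM0, hq0] at hconst
  rw [hα, ContinuousLinearMap.comp_apply, hMN 1 one_mem] at hconst
  simpa [hY] using hconst

end IsHamFrame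

end

end

/-! ### Tangent curves, monotonicity of `F₀`, the local projection, and the differential of `H₀` -/

noncomputable section

section

variable {P : Type*} [NormedAddCommGroup P] [NormedSpace ℝ P] {m R : ℕ}
  {J : (P →L[ℝ] ℝ) →L[ℝ] P} {Ω : Set P} {F₀ : P → ℝ} {F : Fin m → P → ℝ} {G : Fin R → P → ℝ}
  {z : P} {e : P × (Fin m → ℝ) → P} {U : Set P} {δ : ℝ} {c : Fin m → ℝ}

namespace IsHamFrame

/-- A vector killed by the differentials of the `G k` is the velocity of a curve in `{G = 0}`. -/
lemma exists_curve [CompleteSpace P] (hf : IsHamFrame J Ω F₀ F G) (hz : z ∈ Ω)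
    (h0 : ∀ k, G k z = 0) {v : P} (hv : ∀ k, fderiv ℝ (G k) z v = 0) :
    ∃ γ : ℝ → P, γ 0 = z ∧ (∀ᶠ s in 𝓝 (0 : ℝ), γ s ∈ Ω ∧ ∀ k, G k (γ s) = 0) ∧
      ContDiffAt ℝ ∞ γ 0 ∧ HasDerivAt γ v 0 := by
  -- Vectors dual to the `dG_k`: the line `z + s v` is corrected in their span so as to stay in `{G
  -- = 0}`.
  choose η hη using fun k : Fin R => hf.surj z hz (Pi.single k 1)
  set A : ℝ × (Fin R → ℝ) → P := fun y => z + (y.1 • v + ∑ k, y.2 k • η k) with hA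
  have hAs : ContDiff ℝ ∞ A := by fun_prop
  have hA0 : A (0, 0) = z := by simp [hA]
  have hAd : ∀ y w, fderiv ℝ A y w = w.1 • v + ∑ k, w.2 k • η k := by
    intro y w
    let AL : ℝ × (Fin R → ℝ) →L[ℝ] P := (ContinuousLinearMap.fst ℝ ℝ _).smulRight v +
      ∑ k, (ContinuousLinearMap.proj k ∘L ContinuousLinearMap.snd ℝ ℝ (Fin R → ℝ)).smulRight (η k)
    have hAL : A = fun y => z + AL y := by
      ext1 y
      simp [hA, AL]
    rw [hAL, (AL.hasFDerivAt.const_add z).fderiv]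
    simp [AL]
  set f : ℝ × (Fin R → ℝ) → (Fin R → ℝ) := fun y k => G k (A y) with hf'
  have hAt : Tendsto A (𝓝 (0, 0)) (𝓝 z) := by
    have := hAs.continuous.tendsto (0, 0)
    rwa [hA0] at this
  have hsm : ∀ᶠ y in 𝓝 ((0 : ℝ), (0 : Fin R → ℝ)), ContDiffAt ℝ ∞ f y := by
    filter_upwards [hAt.eventually (hf.isOpen.mem_nhds hz)] with y hy
    exact contDiffAt_pi.2 fun k => (hf.smoothG k _ hy).comp y hAs.contDiffAt
  have hfd : ∀ w k, fderiv ℝ f (0, 0) w k = w.2 k := by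
    intro w k
    have h1 : HasFDerivAt (G k) (fderiv ℝ (G k) z) (A (0, 0)) := by
      rw [hA0]
      exact ((hf.smoothG k z hz).differentiableAt (by simp)).hasFDerivAt
    have h2 := h1.comp ((0 : ℝ), (0 : Fin R → ℝ)) (hAs.differentiable (by simp) _).hasFDerivAt
    have h3 := hasFDerivAt_pi'.1 ((hsm.self_of_nhds).differentiableAt (by simp)).hasFDerivAt k
    have h4 := DFunLike.congr_fun (h3.unique h2) w
    simp only [ContinuousLinearMap.comp_apply, hAd, map_add, map_smul, hv, map_sum, hη,
      Pi.single_apply] at h4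
    simpa using h4
  have hinv : (fderiv ℝ f (0, 0) ∘L .inr ℝ ℝ (Fin R → ℝ)).IsInvertible := by
    refine ⟨ContinuousLinearEquiv.refl ℝ _, ?_⟩
    refine ContinuousLinearMap.ext fun w => funext fun k => ?_
    exact (hfd (0, w) k).symm
  obtain ⟨ψ, hψ0, hψs, hψi⟩ := exists_smooth_implicit hsm
    (funext fun k => by simp only [hf', hA0, h0, Pi.zero_apply]) hinv
  simp only at hψ0 hψs
  have hψs0 := hψs.self_of_nhds
  have hpt : Tendsto (fun s : ℝ => (s, ψ s)) (𝓝 0) (𝓝 (0, 0)) := by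
    have : ContinuousAt (fun s : ℝ => (s, ψ s)) 0 := continuousAt_id.prodMk hψs0.continuousAt
    simpa [ContinuousAt, hψ0] using this
  have hzero : ∀ᶠ s in 𝓝 (0 : ℝ), f (s, ψ s) = 0 := (hpt.eventually hψi).mono fun s hs => hs.2 rfl
  have hψd : HasDerivAt ψ 0 0 := by
    have h1 := (hψs0.differentiableAt (by simp)).hasDerivAt
    have h2 : HasFDerivAt f (fderiv ℝ f (0, 0)) ((0 : ℝ), ψ 0) := by
      rw [hψ0]
      exact ((hsm.self_of_nhds).differentiableAt (by simp)).hasFDerivAt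
    have h3 := h2.comp_hasDerivAt (0 : ℝ) ((hasDerivAt_id (0 : ℝ)).prodMk h1)
    have h4 := h3.unique ((hasDerivAt_const (0 : ℝ) (0 : Fin R → ℝ)).congr_of_eventuallyEq hzero)
    -- Since `dG_k(v) = 0`, the correction has no first-order term and the curve has velocity `v`.
    have h5 : deriv ψ 0 = 0 := by
      ext k
      have := congrFun h4 k
      rwa [hfd] at this
    rwa [h5] at h1
  refine ⟨fun s => A (s, ψ s), by simp [hψ0, hA0], ?_, ?_, ?_⟩
  · filter_upwards [hzero, (hAt.comp hpt).eventually (hf.isOpen.mem_nhds hz)] with s hs hs'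
    exact ⟨hs', fun k => congrFun hs k⟩
  · exact hAs.contDiffAt.comp (0 : ℝ) (contDiffAt_id.prodMk hψs0)
  · have h1 : HasFDerivAt A (fderiv ℝ A (0, ψ 0)) ((0 : ℝ), ψ 0) :=
      (hAs.differentiable (by simp) _).hasFDerivAt
    refine (h1.comp_hasDerivAt (0 : ℝ) ((hasDerivAt_id (0 : ℝ)).prodMk hψd)).congr_deriv ?_
    rw [hAd]
    simp

/-- Along a trajectory of `∑ cᵢ F⃗ᵢ` that ends in the zero set of the `{F₀, F i}`, the function `F₀`
is concave with a critical point at the end, hence it does not decrease. -/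
lemma le_exp (hf : IsHamFrame J Ω F₀ F G) (hJ : ∀ α β : P →L[ℝ] ℝ, α (J β) = -β (J α))
    (hL : ∀ y ∈ Ω, ∀ v : Fin m → ℝ, v ≠ 0 →
      ∑ i, ∑ j, v i * v j * pb J (F i) (pb J (F j) F₀) y < 0)
    (he : IsLocalExp (fun i => hv J (F i)) e U δ Ω) (hz : z ∈ U) (hc : c ∈ Metric.ball 0 δ)
    (h1 : ∀ i, pb J F₀ (F i) (e (z, c)) = 0) : F₀ z ≤ F₀ (e (z, c)) := by
  have hΩ : ∀ t ∈ Icc (0 : ℝ) 1, e (z, t • c) ∈ Ω := fun t ht => curve_mem he hz hc ht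
  set h : ℝ → ℝ := fun t => F₀ (e (z, t • c)) with hh
  set h' : ℝ → ℝ := fun t => ∑ i, c i * pb J (F i) F₀ (e (z, t • c)) with hh'
  have hd : ∀ t ∈ Icc (0 : ℝ) 1, HasDerivAt h (h' t) t := fun t ht =>
    hasDerivAt_comp he hz hc ht ((hf.smooth₀ _ (hΩ t ht)).differentiableAt (by simp))
  have hd' : ∀ t ∈ Icc (0 : ℝ) 1, HasDerivAt h'
      (∑ j, c j * ∑ i, c i * pb J (F i) (pb J (F j) F₀) (e (z, t • c))) t := fun t ht =>
    HasDerivAt.fun_sum fun j _ => HasDerivAt.const_mul _ (hasDerivAt_comp he hz hc ht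
      (((hf.smooth j _ (hΩ t ht)).pb (hf.smooth₀ _ (hΩ t ht))).differentiableAt (by simp)))
  have hneg : ∀ y ∈ Ω, ∑ j, c j * ∑ i, c i * pb J (F i) (pb J (F j) F₀) y ≤ 0 := by
    intro y hy
    by_cases hc0 : c = 0
    · simp [hc0]
    · refine le_of_eq_of_le ?_ (hL y hy c hc0).le
      simp only [Finset.mul_sum]
      rw [Finset.sum_comm]
      exact Finset.sum_congr rfl fun i _ => Finset.sum_congr rfl fun j _ => by ring
  have hint : ∀ t ∈ interior (Icc (0 : ℝ) 1), t ∈ Icc (0 : ℝ) 1 := fun t ht => interior_subset ht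
  have hanti : AntitoneOn h' (Icc 0 1) := by
    refine antitoneOn_of_deriv_nonpos (convex_Icc 0 1)
      (fun t ht => (hd' t ht).continuousAt.continuousWithinAt)
      (fun t ht => (hd' t (hint t ht)).differentiableAt.differentiableWithinAt) fun t ht => ?_
    rw [(hd' t (hint t ht)).deriv]
    exact hneg _ (hΩ t (hint t ht))
  have h1' : h' 1 = 0 := by
    simp only [hh', one_smul]
    refine Finset.sum_eq_zero fun i _ => ?_
    rw [pb_skew hJ, h1, neg_zero, mul_zero]
  have hmono : MonotoneOn h (Icc 0 1) := by
    refine monotoneOn_of_deriv_nonneg (convex_Icc 0 1)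
      (fun t ht => (hd t ht).continuousAt.continuousWithinAt)
      (fun t ht => (hd t (hint t ht)).differentiableAt.differentiableWithinAt) fun t ht => ?_
    rw [(hd t (hint t ht)).deriv, ← h1']
    exact hanti (hint t ht) ⟨zero_le_one, le_rfl⟩ (hint t ht).2
  have := hmono ⟨le_rfl, zero_le_one⟩ ⟨zero_le_one, le_rfl⟩ (zero_le_one' ℝ)
  simpa [hh, he.zero z hz] using this

/-- This is the derivative in `c` at `0` of the equations defining `θ`: minus the Legendre matrix
with indices transposed. -/
lemma fderiv_pb_sum (hf : IsHamFrame J Ω F₀ F G) (hJ : ∀ α β : P →L[ℝ] ℝ, α (J β) = -β (J α))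
    (hz : z ∈ Ω) (i : Fin m) (w : Fin m → ℝ) :
    fderiv ℝ (pb J F₀ (F i)) z (∑ j, w j • hv J (F j) z) =
      -∑ j, w j * pb J (F j) (pb J (F i) F₀) z := by
  have hneg : pb J F₀ (F i) = fun y => -pb J (F i) F₀ y := funext fun y => pb_skew hJ _ _ _
  have hd : HasFDerivAt (fun y => -pb J (F i) F₀ y) (-fderiv ℝ (pb J (F i) F₀) z) z :=
    ((((hf.smooth i z hz).pb (hf.smooth₀ z hz)).differentiableAt (by simp)).hasFDerivAt).neg
  rw [hneg, hd.fderiv]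
  simp [pb]

/-- Contracting the hypothesis with `w` gives a zero value of the Legendre form at `w`, which
definiteness allows only for `w = 0`. -/
lemma eq_zero_of_fderiv_pb (hf : IsHamFrame J Ω F₀ F G)
    (hJ : ∀ α β : P →L[ℝ] ℝ, α (J β) = -β (J α))
    (hL : ∀ v : Fin m → ℝ, v ≠ 0 → ∑ i, ∑ j, v i * v j * pb J (F i) (pb J (F j) F₀) z < 0)
    (hz : z ∈ Ω) (w : Fin m → ℝ)
    (hw : ∀ i, fderiv ℝ (pb J F₀ (F i)) z (∑ j, w j • hv J (F j) z) = 0) : w = 0 := by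
  by_contra hne
  refine (hL w hne).ne ?_
  rw [Finset.sum_comm]
  refine Finset.sum_eq_zero fun i _ => ?_
  have := hw i
  rw [hf.fderiv_pb_sum hJ hz, neg_eq_zero] at this
  calc ∑ j, w j * w i * pb J (F j) (pb J (F i) F₀) z
      = w i * ∑ j, w j * pb J (F j) (pb J (F i) F₀) z := by
        rw [Finset.mul_sum]; exact Finset.sum_congr rfl fun j _ => by ring
    _ = 0 := by rw [this, mul_zero]

/-- If `{G = 0, {F₀, G} = 0}` is cut out in `{G = 0}` near `z` by `m` equations with independent
differentials, and the matrix of the `{F i, {F j, F₀}}` is negative definite at `z`, then near `z` it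
is also cut out by the `{F₀, F i}`. -/
lemma eventually_sing [FiniteDimensional ℝ P] (hf : IsHamFrame J Ω F₀ F G)
    (hJ : ∀ α β : P →L[ℝ] ℝ, α (J β) = -β (J α))
    (hL : ∀ v : Fin m → ℝ, v ≠ 0 → ∑ i, ∑ j, v i * v j * pb J (F i) (pb J (F j) F₀) z < 0)
    (hzΩ : z ∈ Ω) (h0 : ∀ k, G k z = 0) (h1 : ∀ k, pb J F₀ (G k) z = 0)
    (he : IsLocalExp (fun i => hv J (F i)) e U δ Ω) (hz : z ∈ U)
    {g : P → Fin m → ℝ} (hg : ∀ᶠ y in 𝓝 z, ContDiffAt ℝ ∞ g y)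
    (hgS : ∀ᶠ y in 𝓝 z, ((∀ k, G k y = 0) ∧ ∀ k, pb J F₀ (G k) y = 0) ↔
      (∀ k, G k y = 0) ∧ g y = 0)
    (hgs : ∀ w : Fin m → ℝ, ∃ v, (∀ k, fderiv ℝ (G k) z v = 0) ∧ fderiv ℝ g z v = w) :
    ∀ᶠ y in 𝓝 z, (∀ k, G k y = 0) → (∀ i, pb J F₀ (F i) y = 0) → ∀ k, pb J F₀ (G k) y = 0 := by
  have : CompleteSpace P := FiniteDimensional.complete ℝ P
  have hΩ : ∀ᶠ y in 𝓝 z, y ∈ Ω := hf.isOpen.mem_nhds hzΩ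
  have hQs : ∀ i, ∀ᶠ y in 𝓝 z, ContDiffAt ℝ ∞ (pb J F₀ (F i)) y := fun i =>
    hΩ.mono fun y hy => (hf.smooth₀ y hy).pb (hf.smooth i y hy)
  have hQ0 : ∀ i, pb J F₀ (F i) z = 0 := hf.pb_eq_zero hJ hzΩ h0 h1
  have hg0 : g z = 0 := (hgS.self_of_nhds.1 ⟨h0, h1⟩).2
  have hgc := fun i => hg.mono fun y hy => contDiffAt_pi.1 hy i
  -- the differentials of the `{F₀, F i}` are combinations of those of `G` and `g`
  have hLag : ∀ x, (∀ k, fderiv ℝ (G k) z x = 0) → fderiv ℝ g z x = 0 →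
      ∀ i, fderiv ℝ (pb J F₀ (F i)) z x = 0 := by
    intro x hx1 hx2 i
    set Gg : P → (Fin R → ℝ) × (Fin m → ℝ) := fun y => (fun k => G k y, g y) with hGg
    have hGs : ContDiffAt ℝ ∞ Gg z :=
      (contDiffAt_pi.2 fun k => hf.smoothG k z hzΩ).prodMk hg.self_of_nhds
    have hGd : ∀ y, fderiv ℝ Gg z y = (fun k => fderiv ℝ (G k) z y, fderiv ℝ g z y) := by
      intro y
      have : HasFDerivAt Gg ((ContinuousLinearMap.pi fun k => fderiv ℝ (G k) z).prod
          (fderiv ℝ g z)) z :=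
        (hasFDerivAt_pi.2 fun k => ((hf.smoothG k z hzΩ).differentiableAt
          (by simp)).hasFDerivAt).prodMk (hg.self_of_nhds.differentiableAt (by simp)).hasFDerivAt
      rw [this.fderiv]
      rfl
    -- The level set is contained in `S` near `z`, and `{F₀, F i}` is zero there. A constant
    -- function has an extremum, so Lagrange multipliers apply.
    have hext : IsLocalExtrOn (pb J F₀ (F i)) {y | Gg y = Gg z} z := by
      refine Or.inl ?_
      change ∀ᶠ y in 𝓝[{y | Gg y = Gg z}] z, pb J F₀ (F i) z ≤ pb J F₀ (F i) y
      filter_upwards [self_mem_nhdsWithin, mem_nhdsWithin_of_mem_nhds hgS,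
        mem_nhdsWithin_of_mem_nhds hΩ] with y hy1 hy2 hy3
      simp only [hGg, Prod.mk.injEq, hg0] at hy1
      have hy0 : ∀ k, G k y = 0 := fun k => (congrFun hy1.1 k).trans (h0 k)
      have := hy2.2 ⟨hy0, hy1.2⟩
      rw [hQ0, hf.pb_eq_zero hJ hy3 this.1 this.2]
    obtain ⟨Λ, Λ₀, hne, hΛ⟩ := hext.exists_linear_map_of_hasStrictFDerivAt
      (hGs.hasStrictFDerivAt (by simp)) ((hQs i).self_of_nhds.hasStrictFDerivAt (by simp))
    -- If `Λ₀` were `0`, then `Λ` would vanish on the range of the differential of `(G, g)`, which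
    -- is everything: `G` is adjusted first, then `g` along the kernel of `dG`.
    have hΛ₀ : Λ₀ ≠ 0 := by
      rintro rfl
      refine hne (Prod.ext (LinearMap.ext fun y => ?_) rfl)
      obtain ⟨v1, hv1⟩ := hf.surj z hzΩ y.1
      obtain ⟨v2, hv2, hv3⟩ := hgs (y.2 - fderiv ℝ g z v1)
      have hy : fderiv ℝ Gg z (v1 + v2) = y := by
        rw [hGd]
        refine Prod.ext (funext fun k => ?_) ?_
        · simp [hv1, hv2]
        · simp [hv3]
      have := hΛ (v1 + v2)
      rw [hy] at this
      simpa using this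
    have := hΛ x
    rw [hGd] at this
    have hx0 : ((fun k => fderiv ℝ (G k) z x, fderiv ℝ g z x) :
        (Fin R → ℝ) × (Fin m → ℝ)) = 0 := Prod.ext (funext hx1) hx2
    rw [hx0, map_zero, zero_add, smul_eq_mul] at this
    exact (mul_eq_zero.1 this).resolve_left hΛ₀
  obtain ⟨ψ, hψ0, hψs, hψi⟩ := he.exists_implicit hz hQs hQ0
    (hf.eq_zero_of_fderiv_pb hJ hL hzΩ)
  have hgd : ∀ i x, fderiv ℝ (fun y => g y i) z x = fderiv ℝ g z x i := fun i x =>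
    DFunLike.congr_fun (hasFDerivAt_pi'.1 (hg.self_of_nhds.differentiableAt
      (by simp)).hasFDerivAt i).fderiv x
  -- The `F⃗ⱼ` are tangent to `{G = 0}` at `z`. So if `dg` kills `∑ wⱼ F⃗ⱼ`, then by `hLag` so do
  -- the `d{F₀, Fᵢ}`, and the Legendre condition gives `w = 0`.
  obtain ⟨χ, hχ0, hχs, hχi⟩ := he.exists_implicit hz (Q := fun i y => g y i) hgc
    (fun i => congrFun hg0 i) (fun w hw => by
      refine hf.eq_zero_of_fderiv_pb hJ hL hzΩ w (hLag _ (fun k => ?_) (funext fun i => ?_))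
      · rw [map_sum]
        refine Finset.sum_eq_zero fun j _ => ?_
        obtain ⟨a, -, hag⟩ := hf.inv j k
        have : fderiv ℝ (G k) z (hv J (F j) z) = 0 := by
          refine (hag z hzΩ).trans (Finset.sum_eq_zero fun l _ => ?_)
          rw [h0, mul_zero]
        rw [map_smul, this, smul_zero]
      · rw [← hgd]
        exact hw i)
  have hec : Tendsto e (𝓝 (z, 0)) (𝓝 z) := by
    have := (he.smooth _ (he.zero_mem hz)).continuousAt.tendsto
    rwa [he.zero z hz] at this
  have hpt : Tendsto (fun y => (y, χ y)) (𝓝 z) (𝓝 (z, 0)) := by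
    have : ContinuousAt (fun y => (y, χ y)) z := continuousAt_id.prodMk hχs.self_of_nhds.continuousAt
    simpa [ContinuousAt, hχ0] using this
  have hpt0 : Tendsto (fun y => (y, (0 : Fin m → ℝ))) (𝓝 z) (𝓝 (z, 0)) :=
    Continuous.tendsto (by fun_prop) z
  filter_upwards [hpt.eventually hχi, hpt.eventually hψi, hpt0.eventually hψi,
    (hec.comp hpt).eventually hgS, (hec.comp hpt).eventually hΩ,
    hpt.eventually (he.isOpen_prod.mem_nhds (he.zero_mem hz))] with y y1 y2 y3 y4 y5 y6 hG hQ
  -- The flow with coefficients `χ y` takes `y` inside `Σ` to a zero of `g`, hence into `S`, where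
  -- the `{F₀, Fᵢ}` vanish; thus `ψ y = χ y`. If they vanish at `y` already, then `ψ y = 0`, so the
  -- point of `S` reached is `y` itself.
  have hG' : ∀ k, G k (e (y, χ y)) = 0 := by
    simpa using hf.flow_mem he y6.1 y6.2 hG 1 ⟨zero_le_one, le_rfl⟩
  have hs := y4.2 ⟨hG', funext (y1.2 rfl)⟩
  have hψχ : ψ y = χ y := y2.1 (hf.pb_eq_zero hJ y5 hs.1 hs.2)
  have hψ0' : ψ y = 0 := y3.1 (by simpa only [he.zero y y6.1] using hQ)
  have hχy : χ y = 0 := hψχ.symm.trans hψ0'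
  have := hs.2
  simpa only [Function.comp_apply, hχy, he.zero y y6.1] using this

/-- Local solution `θ` of `{F₀, F i}(exp(∑ θⱼ F⃗ⱼ)) = 0`. -/
lemma exists_local_projection [FiniteDimensional ℝ P] (hf : IsHamFrame J Ω F₀ F G)
    (hJ : ∀ α β : P →L[ℝ] ℝ, α (J β) = -β (J α))
    (hL : ∀ v : Fin m → ℝ, v ≠ 0 → ∑ i, ∑ j, v i * v j * pb J (F i) (pb J (F j) F₀) z < 0)
    (hzΩ : z ∈ Ω) (h0 : ∀ k, G k z = 0) (h1 : ∀ k, pb J F₀ (G k) z = 0)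
    {g : P → Fin m → ℝ} (hg : ∀ᶠ y in 𝓝 z, ContDiffAt ℝ ∞ g y)
    (hgS : ∀ᶠ y in 𝓝 z, ((∀ k, G k y = 0) ∧ ∀ k, pb J F₀ (G k) y = 0) ↔
      (∀ k, G k y = 0) ∧ g y = 0)
    (hgs : ∀ w : Fin m → ℝ, ∃ v, (∀ k, fderiv ℝ (G k) z v = 0) ∧ fderiv ℝ g z v = w) :
    ∃ (e : P × (Fin m → ℝ) → P) (U : Set P) (δ : ℝ) (θ : P → Fin m → ℝ), z ∈ U ∧ U ⊆ Ω ∧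
      IsLocalExp (fun i => hv J (F i)) e U δ Ω ∧ (∀ y ∈ U, ContDiffAt ℝ ∞ θ y) ∧
      (∀ y ∈ U, ∀ c ∈ Metric.ball (0 : Fin m → ℝ) δ,
        (∀ i, pb J F₀ (F i) (e (y, c)) = 0) ↔ θ y = c) ∧
      ∀ y ∈ U, (∀ k, G k y = 0) → (∀ i, pb J F₀ (F i) y = 0) → ∀ k, pb J F₀ (G k) y = 0 := by
  have : CompleteSpace P := FiniteDimensional.complete ℝ P
  have hΩ : ∀ᶠ y in 𝓝 z, y ∈ Ω := hf.isOpen.mem_nhds hzΩ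
  obtain ⟨e, -, -, he⟩ := exists_isLocalExp (X := fun i => hv J (F i)) (Ω := Ω) hΩ
    (fun i => hΩ.mono fun y hy => (hf.smooth i y hy).hv)
  -- A preliminary domain, on which `θ` is constructed; the same `e` is then restricted to where `θ`
  -- has the required properties.
  obtain ⟨U, δ, hz, he', -⟩ := he (fun _ => True) (Eventually.of_forall fun _ => trivial)
  have hQs : ∀ i, ∀ᶠ y in 𝓝 z, ContDiffAt ℝ ∞ (pb J F₀ (F i)) y := fun i =>
    hΩ.mono fun y hy => (hf.smooth₀ y hy).pb (hf.smooth i y hy)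
  obtain ⟨θ, -, hθs, hθi⟩ := he'.exists_implicit hz hQs (hf.pb_eq_zero hJ hzΩ h0 h1)
    (hf.eq_zero_of_fderiv_pb hJ hL hzΩ)
  have hsing := hf.eventually_sing hJ hL hzΩ h0 h1 he' hz hg hgS hgs
  have hfst : Tendsto Prod.fst (𝓝 (z, (0 : Fin m → ℝ))) (𝓝 z) := continuousAt_fst.tendsto
  obtain ⟨U', δ', hz', he'', hp⟩ := he _ (hθi.and (hfst.eventually (hθs.and (hsing.and hΩ))))
  have hp0 := fun y (hy : y ∈ U') => hp _ (he''.zero_mem hy)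
  exact ⟨e, U', δ', θ, hz', fun y hy => (hp0 y hy).2.2.2, he'', fun y hy => (hp0 y hy).2.1,
    fun y hy c hc => (hp (y, c) ⟨hy, hc⟩).1, fun y hy => (hp0 y hy).2.2.1⟩

section SuperHam

variable {θ : P → Fin m → ℝ}

lemma hasFDerivAt_exp (he : IsLocalExp (fun i => hv J (F i)) e U δ Ω) (hz : z ∈ U)
    (hθ : DifferentiableAt ℝ θ z) (hθm : θ z ∈ Metric.ball 0 δ) {H : P → ℝ}
    (hH : DifferentiableAt ℝ H (e (z, θ z))) :
    HasFDerivAt (fun y => H (e (y, θ y))) (fderiv ℝ H (e (z, θ z)) ∘L fderiv ℝ e (z, θ z) ∘L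
      (ContinuousLinearMap.id ℝ P).prod (fderiv ℝ θ z)) z := by
  have h1 : HasFDerivAt (fun y => (y, θ y)) _ z := (hasFDerivAt_id z).prodMk hθ.hasFDerivAt
  have h2 := ((he.smooth (z, θ z) ⟨hz, hθm⟩).differentiableAt (by simp)).hasFDerivAt
  exact hH.hasFDerivAt.comp z (h2.comp z h1)

lemma contDiffAt_exp (he : IsLocalExp (fun i => hv J (F i)) e U δ Ω) (hz : z ∈ U)
    (hθ : ContDiffAt ℝ ∞ θ z) (hθm : θ z ∈ Metric.ball 0 δ) {H : P → ℝ}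
    (hH : ContDiffAt ℝ ∞ H (e (z, θ z))) : ContDiffAt ℝ ∞ (fun y => H (e (y, θ y))) z := by
  have h1 : ContDiffAt ℝ ∞ (fun y => (y, θ y)) z := contDiffAt_id.prodMk hθ
  exact hH.comp z ((he.smooth (z, θ z) ⟨hz, hθm⟩).comp z h1)

/-- The differential of `H ∘ exp(∑ θⱼ F⃗ⱼ)` at a zero of `θ`. -/
lemma fderiv_exp_of_theta_eq_zero (he : IsLocalExp (fun i => hv J (F i)) e U δ Ω) (hz : z ∈ U)
    (hθ : DifferentiableAt ℝ θ z) (hθ0 : θ z = 0) {H : P → ℝ} (hH : DifferentiableAt ℝ H z)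
    (v : P) : fderiv ℝ (fun y => H (e (y, θ y))) z v =
      fderiv ℝ H z (v + ∑ i, fderiv ℝ θ z v i • hv J (F i) z) := by
  have hez : e (z, θ z) = z := by rw [hθ0, he.zero z hz]
  rw [(hasFDerivAt_exp he hz hθ (by rw [hθ0]; exact Metric.mem_ball_self he.pos)
    (by rwa [hez])).fderiv, hez, hθ0]
  simp [he.fderiv_zero hz]

/-- The differential of the solution `θ` of `{F₀, F i}(exp(∑ θⱼ F⃗ⱼ)) = 0` at a zero of `θ`. -/
lemma fderiv_theta (hf : IsHamFrame J Ω F₀ F G) (hJ : ∀ α β : P →L[ℝ] ℝ, α (J β) = -β (J α))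
    (he : IsLocalExp (fun i => hv J (F i)) e U δ Ω) (hz : z ∈ U) (hzΩ : z ∈ Ω)
    (hθ : DifferentiableAt ℝ θ z) (hθ0 : θ z = 0)
    (hQ : ∀ᶠ y in 𝓝 z, ∀ i, pb J F₀ (F i) (e (y, θ y)) = 0) (i : Fin m) (v : P) :
    fderiv ℝ (pb J F₀ (F i)) z v =
      ∑ j, fderiv ℝ θ z v j * pb J (F j) (pb J (F i) F₀) z := by
  have h := fderiv_exp_of_theta_eq_zero he hz hθ hθ0
    (((hf.smooth₀ z hzΩ).pb (J := J) (hf.smooth i z hzΩ)).differentiableAt (by simp)) v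
  have h0 : (fun y => pb J F₀ (F i) (e (y, θ y))) =ᶠ[𝓝 z] fun _ => 0 := hQ.mono fun y hy => hy i
  rw [h0.fderiv_eq, map_add, hf.fderiv_pb_sum hJ hzΩ] at h
  simp only [fderiv_fun_const, Pi.zero_apply, zero_apply] at h
  linarith

/-- The term with `dθ` only sees `⟨dF₀, F⃗ᵢ⟩ = {Fᵢ, F₀}`, which is zero here. -/
lemma fderiv_superHam_of_sing (hf : IsHamFrame J Ω F₀ F G)
    (hJ : ∀ α β : P →L[ℝ] ℝ, α (J β) = -β (J α))
    (he : IsLocalExp (fun i => hv J (F i)) e U δ Ω) (hz : z ∈ U) (hzΩ : z ∈ Ω)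
    (hθ : DifferentiableAt ℝ θ z) (hθ0 : θ z = 0) (hQ : ∀ i, pb J F₀ (F i) z = 0) :
    fderiv ℝ (fun y => F₀ (e (y, θ y))) z = fderiv ℝ F₀ z := by
  ext v
  rw [fderiv_exp_of_theta_eq_zero he hz hθ hθ0 ((hf.smooth₀ z hzΩ).differentiableAt (by simp)),
    map_add, map_sum, Finset.sum_eq_zero, add_zero]
  intro i _
  have : fderiv ℝ F₀ z (hv J (F i) z) = 0 := by
    change pb J (F i) F₀ z = 0
    rw [pb_skew hJ, hQ, neg_zero]
  rw [map_smul, this, smul_zero]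

/-- By the chain rule this is transport of `G⃗_k` with the variation `dθ(G⃗_k)` of the coefficients.
By skewness it says that `H⃗₀` is tangent to `{G = 0}`. -/
lemma fderiv_superHam_eq_zero [CompleteSpace P] (hf : IsHamFrame J Ω F₀ F G)
    (hJ : ∀ α β : P →L[ℝ] ℝ, α (J β) = -β (J α))
    (he : IsLocalExp (fun i => hv J (F i)) e U δ Ω) (hz : z ∈ U)
    (hθ : DifferentiableAt ℝ θ z) (hθm : θ z ∈ Metric.ball 0 δ) (h0 : ∀ k, G k z = 0)
    (h1 : ∀ k, pb J F₀ (G k) (e (z, θ z)) = 0) (k : Fin R) :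
    fderiv ℝ (fun y => F₀ (e (y, θ y))) z (hv J (G k) z) = 0 := by
  rw [(hasFDerivAt_exp he hz hθ hθm
    ((hf.smooth₀ _ (he.mem (z, θ z) ⟨hz, hθm⟩)).differentiableAt (by simp))).fderiv]
  exact hf.fderiv_comp_exp_eq_zero hJ he hz hθm h0 h1 k _

end SuperHam

end IsHamFrame

end

end

/-! ### Preferred charts of `T*M` and the Liouville and symplectic forms in them -/

noncomputable section

section

variable {E M : Type*} [NormedAddCommGroup E] [NormedSpace ℝ E]
  [TopologicalSpace M] [ChartedSpace E M] [IsManifold 𝓘(ℝ, E) ∞ M]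

/-- The preferred chart of `T*M` at `ℓ₀`. -/
abbrev cotChart (ℓ₀ : Cotangent E M) : PartialEquiv (Cotangent E M) (E × (E →L[ℝ] ℝ)) :=
  extChartAt (cotModel E) ℓ₀

lemma mem_cotChart_source {ℓ₀ ℓ : Cotangent E M} :
    ℓ ∈ (cotChart ℓ₀).source ↔ ℓ.1 ∈ (extChartAt 𝓘(ℝ, E) ℓ₀.1).source := by
  rw [cotChart, FiberBundle.extChartAt]
  simp only [hom_trivializationAt_source, mfld_simps, PartialEquiv.prod_source]
  refine ⟨fun h => ?_, fun h => ?_⟩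
  · simpa using h.1
  · simp only [hom_trivializationAt_apply]
    simpa using h

lemma mem_cotChart_target {ℓ₀ : Cotangent E M} {z : E × (E →L[ℝ] ℝ)} :
    z ∈ (cotChart ℓ₀).target ↔ z.1 ∈ (extChartAt 𝓘(ℝ, E) ℓ₀.1).target := by
  rw [cotChart, FiberBundle.extChartAt_target]
  simp only [mem_prod, mem_inter_iff, mem_univ, and_true, mem_preimage]
  refine ⟨fun h => h.1, fun h => ⟨h, ?_⟩⟩
  have := (extChartAt 𝓘(ℝ, E) ℓ₀.1).map_target h
  simpa using! this

lemma cotChart_apply {ℓ₀ ℓ : Cotangent E M} (h : ℓ ∈ (cotChart ℓ₀).source) :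
    cotChart ℓ₀ ℓ = (extChartAt 𝓘(ℝ, E) ℓ₀.1 ℓ.1,
      ContinuousLinearMap.comp (M₂ := TangentSpace 𝓘(ℝ, E) ℓ.1) (M₃ := ℝ) ℓ.2
        (mfderiv 𝓘(ℝ, E) 𝓘(ℝ, E) (extChartAt 𝓘(ℝ, E) ℓ₀.1).symm
          (extChartAt 𝓘(ℝ, E) ℓ₀.1 ℓ.1))) := by
  have h' := mem_cotChart_source.1 h
  rw [extChartAt_source] at h'
  rw [cotChart, FiberBundle.extChartAt]
  simp [hom_trivializationAt_apply, ContinuousLinearMap.inCoordinates]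
  rw [TangentBundle.symmL_trivializationAt h']
  simp
  rfl

lemma cotChart_mem_target {ℓ₀ ℓ : Cotangent E M} (h : ℓ ∈ (cotChart ℓ₀).source) :
    cotChart ℓ₀ ℓ ∈ (cotChart ℓ₀).target := (cotChart ℓ₀).map_source h

lemma cotChart_symm_fst {ℓ₀ : Cotangent E M} {z : E × (E →L[ℝ] ℝ)}
    (hz : z ∈ (cotChart ℓ₀).target) :
    ((cotChart ℓ₀).symm z).1 = (extChartAt 𝓘(ℝ, E) ℓ₀.1).symm z.1 := by
  have h := (cotChart ℓ₀).map_target hz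
  have h1 := congrArg Prod.fst ((cotChart ℓ₀).right_inv hz)
  rw [cotChart_apply h] at h1
  rw [← h1, (extChartAt 𝓘(ℝ, E) ℓ₀.1).left_inv (mem_cotChart_source.1 h)]

/-- The derivative of the preferred chart at `ℓ₀`. -/
abbrev cotChartDeriv (ℓ₀ ℓ : Cotangent E M) :
    TangentSpace (cotModel E) ℓ →L[ℝ] E × (E →L[ℝ] ℝ) :=
  mfderiv (cotModel E) 𝓘(ℝ, E × (E →L[ℝ] ℝ)) (cotChart ℓ₀) ℓ

/-- The derivative of the inverse of the preferred chart at `ℓ₀`. -/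
abbrev cotChartSymmDeriv (ℓ₀ : Cotangent E M) (z : E × (E →L[ℝ] ℝ)) :
    (E × (E →L[ℝ] ℝ)) →L[ℝ] TangentSpace (cotModel E) ((cotChart ℓ₀).symm z) :=
  mfderiv 𝓘(ℝ, E × (E →L[ℝ] ℝ)) (cotModel E) (cotChart ℓ₀).symm z

lemma mdifferentiableAt_cotChart {ℓ₀ ℓ : Cotangent E M} (h : ℓ ∈ (cotChart ℓ₀).source) :
    MDifferentiableAt (cotModel E) 𝓘(ℝ, E × (E →L[ℝ] ℝ)) (cotChart ℓ₀) ℓ :=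
  mdifferentiableAt_extChartAt (by rwa [extChartAt_source] at h)

lemma mdifferentiableAt_cotChart_symm {ℓ₀ : Cotangent E M} {z : E × (E →L[ℝ] ℝ)}
    (hz : z ∈ (cotChart ℓ₀).target) :
    MDifferentiableAt 𝓘(ℝ, E × (E →L[ℝ] ℝ)) (cotModel E) (cotChart ℓ₀).symm z := by
  have := mdifferentiableWithinAt_extChartAt_symm hz
  rwa [ModelWithCorners.range_eq_univ, mdifferentiableWithinAt_univ] at this

lemma cotChartDeriv_symm {ℓ₀ : Cotangent E M} {z : E × (E →L[ℝ] ℝ)}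
    (hz : z ∈ (cotChart ℓ₀).target) (w : E × (E →L[ℝ] ℝ)) :
    cotChartDeriv ℓ₀ ((cotChart ℓ₀).symm z) (cotChartSymmDeriv ℓ₀ z w) = w := by
  have := mfderiv_extChartAt_comp_mfderivWithin_extChartAt_symm hz
  rw [ModelWithCorners.range_eq_univ, mfderivWithin_univ] at this
  exact DFunLike.congr_fun this w

lemma isInvertible_cotChartDeriv {ℓ₀ ℓ : Cotangent E M} (h : ℓ ∈ (cotChart ℓ₀).source) :
    (cotChartDeriv ℓ₀ ℓ).IsInvertible := isInvertible_mfderiv_extChartAt h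

lemma cotChartDeriv_bijective {ℓ₀ ℓ : Cotangent E M} (h : ℓ ∈ (cotChart ℓ₀).source) :
    Function.Bijective (cotChartDeriv ℓ₀ ℓ) := by
  obtain ⟨e, he⟩ := isInvertible_cotChartDeriv h
  rw [← he]
  exact e.bijective

lemma cotChart_target_mem_nhds {ℓ₀ : Cotangent E M} {z : E × (E →L[ℝ] ℝ)}
    (hz : z ∈ (cotChart ℓ₀).target) : (cotChart ℓ₀).target ∈ 𝓝 z :=
  (isOpen_extChartAt_target ℓ₀).mem_nhds hz

lemma cotChart_source_mem_nhds {ℓ₀ ℓ : Cotangent E M} (h : ℓ ∈ (cotChart ℓ₀).source) :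
    (cotChart ℓ₀).source ∈ 𝓝 ℓ :=
  (isOpen_extChartAt_source ℓ₀).mem_nhds h

/-- No differentiability is needed: differentiability transfers through the chart, and in its
absence both derivatives take the default value `0`. -/
lemma mfderiv_eq_fderiv_cotChart {V : Type*} [NormedAddCommGroup V] [NormedSpace ℝ V]
    (F : Cotangent E M → V) {ℓ₀ ℓ : Cotangent E M} (h : ℓ ∈ (cotChart ℓ₀).source)
    (v : TangentSpace (cotModel E) ℓ) :
    mfderiv (cotModel E) 𝓘(ℝ, V) F ℓ v =
      fderiv ℝ (F ∘ (cotChart ℓ₀).symm) (cotChart ℓ₀ ℓ) (cotChartDeriv ℓ₀ ℓ v) := by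
  have hz := cotChart_mem_target h
  have hl : (cotChart ℓ₀).symm (cotChart ℓ₀ ℓ) = ℓ := (cotChart ℓ₀).left_inv h
  have hev : (F ∘ (cotChart ℓ₀).symm) ∘ cotChart ℓ₀ =ᶠ[𝓝 ℓ] F := by
    filter_upwards [cotChart_source_mem_nhds h] with p hp
    exact congrArg F ((cotChart ℓ₀).left_inv hp)
  by_cases hF : MDifferentiableAt (cotModel E) 𝓘(ℝ, V) F ℓ
  · have h1 : MDifferentiableAt 𝓘(ℝ, E × (E →L[ℝ] ℝ)) 𝓘(ℝ, V) (F ∘ (cotChart ℓ₀).symm)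
        (cotChart ℓ₀ ℓ) :=
      MDifferentiableAt.comp (I' := cotModel E) _ (by rwa [hl])
        (mdifferentiableAt_cotChart_symm hz)
    rw [← hev.mfderiv_eq, mfderiv_comp ℓ h1 (mdifferentiableAt_cotChart h), ← mfderiv_eq_fderiv]
    rfl
  · have h1 : ¬ DifferentiableAt ℝ (F ∘ (cotChart ℓ₀).symm) (cotChart ℓ₀ ℓ) := fun h1 =>
      hF ((hev.mdifferentiableAt_iff (I := cotModel E) (I' := 𝓘(ℝ, V))).1
        (h1.mdifferentiableAt.comp ℓ (mdifferentiableAt_cotChart h)))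
    rw [mfderiv_zero_of_not_mdifferentiableAt hF, fderiv_zero_of_not_differentiableAt h1]
    rfl

/-- The canonical symplectic form of `E × E*`. -/
def canonicalForm (v w : E × (E →L[ℝ] ℝ)) : ℝ := v.2 w.1 - w.2 v.1

lemma cotChart_snd_apply {ℓ₀ ℓ : Cotangent E M} (h : ℓ ∈ (cotChart ℓ₀).source)
    (u : TangentSpace 𝓘(ℝ, E) ℓ.1) :
    (cotChart ℓ₀ ℓ).2 (mfderiv 𝓘(ℝ, E) 𝓘(ℝ, E) (extChartAt 𝓘(ℝ, E) ℓ₀.1) ℓ.1 u) = ℓ.2 u := by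
  have h' := mfderivWithin_extChartAt_symm_comp_mfderiv_extChartAt'
    (I := 𝓘(ℝ, E)) (mem_cotChart_source.1 h)
  rw [ModelWithCorners.range_eq_univ, mfderivWithin_univ] at h'
  rw [cotChart_apply h]
  exact congrArg ℓ.2 (DFunLike.congr_fun h' u)

/-- The chart of `T*M` covers that of `M` and its fibre coordinate is the momentum, so every
preferred chart shows the Liouville form as `ξ dx`. -/
lemma liouvilleForm_eq {ℓ₀ ℓ : Cotangent E M} (h : ℓ ∈ (cotChart ℓ₀).source)
    (v : TangentSpace (cotModel E) ℓ) :
    liouvilleForm ℓ v = (cotChart ℓ₀ ℓ).2 (cotChartDeriv ℓ₀ ℓ v).1 := by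
  have hπ : MDifferentiableAt (cotModel E) 𝓘(ℝ, E) (fun p : Cotangent E M => p.1) ℓ :=
    (Bundle.contMDiff_proj (n := 1) _ ℓ).mdifferentiableAt (by simp)
  have hφ : MDifferentiableAt 𝓘(ℝ, E) 𝓘(ℝ, E) (extChartAt 𝓘(ℝ, E) ℓ₀.1) ℓ.1 :=
    mdifferentiableAt_extChartAt (by
      have := mem_cotChart_source.1 h
      rwa [extChartAt_source] at this)
  have ha := mfderiv_comp ℓ hφ hπ
  have hb := mfderiv_comp (I'' := 𝓘(ℝ, E)) (g := Prod.fst) ℓ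
    (differentiableAt_fst.mdifferentiableAt) (mdifferentiableAt_cotChart h)
  have hev : extChartAt 𝓘(ℝ, E) ℓ₀.1 ∘ (fun p : Cotangent E M => p.1) =ᶠ[𝓝 ℓ]
      Prod.fst ∘ cotChart ℓ₀ := by
    filter_upwards [cotChart_source_mem_nhds h] with p hp
    simp only [Function.comp_apply, cotChart_apply hp]
  have hc := DFunLike.congr_fun (ha.symm.trans (hev.mfderiv_eq.trans hb)) v
  rw [mfderiv_eq_fderiv, fderiv_fst] at hc
  refine (cotChart_snd_apply h _).symm.trans ?_
  exact congrArg (cotChart ℓ₀ ℓ).2 hc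

lemma liouvilleInChart_apply {ℓ₀ : Cotangent E M} {z : E × (E →L[ℝ] ℝ)}
    (hz : z ∈ (cotChart ℓ₀).target) (w : E × (E →L[ℝ] ℝ)) :
    liouvilleInChart ℓ₀ z w = z.2 w.1 := by
  refine (liouvilleForm_eq ((cotChart ℓ₀).map_target hz) (cotChartSymmDeriv ℓ₀ z w)).trans ?_
  rw [cotChartDeriv_symm hz, (cotChart ℓ₀).right_inv hz]

/-- `z ↦ z.2 ∘ fst`, the Liouville form of `E × E*`. -/
def canonicalOneForm (E : Type*) [NormedAddCommGroup E] [NormedSpace ℝ E] :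
    (E × (E →L[ℝ] ℝ)) →L[ℝ] (E × (E →L[ℝ] ℝ)) →L[ℝ] ℝ :=
  ((ContinuousLinearMap.compL ℝ (E × (E →L[ℝ] ℝ)) E ℝ).flip
    (.fst ℝ E (E →L[ℝ] ℝ))).comp (.snd ℝ E (E →L[ℝ] ℝ))

lemma canonicalOneForm_apply (z w : E × (E →L[ℝ] ℝ)) : canonicalOneForm E z w = z.2 w.1 := rfl

lemma canonicalForm_eq (v w : E × (E →L[ℝ] ℝ)) :
    canonicalForm v w = canonicalOneForm E v w - canonicalOneForm E w v := rfl

lemma liouvilleInChart_eventuallyEq {ℓ₀ : Cotangent E M} {z : E × (E →L[ℝ] ℝ)}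
    (hz : z ∈ (cotChart ℓ₀).target) :
    liouvilleInChart (M := M) ℓ₀ =ᶠ[𝓝 z] canonicalOneForm E := by
  filter_upwards [cotChart_target_mem_nhds hz] with y hy
  exact ContinuousLinearMap.ext fun w => liouvilleInChart_apply hy w

lemma symplecticForm_self (ℓ : Cotangent E M) (v w : TangentSpace (cotModel E) ℓ) :
    symplecticForm ℓ v w = canonicalForm (cotChartDeriv ℓ ℓ v) (cotChartDeriv ℓ ℓ w) := by
  rw [symplecticForm, (liouvilleInChart_eventuallyEq (mem_extChartAt_target ℓ)).fderiv_eq,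
    ContinuousLinearMap.fderiv]
  rfl

/-- A map preserving a linear one-form preserves its exterior derivative. -/
lemma bilin_fderiv_sub {P : Type*} [NormedAddCommGroup P] [NormedSpace ℝ P]
    (B : P →L[ℝ] P →L[ℝ] ℝ) {T : P → P} {z : P} (hT : ContDiffAt ℝ 2 T z)
    (h : ∀ᶠ y in 𝓝 z, ∀ w, B (T y) (fderiv ℝ T y w) = B y w) (v w : P) :
    B (fderiv ℝ T z v) (fderiv ℝ T z w) - B (fderiv ℝ T z w) (fderiv ℝ T z v) =
      B v w - B w v := by
  have h2 := (hT.differentiableAt (by simp)).hasFDerivAt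
  have h3 : HasFDerivAt (fderiv ℝ T) (fderiv ℝ (fderiv ℝ T) z) z :=
    ((hT.fderiv_right (m := 1) (by norm_num)).differentiableAt (by simp)).hasFDerivAt
  -- The invariance identity at the fixed vector `a` is differentiated in direction `b`;
  -- antisymmetrising removes the second derivative of `T`.
  have key : ∀ a b, B (fderiv ℝ T z b) (fderiv ℝ T z a) +
      B (T z) (fderiv ℝ (fderiv ℝ T) z b a) = B b a := by
    intro a b
    have h1 : HasFDerivAt (fun y => B (T y)) (B ∘L fderiv ℝ T z) z :=
      B.hasFDerivAt.comp z h2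
    have h1' := h1.clm_apply (h3.clm_apply (hasFDerivAt_const a z))
    have hr := (B.hasFDerivAt (x := z)).clm_apply (hasFDerivAt_const a z)
    have := DFunLike.congr_fun ((h1'.congr_of_eventuallyEq
      (h.mono fun y hy => (hy a).symm)).unique hr) b
    simp at this
    linarith
  have hs : fderiv ℝ (fderiv ℝ T) z v w = fderiv ℝ (fderiv ℝ T) z w v :=
    (hT.isSymmSndFDerivAt (by simp)).eq v w
  have h4 := key w v
  have h5 := key v w
  rw [hs] at h4
  linarith

lemma canonicalOneForm_cotChart_comp {ℓ₀ ℓ₁ : Cotangent E M} {y : E × (E →L[ℝ] ℝ)}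
    (h1 : y ∈ (cotChart ℓ₁).target) (h0 : (cotChart ℓ₁).symm y ∈ (cotChart ℓ₀).source)
    (w : E × (E →L[ℝ] ℝ)) :
    canonicalOneForm E ((cotChart ℓ₀ ∘ (cotChart ℓ₁).symm) y)
      (fderiv ℝ (cotChart ℓ₀ ∘ (cotChart ℓ₁).symm) y w) = canonicalOneForm E y w := by
  have hd := mfderiv_comp y (mdifferentiableAt_cotChart h0) (mdifferentiableAt_cotChart_symm h1)
  rw [mfderiv_eq_fderiv] at hd
  have hd' : fderiv ℝ (cotChart ℓ₀ ∘ (cotChart ℓ₁).symm) y w =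
    cotChartDeriv ℓ₀ ((cotChart ℓ₁).symm y) (cotChartSymmDeriv ℓ₁ y w) :=
    DFunLike.congr_fun hd w
  rw [hd', canonicalOneForm_apply, canonicalOneForm_apply, Function.comp_apply,
    ← liouvilleForm_eq h0, liouvilleForm_eq ((cotChart ℓ₁).map_target h1), cotChartDeriv_symm h1,
    (cotChart ℓ₁).right_inv h1]

/-- The definition uses the chart at `ℓ` itself. Transition maps preserve `ξ dx`, hence its exterior
derivative, so any preferred chart containing `ℓ` gives the same canonical form. -/
lemma symplecticForm_eq {ℓ₀ ℓ : Cotangent E M} (h : ℓ ∈ (cotChart ℓ₀).source)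
    (v w : TangentSpace (cotModel E) ℓ) :
    symplecticForm ℓ v w = canonicalForm (cotChartDeriv ℓ₀ ℓ v) (cotChartDeriv ℓ₀ ℓ w) := by
  have hz := mem_extChartAt_target (I := cotModel E) ℓ
  have hl : (cotChart ℓ).symm (cotChart ℓ ℓ) = ℓ :=
    (cotChart ℓ).left_inv (mem_extChartAt_source ℓ)
  have hd := mfderiv_eq_fderiv_cotChart (cotChart ℓ₀) (mem_extChartAt_source (I := cotModel E) ℓ)
  have hd' : ∀ u, cotChartDeriv ℓ₀ ℓ u =
    fderiv ℝ (cotChart ℓ₀ ∘ (cotChart ℓ).symm) (cotChart ℓ ℓ) (cotChartDeriv ℓ ℓ u) := hd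
  rw [symplecticForm_self, hd' v, hd' w, canonicalForm_eq, canonicalForm_eq,
    bilin_fderiv_sub]
  · have : ContMDiffAt 𝓘(ℝ, E × (E →L[ℝ] ℝ)) 𝓘(ℝ, E × (E →L[ℝ] ℝ)) 2
        (cotChart ℓ₀ ∘ (cotChart ℓ).symm) (cotChart ℓ ℓ) := by
      have h1 : ContMDiffAt 𝓘(ℝ, E × (E →L[ℝ] ℝ)) (cotModel E) 2 (cotChart ℓ).symm
          (cotChart ℓ ℓ) := (contMDiffOn_extChartAt_symm (n := 2) ℓ).contMDiffAt
            (cotChart_target_mem_nhds hz)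
      refine ContMDiffAt.comp (I' := cotModel E) (g := cotChart ℓ₀) _ ?_ h1
      rw [hl]
      exact contMDiffAt_extChartAt' (by rwa [extChartAt_source] at h)
    exact this.contDiffAt
  · have hc : ContinuousAt (cotChart ℓ).symm (cotChart ℓ ℓ) := continuousAt_extChartAt_symm ℓ
    filter_upwards [cotChart_target_mem_nhds hz, hc.preimage_mem_nhds (by
      rw [hl]; exact cotChart_source_mem_nhds h)] with y hy hy' w
    exact canonicalOneForm_cotChart_comp hy hy' w

end

end

/-! ### The constant Poisson tensor of `E × E*`; Hamiltonian fields and brackets in charts -/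

noncomputable section

section

variable {E : Type*} [NormedAddCommGroup E] [NormedSpace ℝ E] [FiniteDimensional ℝ E]

variable (E) in
/-- `w ↦ ω(·, w)` for the canonical symplectic form `ω`. -/
def canonicalBilin : (E × (E →L[ℝ] ℝ)) →ₗ[ℝ] (E × (E →L[ℝ] ℝ)) →L[ℝ] ℝ :=
  (((canonicalOneForm E).flip - canonicalOneForm E :
    (E × (E →L[ℝ] ℝ)) →L[ℝ] (E × (E →L[ℝ] ℝ)) →L[ℝ] ℝ) :
    (E × (E →L[ℝ] ℝ)) →ₗ[ℝ] (E × (E →L[ℝ] ℝ)) →L[ℝ] ℝ)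

omit [FiniteDimensional ℝ E] in
lemma canonicalBilin_apply (v w : E × (E →L[ℝ] ℝ)) :
    canonicalBilin E w v = canonicalForm v w := rfl

omit [FiniteDimensional ℝ E] in
lemma canonicalBilin_injective : Function.Injective (canonicalBilin E) := by
  refine (injective_iff_map_eq_zero _).2 fun w hw => ?_
  have h : ∀ v, canonicalForm v w = 0 := fun v => by
    rw [← canonicalBilin_apply, hw]; rfl
  refine Prod.ext ?_ ?_
  · by_contra hne
    obtain ⟨ξ, -, hξ⟩ := exists_dual_vector ℝ w.1 (by simpa using hne)
    have := h (0, ξ)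
    simp [canonicalForm, hξ] at this
    exact hne this
  · ext x
    have := h (x, 0)
    simpa [canonicalForm] using this

omit [FiniteDimensional ℝ E] in
/-- The inverse of an injective linear map from a finite-dimensional space to its dual. -/
lemma exists_inverse_of_injective {P : Type*} [NormedAddCommGroup P] [NormedSpace ℝ P]
    [FiniteDimensional ℝ P] (B : P →ₗ[ℝ] P →L[ℝ] ℝ) (hB : Function.Injective B) :
    ∃ J : (P →L[ℝ] ℝ) →L[ℝ] P, ∀ α, B (J α) = α := by
  have hd : Module.finrank ℝ P = Module.finrank ℝ (P →L[ℝ] ℝ) := by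
    rw [← (LinearMap.toContinuousLinearMap (𝕜 := ℝ) (E := P) (F' := ℝ)).finrank_eq]
    exact (Subspace.dual_finrank_eq (K := ℝ) (V := P)).symm
  let e := LinearMap.linearEquivOfInjective B hB hd
  exact ⟨LinearMap.toContinuousLinearMap e.symm, fun α => e.apply_symm_apply α⟩

/-- The bundle map `T*P → TP` of the canonical symplectic form of `P = E × E*`. -/
def canonicalJ : ((E × (E →L[ℝ] ℝ)) →L[ℝ] ℝ) →L[ℝ] E × (E →L[ℝ] ℝ) :=
  (exists_inverse_of_injective (canonicalBilin E) canonicalBilin_injective).choose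

lemma canonicalForm_canonicalJ (α : (E × (E →L[ℝ] ℝ)) →L[ℝ] ℝ) (v : E × (E →L[ℝ] ℝ)) :
    canonicalForm v (canonicalJ α) = α v := by
  rw [← canonicalBilin_apply]
  exact DFunLike.congr_fun ((exists_inverse_of_injective (canonicalBilin E)
    canonicalBilin_injective).choose_spec α) v

lemma eq_canonicalJ {α : (E × (E →L[ℝ] ℝ)) →L[ℝ] ℝ} {w : E × (E →L[ℝ] ℝ)}
    (h : ∀ v, α v = canonicalForm v w) : w = canonicalJ α := by
  refine canonicalBilin_injective (ContinuousLinearMap.ext fun v => ?_)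
  rw [canonicalBilin_apply, canonicalBilin_apply, canonicalForm_canonicalJ, h]

lemma canonicalJ_skew (α β : (E × (E →L[ℝ] ℝ)) →L[ℝ] ℝ) :
    α (canonicalJ β) = -β (canonicalJ α) := by
  rw [← canonicalForm_canonicalJ α, ← canonicalForm_canonicalJ β, canonicalForm, canonicalForm]
  ring

variable {M : Type*} [TopologicalSpace M] [ChartedSpace E M] [IsManifold 𝓘(ℝ, E) ∞ M]

/-- A function on `T*M` read in the preferred chart at `ℓ₀`. -/
def inCotChart (ℓ₀ : Cotangent E M) {V : Type*} (F : Cotangent E M → V) :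
    E × (E →L[ℝ] ℝ) → V := F ∘ (cotChart ℓ₀).symm

omit [FiniteDimensional ℝ E] in
lemma inCotChart_apply {ℓ₀ ℓ : Cotangent E M} {V : Type*} (F : Cotangent E M → V)
    (h : ℓ ∈ (cotChart ℓ₀).source) : inCotChart ℓ₀ F (cotChart ℓ₀ ℓ) = F ℓ :=
  congrArg F ((cotChart ℓ₀).left_inv h)

omit [FiniteDimensional ℝ E] in
lemma cotDiff_eq {ℓ₀ ℓ : Cotangent E M} (F : Cotangent E M → ℝ)
    (h : ℓ ∈ (cotChart ℓ₀).source) (v : TangentSpace (cotModel E) ℓ) :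
    cotDiff F ℓ v = fderiv ℝ (inCotChart ℓ₀ F) (cotChart ℓ₀ ℓ) (cotChartDeriv ℓ₀ ℓ v) :=
  mfderiv_eq_fderiv_cotChart F h v

/-- Nondegeneracy provides a vector with the defining property, so the chosen `hamVec` has it too,
and injectivity of `w ↦ ω(·, w)` identifies it. -/
lemma cotChartDeriv_hamVec {ℓ₀ ℓ : Cotangent E M} (F : Cotangent E M → ℝ)
    (h : ℓ ∈ (cotChart ℓ₀).source) :
    cotChartDeriv ℓ₀ ℓ (hamVec F ℓ) = hv canonicalJ (inCotChart ℓ₀ F) (cotChart ℓ₀ ℓ) := by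
  obtain ⟨X, hX⟩ := (cotChartDeriv_bijective h).surjective
    (hv canonicalJ (inCotChart ℓ₀ F) (cotChart ℓ₀ ℓ))
  have hex : ∃ X : TangentSpace (cotModel E) ℓ, ∀ v : TangentSpace (cotModel E) ℓ,
      cotDiff F ℓ v = symplecticForm ℓ v X := by
    refine ⟨X, fun v => ?_⟩
    rw [cotDiff_eq F h, symplecticForm_eq h, hX, hv, canonicalForm_canonicalJ]
  have hs : ∀ v, cotDiff F ℓ v = symplecticForm ℓ v (hamVec F ℓ) := Classical.epsilon_spec hex
  refine eq_canonicalJ fun w => ?_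
  obtain ⟨v, rfl⟩ := (cotChartDeriv_bijective h).surjective w
  rw [← symplecticForm_eq h, ← hs, cotDiff_eq F h]

lemma poisson_eq {ℓ₀ ℓ : Cotangent E M} (F G : Cotangent E M → ℝ)
    (h : ℓ ∈ (cotChart ℓ₀).source) :
    poisson F G ℓ = pb canonicalJ (inCotChart ℓ₀ F) (inCotChart ℓ₀ G) (cotChart ℓ₀ ℓ) := by
  rw [poisson, cotDiff_eq G h, cotChartDeriv_hamVec F h, pb]

lemma inCotChart_poisson {ℓ₀ : Cotangent E M} (F G : Cotangent E M → ℝ) {z : E × (E →L[ℝ] ℝ)}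
    (hz : z ∈ (cotChart ℓ₀).target) : inCotChart ℓ₀ (poisson F G) z =
      pb canonicalJ (inCotChart ℓ₀ F) (inCotChart ℓ₀ G) z := by
  rw [inCotChart, Function.comp_apply, poisson_eq F G ((cotChart ℓ₀).map_target hz),
    (cotChart ℓ₀).right_inv hz]

lemma inCotChart_poisson_eventuallyEq {ℓ₀ : Cotangent E M} (F G : Cotangent E M → ℝ)
    {z : E × (E →L[ℝ] ℝ)} (hz : z ∈ (cotChart ℓ₀).target) : inCotChart ℓ₀ (poisson F G) =ᶠ[𝓝 z]
      pb canonicalJ (inCotChart ℓ₀ F) (inCotChart ℓ₀ G) :=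
  Filter.mem_of_superset (cotChart_target_mem_nhds hz) fun _ => inCotChart_poisson F G

lemma poisson_poisson_eq {ℓ₀ ℓ : Cotangent E M} (F G H : Cotangent E M → ℝ)
    (h : ℓ ∈ (cotChart ℓ₀).source) :
    poisson F (poisson G H) ℓ = pb canonicalJ (inCotChart ℓ₀ F)
      (pb canonicalJ (inCotChart ℓ₀ G) (inCotChart ℓ₀ H)) (cotChart ℓ₀ ℓ) := by
  rw [poisson_eq F _ h, pb, pb,
    (inCotChart_poisson_eventuallyEq G H (cotChart_mem_target h)).fderiv_eq]

/-! ### Hamiltonian lifts of vector fields -/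

/-- A vector field read in the preferred chart at `q₀`. -/
def vfieldInChart (q₀ : M) (f : VField E M) (x : E) : E :=
  VectorField.mpullback 𝓘(ℝ, E) 𝓘(ℝ, E) (extChartAt 𝓘(ℝ, E) q₀).symm f x

omit [FiniteDimensional ℝ E] in
lemma vfieldInChart_eq {q₀ : M} (f : VField E M) {x : E}
    (hx : x ∈ (extChartAt 𝓘(ℝ, E) q₀).target) : vfieldInChart q₀ f x =
      mfderiv 𝓘(ℝ, E) 𝓘(ℝ, E) (extChartAt 𝓘(ℝ, E) q₀) ((extChartAt 𝓘(ℝ, E) q₀).symm x)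
        (f ((extChartAt 𝓘(ℝ, E) q₀).symm x)) := by
  have h1 := mfderiv_extChartAt_comp_mfderivWithin_extChartAt_symm hx
  have h2 := isInvertible_mfderivWithin_extChartAt_symm hx
  rw [ModelWithCorners.range_eq_univ, mfderivWithin_univ] at h1 h2
  have h3 := mfderivWithin_extChartAt_symm_comp_mfderiv_extChartAt hx
  rw [ModelWithCorners.range_eq_univ, mfderivWithin_univ] at h3
  exact (h2.inverse_apply_eq).2 (DFunLike.congr_fun h3 _).symm

omit [FiniteDimensional ℝ E] in
lemma inCotChart_hamLift {ℓ₀ : Cotangent E M} (f : VField E M) {z : E × (E →L[ℝ] ℝ)}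
    (hz : z ∈ (cotChart ℓ₀).target) :
    inCotChart ℓ₀ (hamLift f) z = z.2 (vfieldInChart ℓ₀.1 f z.1) := by
  have h := cotChart_snd_apply ((cotChart ℓ₀).map_target hz) (f ((cotChart ℓ₀).symm z).1)
  rw [(cotChart ℓ₀).right_inv hz, cotChart_symm_fst hz] at h
  rw [vfieldInChart_eq f (mem_cotChart_target.1 hz), h, inCotChart, Function.comp_apply, hamLift,
    cotChart_symm_fst hz]

omit [FiniteDimensional ℝ E] in
lemma IsSmoothVField.contDiffAt_vfieldInChart [CompleteSpace E] {q₀ : M} {f : VField E M}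
    (hf : IsSmoothVField f) {x : E} (hx : x ∈ (extChartAt 𝓘(ℝ, E) q₀).target) :
    ContDiffAt ℝ ∞ (vfieldInChart q₀ f) x := by
  have h2 := isInvertible_mfderivWithin_extChartAt_symm hx
  rw [ModelWithCorners.range_eq_univ, mfderivWithin_univ] at h2
  refine contMDiffAt_vectorSpace_iff_contDiffAt.1
    (ContMDiffAt.mpullback_vectorField_preimage (n := ∞) (hf _) ?_ h2 (by simp))
  exact (contMDiffOn_extChartAt_symm (n := ∞) q₀).contMDiffAt
    ((isOpen_extChartAt_target q₀).mem_nhds hx)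

omit [FiniteDimensional ℝ E] in
lemma vfieldInChart_mlieBracket [CompleteSpace E] {q₀ : M} {f g : VField E M}
    (hf : IsSmoothVField f) (hg : IsSmoothVField g) {x : E}
    (hx : x ∈ (extChartAt 𝓘(ℝ, E) q₀).target) :
    vfieldInChart q₀ (VectorField.mlieBracket 𝓘(ℝ, E) f g) x =
      VectorField.lieBracket ℝ (vfieldInChart q₀ f) (vfieldInChart q₀ g) x := by
  have : IsManifold 𝓘(ℝ, E) (minSmoothness ℝ 2) M := by
    rw [minSmoothness_of_isRCLikeNormedField]
    infer_instance
  have h := VectorField.mpullback_mlieBracket (n := ∞) (I := 𝓘(ℝ, E)) (I' := 𝓘(ℝ, E))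
    (f := (extChartAt 𝓘(ℝ, E) q₀).symm) (x₀ := x) (V := f) (W := g)
    ((hf _).mdifferentiableAt (by simp)) ((hg _).mdifferentiableAt (by simp))
    ((contMDiffOn_extChartAt_symm (n := ∞) q₀).contMDiffAt
      ((isOpen_extChartAt_target q₀).mem_nhds hx)) (by
        rw [minSmoothness_of_isRCLikeNormedField]
        simpa using (by exact_mod_cast le_top : ((2 : ℕ∞) : WithTop ℕ∞) ≤ ∞))
  refine h.trans ?_
  rw [← VectorField.mlieBracketWithin_univ, VectorField.mlieBracketWithin_eq_lieBracketWithin]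
  exact congrFun VectorField.lieBracketWithin_univ x

/-- The function `(x, ξ) ↦ ξ (a x)`. -/
def fiberLinear (a : E → E) (z : E × (E →L[ℝ] ℝ)) : ℝ := z.2 (a z.1)

omit [FiniteDimensional ℝ E] in
lemma contDiffAt_fiberLinear {a : E → E} {z : E × (E →L[ℝ] ℝ)} (ha : ContDiffAt ℝ ∞ a z.1) :
    ContDiffAt ℝ ∞ (fiberLinear a) z :=
  contDiffAt_snd.clm_apply (ContDiffAt.comp z ha contDiffAt_fst)

omit [FiniteDimensional ℝ E] in
lemma fderiv_fiberLinear {a : E → E} {z : E × (E →L[ℝ] ℝ)} (ha : DifferentiableAt ℝ a z.1)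
    (v : E × (E →L[ℝ] ℝ)) :
    fderiv ℝ (fiberLinear a) z v = v.2 (a z.1) + z.2 (fderiv ℝ a z.1 v.1) := by
  have h1 : HasFDerivAt (fun y : E × (E →L[ℝ] ℝ) => a y.1)
      (fderiv ℝ a z.1 ∘L .fst ℝ E (E →L[ℝ] ℝ)) z :=
    HasFDerivAt.comp z ha.hasFDerivAt hasFDerivAt_fst
  have h2 : HasFDerivAt (fiberLinear a) _ z :=
    (hasFDerivAt_snd (p := z)).clm_apply h1
  rw [h2.fderiv]
  simp [add_comm]

lemma hv_fiberLinear {a : E → E} {z : E × (E →L[ℝ] ℝ)} (ha : DifferentiableAt ℝ a z.1) :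
    hv canonicalJ (fiberLinear a) z = (a z.1, -(z.2 ∘L fderiv ℝ a z.1)) := by
  refine (eq_canonicalJ fun v => ?_).symm
  rw [fderiv_fiberLinear ha, canonicalForm]
  simp

/-- The Hamiltonian field of `ξ(a x)` is `(a, -ξ ∘ Da)`, so the bracket is `ξ(Db a - Da b)`. -/
lemma pb_fiberLinear {a b : E → E} {z : E × (E →L[ℝ] ℝ)} (ha : DifferentiableAt ℝ a z.1)
    (hb : DifferentiableAt ℝ b z.1) :
    pb canonicalJ (fiberLinear a) (fiberLinear b) z =
      fiberLinear (VectorField.lieBracket ℝ a b) z := by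
  rw [pb, hv_fiberLinear ha, fderiv_fiberLinear hb, fiberLinear, VectorField.lieBracket, map_sub]
  simp
  ring

omit [FiniteDimensional ℝ E] in
lemma inCotChart_hamLift_eventuallyEq {ℓ₀ : Cotangent E M} (f : VField E M)
    {z : E × (E →L[ℝ] ℝ)} (hz : z ∈ (cotChart ℓ₀).target) :
    inCotChart ℓ₀ (hamLift f) =ᶠ[𝓝 z] fiberLinear (vfieldInChart ℓ₀.1 f) :=
  Filter.mem_of_superset (cotChart_target_mem_nhds hz) fun _ hy => inCotChart_hamLift f hy

lemma IsSmoothVField.contDiffAt_hamLift {f : VField E M} (hf : IsSmoothVField f)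
    {ℓ₀ : Cotangent E M} {z : E × (E →L[ℝ] ℝ)} (hz : z ∈ (cotChart ℓ₀).target) :
    ContDiffAt ℝ ∞ (inCotChart ℓ₀ (hamLift f)) z := by
  have : CompleteSpace E := FiniteDimensional.complete ℝ E
  exact (contDiffAt_fiberLinear (hf.contDiffAt_vfieldInChart
    (mem_cotChart_target.1 hz))).congr_of_eventuallyEq (inCotChart_hamLift_eventuallyEq f hz)

lemma pb_eventuallyEq {P : Type*} [NormedAddCommGroup P] [NormedSpace ℝ P]
    (J : (P →L[ℝ] ℝ) →L[ℝ] P) {F F' G G' : P → ℝ} {z : P} (hF : F =ᶠ[𝓝 z] F')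
    (hG : G =ᶠ[𝓝 z] G') : pb J F G z = pb J F' G' z := by
  rw [pb, pb, hv, hv, hF.fderiv_eq, hG.fderiv_eq]

/-- Naturality of the Lie bracket carries `pb_fiberLinear` to the manifold. Closure of `Lie(𝔣)`
under brackets thereby becomes stability under Poisson brackets. -/
lemma pb_hamLift {f g : VField E M} (hf : IsSmoothVField f) (hg : IsSmoothVField g)
    {ℓ₀ : Cotangent E M} {z : E × (E →L[ℝ] ℝ)} (hz : z ∈ (cotChart ℓ₀).target) :
    pb canonicalJ (inCotChart ℓ₀ (hamLift f)) (inCotChart ℓ₀ (hamLift g)) z =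
      inCotChart ℓ₀ (hamLift (VectorField.mlieBracket 𝓘(ℝ, E) f g)) z := by
  have : CompleteSpace E := FiniteDimensional.complete ℝ E
  have hz' := mem_cotChart_target.1 hz
  rw [pb_eventuallyEq _ (inCotChart_hamLift_eventuallyEq f hz)
    (inCotChart_hamLift_eventuallyEq g hz),
    pb_fiberLinear ((hf.contDiffAt_vfieldInChart hz').differentiableAt (by simp))
      ((hg.contDiffAt_vfieldInChart hz').differentiableAt (by simp)),
    inCotChart_hamLift _ hz, vfieldInChart_mlieBracket hf hg hz', fiberLinear]

omit [FiniteDimensional ℝ E] in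
lemma IsSmoothVField.mlieBracket [CompleteSpace E] {f g : VField E M} (hf : IsSmoothVField f)
    (hg : IsSmoothVField g) : IsSmoothVField (VectorField.mlieBracket 𝓘(ℝ, E) f g) := by
  have : IsManifold 𝓘(ℝ, E) (((⊤ : ℕ∞) : WithTop ℕ∞) + 1) M := by simpa
  have : IsManifold 𝓘(ℝ, E) (minSmoothness ℝ 3) M := by
    rw [minSmoothness_of_isRCLikeNormedField]
    infer_instance
  exact ContDiff.mlieBracket_vectorField (m := ⊤) (n := ⊤) hf hg (by simp)

lemma LieGen.isSmoothVField {m : ℕ} {f : Fin m → VField E M} (hf : ∀ i, IsSmoothVField (f i))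
    {g : VField E M} (hg : LieGen f g) : IsSmoothVField g := by
  have : CompleteSpace E := FiniteDimensional.complete ℝ E
  induction hg with
  | basic i => exact hf i
  | zero => exact Bundle.contMDiff_zeroSection ℝ _
  | add _ _ h1 h2 => exact ContMDiff.add_section h1 h2
  | smul c _ h => exact ContMDiff.const_smul_section h
  | bracket _ _ h1 h2 => exact h1.mlieBracket h2

end

end

/-! ### Local frames of `Lie(𝔣)` and the Hamiltonian frame they define -/

noncomputable section

section

/-- Near a point where they are independent, smooth fields `a k` are independent, and a field
which is pointwise a combination of them is so with smooth coefficients. -/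
lemma exists_smooth_coeff {E : Type*} [NormedAddCommGroup E] [NormedSpace ℝ E]
    [FiniteDimensional ℝ E] {R : ℕ} {W : Set E} (hW : IsOpen W) {x₀ : E} (hx₀ : x₀ ∈ W)
    {a : Fin R → E → E} (ha : ∀ k, ∀ x ∈ W, ContDiffAt ℝ ∞ (a k) x)
    (hli : LinearIndependent ℝ fun k => a k x₀) :
    ∃ V, IsOpen V ∧ x₀ ∈ V ∧ V ⊆ W ∧ ∃ C : E → E →L[ℝ] (Fin R → ℝ),
      (∀ x ∈ V, ContDiffAt ℝ ∞ C x) ∧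
      ∀ x ∈ V, ∀ w : Fin R → ℝ, C x (∑ k, w k • a k x) = w := by
  obtain ⟨L, hL⟩ := LinearMap.exists_leftInverse_of_injective
    (Fintype.linearCombination ℝ fun k => a k x₀)
    (LinearMap.ker_eq_bot.2 (by simpa using hli.fintypeLinearCombination_injective))
  set L' : E →L[ℝ] (Fin R → ℝ) := LinearMap.toContinuousLinearMap L
  -- The matrix of the frame followed by a left inverse at `x₀`: it is the identity at `x₀`, hence
  -- invertible nearby, and `A⁻¹ L'` reads off coefficients smoothly.
  set A : E → (Fin R → ℝ) →L[ℝ] (Fin R → ℝ) := fun x =>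
    ∑ k, ContinuousLinearMap.smulRightL ℝ (Fin R → ℝ) (Fin R → ℝ)
      (ContinuousLinearMap.proj (R := ℝ) (φ := fun _ : Fin R => ℝ) k) (L' (a k x)) with hA
  have hAa : ∀ x w, A x w = L' (∑ k, w k • a k x) := by
    intro x w
    simp [hA, sum_apply, map_sum]
  have hAs : ∀ x ∈ W, ContDiffAt ℝ ∞ A x := fun x hx =>
    ContDiffAt.sum fun k _ => ContinuousLinearMap.contDiff _ |>.contDiffAt.comp x
      (L'.contDiff.contDiffAt.comp x (ha k x hx))
  have hA0 : A x₀ = ContinuousLinearMap.id ℝ _ := by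
    ext1 w
    rw [hAa]
    exact DFunLike.congr_fun hL w
  set V := {x ∈ W | IsUnit (A x)} with hV
  have hVo : IsOpen V := by
    refine isOpen_iff_mem_nhds.2 fun x hx => ?_
    filter_upwards [hW.mem_nhds hx.1,
      (hAs x hx.1).continuousAt.preimage_mem_nhds (Units.isOpen.mem_nhds hx.2)] with y h1 h2
    exact ⟨h1, h2⟩
  refine ⟨V, hVo, ⟨hx₀, hA0 ▸ isUnit_one⟩, fun x hx => hx.1,
    fun x => (Ring.inverse (A x)) ∘L L', fun x hx => ?_, fun x hx w => ?_⟩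
  · obtain ⟨u, hu⟩ := hx.2
    have h1 : ContDiffAt ℝ ∞ Ring.inverse (A x) := hu ▸ contDiffAt_ringInverse ℝ u
    exact (h1.comp x (hAs x hx.1)).clm_comp contDiffAt_const
  · rw [ContinuousLinearMap.comp_apply, ← hAa]
    exact DFunLike.congr_fun (Ring.inverse_mul_cancel _ hx.2) w

variable {E M : Type*} [NormedAddCommGroup E] [NormedSpace ℝ E] [FiniteDimensional ℝ E]
  [TopologicalSpace M] [ChartedSpace E M] [IsManifold 𝓘(ℝ, E) ∞ M] {m R : ℕ}

-- The generated fields already form a linear space, so taking the span adds no values.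
omit [FiniteDimensional ℝ E] [IsManifold 𝓘(ℝ, E) ∞ M] in
lemma exists_lieGen_of_mem_lieAt {f : Fin m → VField E M} {q : M} {v : TangentSpace 𝓘(ℝ, E) q}
    (hv : v ∈ lieAt f q) : ∃ g, LieGen f g ∧ g q = v := by
  induction hv using Submodule.span_induction with
  | mem x h => exact h
  | zero => exact ⟨_, .zero, rfl⟩
  | add x y _ _ hx hy =>
    obtain ⟨g, hg, rfl⟩ := hx
    obtain ⟨h, hh, rfl⟩ := hy
    exact ⟨_, hg.add hh, rfl⟩
  | smul c x _ hx =>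
    obtain ⟨g, hg, rfl⟩ := hx
    exact ⟨_, hg.smul c, rfl⟩

/-- A local frame of `Lie(𝔣)` in the preferred chart at `q₀`. -/
lemma exists_lie_frame {f : Fin m → VField E M} (hf : ∀ i, IsSmoothVField (f i)) {O : Set M}
    (hO : IsOpen O) (hreg : LieRegularOn f R O) {q₀ : M} (hq₀ : q₀ ∈ O) :
    ∃ V, IsOpen V ∧ extChartAt 𝓘(ℝ, E) q₀ q₀ ∈ V ∧ V ⊆ (extChartAt 𝓘(ℝ, E) q₀).target ∧
      ∃ g : Fin R → VField E M, (∀ k, LieGen f (g k)) ∧ ∃ C : E → E →L[ℝ] (Fin R → ℝ),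
      (∀ x ∈ V, ContDiffAt ℝ ∞ C x) ∧
      (∀ x ∈ V, ∀ w : Fin R → ℝ, C x (∑ k, w k • vfieldInChart q₀ (g k) x) = w) ∧
      ∀ h, LieGen f h → ∀ x ∈ V, vfieldInChart q₀ h x =
        ∑ k, C x (vfieldInChart q₀ h x) k • vfieldInChart q₀ (g k) x := by
  have : CompleteSpace E := FiniteDimensional.complete ℝ E
  have hfd : ∀ q : M, FiniteDimensional ℝ (TangentSpace 𝓘(ℝ, E) q) := fun q =>
    inferInstanceAs (FiniteDimensional ℝ E)
  let b := Module.finBasisOfFinrankEq ℝ (lieAt f q₀) (hreg q₀ hq₀).2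
  have hg : ∀ k, ∃ g, LieGen f g ∧ g q₀ = b k := fun k => exists_lieGen_of_mem_lieAt (b k).2
  choose g hg hgb using hg
  set φ := extChartAt 𝓘(ℝ, E) q₀
  have hinv : ∀ x ∈ φ.target, Function.Injective (mfderiv 𝓘(ℝ, E) 𝓘(ℝ, E) φ (φ.symm x)) := by
    intro x hx
    obtain ⟨e, he⟩ := isInvertible_mfderiv_extChartAt (φ.map_target hx)
    rw [← he]
    exact e.injective
  set W := φ.target ∩ φ.symm ⁻¹' O with hWdef
  have hW : IsOpen W :=
    (continuousOn_extChartAt_symm q₀).isOpen_inter_preimage (isOpen_extChartAt_target q₀) hO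
  have hx₀ : φ q₀ ∈ φ.target := mem_extChartAt_target q₀
  have hq : φ.symm (φ q₀) = q₀ := extChartAt_to_inv q₀
  have hx₀W : φ q₀ ∈ W := ⟨hx₀, by rw [mem_preimage, hq]; exact hq₀⟩
  have hli : LinearIndependent ℝ fun k => vfieldInChart q₀ (g k) (φ q₀) := by
    have h1 : LinearIndependent ℝ fun k => (b k : TangentSpace 𝓘(ℝ, E) q₀) :=
      b.linearIndependent.map' (lieAt f q₀).subtype (Submodule.ker_subtype _)
    have h2 : LinearIndependent ℝ fun k => g k (φ.symm (φ q₀)) := by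
      rw [hq]
      simpa only [hgb] using h1
    have h3 := h2.map' (mfderiv 𝓘(ℝ, E) 𝓘(ℝ, E) φ (φ.symm (φ q₀))).toLinearMap
      (LinearMap.ker_eq_bot.2 (hinv _ hx₀))
    have h4 : (fun k => vfieldInChart q₀ (g k) (φ q₀)) =
      (mfderiv 𝓘(ℝ, E) 𝓘(ℝ, E) φ (φ.symm (φ q₀))).toLinearMap ∘ fun k => g k (φ.symm (φ q₀)) :=
      funext fun k => vfieldInChart_eq (g k) hx₀
    rw [h4]
    exact h3
  obtain ⟨V, hVo, hxV, hVW, C, hC, hC1⟩ := exists_smooth_coeff hW hx₀W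
    (fun k x hx => ((hg k).isSmoothVField hf).contDiffAt_vfieldInChart hx.1) hli
  refine ⟨V, hVo, hxV, fun x hx => (hVW hx).1, g, hg, C, hC, hC1, fun h hh x hx => ?_⟩
  set q := φ.symm x with hqdef
  have hxt := (hVW hx).1
  have hli' : LinearIndependent ℝ fun k => vfieldInChart q₀ (g k) x := by
    refine Fintype.linearIndependent_iff.2 fun w hw => ?_
    have := hC1 x hx w
    rw [hw, map_zero] at this
    exact fun i => (congrFun this i).symm
  have hliq : LinearIndependent ℝ fun k => g k q := by
    refine LinearIndependent.of_comp (mfderiv 𝓘(ℝ, E) 𝓘(ℝ, E) φ q).toLinearMap ?_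
    have h4 : (fun k => vfieldInChart q₀ (g k) x) =
      (mfderiv 𝓘(ℝ, E) 𝓘(ℝ, E) φ q).toLinearMap ∘ fun k => g k q :=
      funext fun k => vfieldInChart_eq (g k) hxt
    rw [← h4]
    exact hli'
  -- Here the constancy of the dimension enters: the `R` fields remain independent near `q₀`, so
  -- they still span.
  have hspan : Submodule.span ℝ (range fun k => g k q) = lieAt f q := by
    refine Submodule.eq_of_le_of_finrank_eq (Submodule.span_le.2 ?_) ?_
    · rintro _ ⟨k, rfl⟩
      exact Submodule.subset_span ⟨g k, hg k, rfl⟩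
    · rw [finrank_span_eq_card hliq, (hreg q (hVW hx).2).2, Fintype.card_fin]
  have hmem : h q ∈ Submodule.span ℝ (range fun k => g k q) := by
    rw [hspan]
    exact Submodule.subset_span ⟨h, hh, rfl⟩
  obtain ⟨w, hw⟩ := (Submodule.mem_span_range_iff_exists_fun ℝ).1 hmem
  have hw' : vfieldInChart q₀ h x = ∑ k, w k • vfieldInChart q₀ (g k) x := by
    have h5 : ∀ h', vfieldInChart q₀ h' x = mfderiv 𝓘(ℝ, E) 𝓘(ℝ, E) φ q (h' q) := fun h' =>
      vfieldInChart_eq h' hxt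
    rw [h5 h, ← hw, map_sum]
    refine Finset.sum_congr rfl fun k _ => ?_
    rw [h5, map_smul]
    rfl
  rw [hw', hC1 x hx w]

lemma IsHamFrame.mono {P : Type*} [NormedAddCommGroup P] [NormedSpace ℝ P]
    {J : (P →L[ℝ] ℝ) →L[ℝ] P} {Ω Ω' : Set P} {F₀ : P → ℝ} {F : Fin m → P → ℝ} {G : Fin R → P → ℝ}
    (hf : IsHamFrame J Ω F₀ F G) (hΩ' : IsOpen Ω') (h : Ω' ⊆ Ω) : IsHamFrame J Ω' F₀ F G where
  isOpen := hΩ'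
  smooth₀ z hz := hf.smooth₀ z (h hz)
  smooth i z hz := hf.smooth i z (h hz)
  smoothG k z hz := hf.smoothG k z (h hz)
  gen i := let ⟨b, h1, h2⟩ := hf.gen i; ⟨b, fun k z hz => h1 k z (h hz), fun z hz => h2 z (h hz)⟩
  comm i j :=
    let ⟨b, h1, h2⟩ := hf.comm i j; ⟨b, fun k z hz => h1 k z (h hz), fun z hz => h2 z (h hz)⟩
  inv i j :=
    let ⟨b, h1, h2⟩ := hf.inv i j; ⟨b, fun k z hz => h1 k z (h hz), fun z hz => h2 z (h hz)⟩
  surj z hz := hf.surj z (h hz)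

/-- In the preferred chart at `ℓ₀`, the lifts of a local frame of `Lie(𝔣)` cut out `Σ`. -/
lemma exists_isHamFrame {f₀ : VField E M} {f : Fin m → VField E M} (hf₀ : IsSmoothVField f₀)
    (hf : ∀ i, IsSmoothVField (f i)) {O : Set M} (hO : IsOpen O) (hreg : LieRegularOn f R O)
    {ℓ₀ : Cotangent E M} (hℓ₀ : ℓ₀.1 ∈ O) :
    ∃ (Ω : Set (E × (E →L[ℝ] ℝ))) (G : Fin R → E × (E →L[ℝ] ℝ) → ℝ),
      cotChart ℓ₀ ℓ₀ ∈ Ω ∧ Ω ⊆ (cotChart ℓ₀).target ∧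
      IsHamFrame canonicalJ Ω (inCotChart ℓ₀ (hamLift f₀))
        (fun i => inCotChart ℓ₀ (hamLift (f i))) G ∧
      (∀ z ∈ Ω, (cotChart ℓ₀).symm z ∈ sigmaSet f ↔ ∀ k, G k z = 0) ∧
      ∀ z ∈ Ω, (cotChart ℓ₀).symm z ∈ singSet f₀ f ↔ (∀ k, G k z = 0) ∧
        ∀ k, pb canonicalJ (inCotChart ℓ₀ (hamLift f₀)) (G k) z = 0 := by
  have : CompleteSpace E := FiniteDimensional.complete ℝ E
  obtain ⟨V, hV, hxV, hVt, g, hg, C, hC, hC1, hgen⟩ := exists_lie_frame hf hO hreg hℓ₀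
  set Ω : Set (E × (E →L[ℝ] ℝ)) := Prod.fst ⁻¹' V with hΩdef
  have hΩ : IsOpen Ω := hV.preimage continuous_fst
  have hΩt : Ω ⊆ (cotChart ℓ₀).target := fun z hz => mem_cotChart_target.2 (hVt hz)
  set G : Fin R → E × (E →L[ℝ] ℝ) → ℝ := fun k => inCotChart ℓ₀ (hamLift (g k)) with hGdef
  have hgs : ∀ k, IsSmoothVField (g k) := fun k => (hg k).isSmoothVField hf
  -- The coefficients are those of `h` in the frame and depend only on the base point.
  have hspan : ∀ h, LieGen f h → InSmoothSpan Ω G (inCotChart ℓ₀ (hamLift h)) := by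
    intro h hh
    refine ⟨fun k z => C z.1 (vfieldInChart ℓ₀.1 h z.1) k, fun k z hz => ?_, fun z hz => ?_⟩
    · have h1 : ContDiffAt ℝ ∞ (fun x => C x (vfieldInChart ℓ₀.1 h x)) z.1 :=
        (hC z.1 hz).clm_apply ((hh.isSmoothVField hf).contDiffAt_vfieldInChart (hVt hz))
      have h2 : ContDiffAt ℝ ∞ (fun y : E × (E →L[ℝ] ℝ) => C y.1 (vfieldInChart ℓ₀.1 h y.1)) z :=
        ContDiffAt.comp z h1 contDiffAt_fst
      exact contDiffAt_pi.1 h2 k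
    · rw [inCotChart_hamLift h (hΩt hz), hgen h hh z.1 hz, map_sum]
      refine Finset.sum_congr rfl fun k _ => ?_
      rw [map_smul, smul_eq_mul, ← inCotChart_hamLift (g k) (hΩt hz)]
  have hcongr : ∀ {h₁ h₂ : VField E M}, IsSmoothVField h₁ → IsSmoothVField h₂ →
      LieGen f (VectorField.mlieBracket 𝓘(ℝ, E) h₁ h₂) → InSmoothSpan Ω G
        (pb canonicalJ (inCotChart ℓ₀ (hamLift h₁)) (inCotChart ℓ₀ (hamLift h₂))) := by
    intro h₁ h₂ s₁ s₂ hl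
    obtain ⟨b, h1, h2⟩ := hspan _ hl
    exact ⟨b, h1, fun z hz => (pb_hamLift s₁ s₂ (hΩt hz)).trans (h2 z hz)⟩
  have hframe : IsHamFrame canonicalJ Ω (inCotChart ℓ₀ (hamLift f₀))
      (fun i => inCotChart ℓ₀ (hamLift (f i))) G :=
    { isOpen := hΩ
      smooth₀ := fun z hz => hf₀.contDiffAt_hamLift (hΩt hz)
      smooth := fun i z hz => (hf i).contDiffAt_hamLift (hΩt hz)
      smoothG := fun k z hz => (hgs k).contDiffAt_hamLift (hΩt hz)
      gen := fun i => hspan _ (.basic i)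
      comm := fun i j => hcongr (hf i) (hf j) (.bracket (.basic i) (.basic j))
      inv := fun i k => hcongr (hf i) (hgs k) (.bracket (.basic i) (hg k))
      surj := fun z hz w => by
        -- Vertical directions suffice: `dG_k(0, η) = η(g_k)`, and `c ∘ C` takes the value `w k` on
        -- `g_k`.
        set c : (Fin R → ℝ) →L[ℝ] ℝ := ∑ k, w k • ContinuousLinearMap.proj k with hc
        refine ⟨(0, c ∘L C z.1), fun k => ?_⟩
        have h1 : fderiv ℝ (G k) z = _ :=
          (inCotChart_hamLift_eventuallyEq (g k) (hΩt hz)).fderiv_eq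
        rw [h1, fderiv_fiberLinear (((hgs k).contDiffAt_vfieldInChart
          (hVt hz)).differentiableAt (by simp))]
        have h2 := hC1 z.1 hz (Pi.single k 1)
        simp only [Pi.single_apply, ite_smul, one_smul, zero_smul, Finset.sum_ite_eq',
          Finset.mem_univ, if_true] at h2
        simp [h2, hc, sum_apply, Pi.single_apply] }
  have hsig : ∀ z ∈ Ω, (cotChart ℓ₀).symm z ∈ sigmaSet f ↔ ∀ k, G k z = 0 := by
    refine fun z hz => ⟨fun h k => h _ (hg k), fun h h' hh' => ?_⟩
    obtain ⟨b, -, hb⟩ := hspan h' hh'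
    exact (hb z hz).trans (Finset.sum_eq_zero fun k _ => by rw [h, mul_zero])
  refine ⟨Ω, G, hxV, hΩt, hframe, hsig, fun z hz => ?_⟩
  refine ⟨fun h => ⟨(hsig z hz).1 h.1, fun k => ?_⟩, fun h => ⟨(hsig z hz).2 h.1, fun h' hh' => ?_⟩⟩
  · rw [hGdef, pb_hamLift hf₀ (hgs k) (hΩt hz)]
    exact h.2 _ (hg k)
  · change inCotChart ℓ₀ (hamLift (VectorField.mlieBracket 𝓘(ℝ, E) f₀ h')) z = 0
    rw [← pb_hamLift hf₀ (hh'.isSmoothVField hf) (hΩt hz), pb_skew canonicalJ_skew,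
      hframe.pb_eq_zero_of_inSmoothSpan canonicalJ_skew (hspan h' hh') hz h.1 h.2, neg_zero]

end

end

/-! ### Curves and exponentials in `T*M` versus their chart expressions -/

noncomputable section

section

/-- Points over different base points are separated in the base, points of one fibre in a
trivialization. This is needed for uniqueness of integral curves in `T*M`. -/
lemma Bundle.totalSpace_t2Space {B F : Type*} (X : B → Type*) [TopologicalSpace B] [T2Space B]
    [TopologicalSpace F] [T2Space F] [TopologicalSpace (Bundle.TotalSpace F X)]
    [∀ x, TopologicalSpace (X x)] [FiberBundle F X] : T2Space (Bundle.TotalSpace F X) := by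
  refine ⟨fun p q hpq => ?_⟩
  have hπ : Continuous (Bundle.TotalSpace.proj : Bundle.TotalSpace F X → B) :=
    FiberBundle.continuous_proj F X
  by_cases h : p.proj = q.proj
  · set t := trivializationAt F X p.proj
    have hp : p ∈ t.source := t.mem_source.2 (FiberBundle.mem_baseSet_trivializationAt' p.proj)
    have hq : q ∈ t.source := t.mem_source.2 (h ▸ FiberBundle.mem_baseSet_trivializationAt' p.proj)
    have hne : t p ≠ t q := fun h' => hpq (t.injOn hp hq h')
    obtain ⟨A, B, hA, hB, hpA, hqB, hd⟩ := t2_separation hne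
    refine ⟨t.source ∩ t ⁻¹' A, t.source ∩ t ⁻¹' B,
      t.continuousOn.isOpen_inter_preimage t.open_source hA,
      t.continuousOn.isOpen_inter_preimage t.open_source hB, ⟨hp, hpA⟩, ⟨hq, hqB⟩, ?_⟩
    exact (hd.preimage t).mono inter_subset_right inter_subset_right
  · obtain ⟨A, B, hA, hB, hpA, hqB, hd⟩ := t2_separation h
    exact ⟨_, _, hA.preimage hπ, hB.preimage hπ, hpA, hqB, hd.preimage _⟩

variable {E M : Type*} [NormedAddCommGroup E] [NormedSpace ℝ E]
  [TopologicalSpace M] [ChartedSpace E M] [IsManifold 𝓘(ℝ, E) ∞ M] {m R : ℕ}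

lemma hasDerivWithinAt_cotChart_comp {γ : ℝ → Cotangent E M} {t : ℝ} {s : Set ℝ}
    {ℓ₀ : Cotangent E M}
    {v : TangentSpace (cotModel E) (γ t)}
    (h : HasMFDerivWithinAt 𝓘(ℝ, ℝ) (cotModel E) γ s t ((1 : ℝ →L[ℝ] ℝ).smulRight v))
    (ht : γ t ∈ (cotChart ℓ₀).source) :
    HasDerivWithinAt (fun τ => cotChart ℓ₀ (γ τ)) (cotChartDeriv ℓ₀ (γ t) v) s t := by
  have h1 := (mdifferentiableAt_cotChart ht).hasMFDerivAt.comp_hasMFDerivWithinAt t h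
  have h2 : HasFDerivWithinAt (fun τ => cotChart ℓ₀ (γ τ))
      ((1 : ℝ →L[ℝ] ℝ).smulRight (cotChartDeriv ℓ₀ (γ t) v)) s t := by
    refine (hasMFDerivWithinAt_iff_hasFDerivWithinAt.1 h1).congr_fderiv ?_
    refine ContinuousLinearMap.ext fun r => ?_
    exact (cotChartDeriv ℓ₀ (γ t)).map_smul r v
  simpa using! h2.hasDerivWithinAt

lemma hasMFDerivWithinAt_cotChart_symm_comp {ζ : ℝ → E × (E →L[ℝ] ℝ)} {t : ℝ} {s : Set ℝ}
    {ℓ₀ : Cotangent E M} {w : E × (E →L[ℝ] ℝ)} (h : HasDerivWithinAt ζ w s t)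
    (ht : ζ t ∈ (cotChart ℓ₀).target)
    {v : TangentSpace (cotModel E) ((cotChart ℓ₀).symm (ζ t))}
    (hv : cotChartDeriv ℓ₀ ((cotChart ℓ₀).symm (ζ t)) v = w) :
    HasMFDerivWithinAt 𝓘(ℝ, ℝ) (cotModel E) (fun τ => (cotChart ℓ₀).symm (ζ τ)) s t
      ((1 : ℝ →L[ℝ] ℝ).smulRight (v : E × (E →L[ℝ] ℝ))) := by
  have h1 := (mdifferentiableAt_cotChart_symm ht).hasMFDerivAt.comp_hasMFDerivWithinAt t
    (hasMFDerivWithinAt_iff_hasFDerivWithinAt.2 h.hasFDerivWithinAt)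
  have hv' : cotChartSymmDeriv ℓ₀ (ζ t) w = v := by
    refine (cotChartDeriv_bijective ((cotChart ℓ₀).map_target ht)).injective ?_
    rw [cotChartDeriv_symm ht, hv]
  refine h1.congr_mfderiv ?_
  refine ContinuousLinearMap.ext fun (r : ℝ) => ?_
  exact ((cotChartSymmDeriv ℓ₀ (ζ t)).map_smul (r : ℝ) w).trans
    (congrArg (fun x : TangentSpace (cotModel E) _ => (r : ℝ) • x) hv')

lemma contMDiffAt_iff_contDiffAt_inCotChart {V : Type*} [NormedAddCommGroup V] [NormedSpace ℝ V]
    {F : Cotangent E M → V} {ℓ₀ ℓ : Cotangent E M} (h : ℓ ∈ (cotChart ℓ₀).source) :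
    ContMDiffAt (cotModel E) 𝓘(ℝ, V) ∞ F ℓ ↔
      ContDiffAt ℝ ∞ (inCotChart ℓ₀ F) (cotChart ℓ₀ ℓ) := by
  have hz := cotChart_mem_target h
  have hl : (cotChart ℓ₀).symm (cotChart ℓ₀ ℓ) = ℓ := (cotChart ℓ₀).left_inv h
  refine ⟨fun hF => ?_, fun hF => ?_⟩
  · have h1 : ContMDiffAt 𝓘(ℝ, E × (E →L[ℝ] ℝ)) (cotModel E) ∞ (cotChart ℓ₀).symm
        (cotChart ℓ₀ ℓ) := (contMDiffOn_extChartAt_symm (n := ∞) ℓ₀).contMDiffAt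
          (cotChart_target_mem_nhds hz)
    exact (ContMDiffAt.comp (I' := cotModel E) (g := F) _ (by rwa [hl]) h1).contDiffAt
  · have h1 : ContMDiffAt (cotModel E) 𝓘(ℝ, E × (E →L[ℝ] ℝ)) ∞ (cotChart ℓ₀) ℓ :=
      contMDiffAt_extChartAt' (by rwa [extChartAt_source] at h)
    have h2 := ContMDiffAt.comp ℓ (hF.contMDiffAt (x := cotChart ℓ₀ ℓ)) h1
    refine h2.congr_of_eventuallyEq ?_
    filter_upwards [cotChart_source_mem_nhds h] with p hp
    exact (inCotChart_apply F hp).symm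

lemma continuousAt_cotChart {ℓ₀ ℓ : Cotangent E M} (h : ℓ ∈ (cotChart ℓ₀).source) :
    ContinuousAt (cotChart ℓ₀) ℓ := (mdifferentiableAt_cotChart h).continuousAt

lemma continuousAt_cotChart_symm {ℓ₀ : Cotangent E M} {z : E × (E →L[ℝ] ℝ)}
    (hz : z ∈ (cotChart ℓ₀).target) : ContinuousAt (cotChart ℓ₀).symm z :=
  (mdifferentiableAt_cotChart_symm hz).continuousAt

section Exp

variable [FiniteDimensional ℝ E] {f : Fin m → VField E M} {ℓ₀ : Cotangent E M}
  {e : (E × (E →L[ℝ] ℝ)) × (Fin m → ℝ) → E × (E →L[ℝ] ℝ)} {U Ω : Set (E × (E →L[ℝ] ℝ))} {δ : ℝ}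
  {ℓ ℓ' : Cotangent E M} {c : Fin m → ℝ}

lemma cotChartDeriv_sum_hamVec (h : ℓ ∈ (cotChart ℓ₀).source) :
    cotChartDeriv ℓ₀ ℓ (∑ i, c i • hamVec (hamLift (f i)) ℓ) =
      ∑ i, c i • hv canonicalJ (inCotChart ℓ₀ (hamLift (f i))) (cotChart ℓ₀ ℓ) := by
  rw [map_sum]
  refine Finset.sum_congr rfl fun i _ => ?_
  rw [map_smul, cotChartDeriv_hamVec _ h]

lemma isExp_of_isLocalExp
    (he : IsLocalExp (fun i => hv canonicalJ (inCotChart ℓ₀ (hamLift (f i)))) e U δ Ω)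
    (hΩ : Ω ⊆ (cotChart ℓ₀).target) (hs : ℓ ∈ (cotChart ℓ₀).source) (hU : cotChart ℓ₀ ℓ ∈ U)
    (hc : c ∈ Metric.ball (0 : Fin m → ℝ) δ) :
    IsExp f c ℓ ((cotChart ℓ₀).symm (e (cotChart ℓ₀ ℓ, c))) := by
  refine ⟨fun t => (cotChart ℓ₀).symm (e (cotChart ℓ₀ ℓ, t • c)), ?_, ?_, fun t ht => ?_⟩
  · simp only [zero_smul, he.zero _ hU]
    exact (cotChart ℓ₀).left_inv hs
  · simp only [one_smul]
  · have hm : e (cotChart ℓ₀ ℓ, t • c) ∈ (cotChart ℓ₀).target :=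
      hΩ (he.mem (cotChart ℓ₀ ℓ, t • c) ⟨hU, smul_mem_ball_zero hc ht⟩)
    refine hasMFDerivWithinAt_cotChart_symm_comp
      (he.deriv (cotChart ℓ₀ ℓ, c) ⟨hU, hc⟩ t ht).hasDerivWithinAt hm ?_
    rw [cotChartDeriv_sum_hamVec ((cotChart ℓ₀).map_target hm), (cotChart ℓ₀).right_inv hm]

/-- The given integral curve is not known to stay in the chart. The times up to which it agrees with
the chart trajectory form a closed set, as `T*M` is Hausdorff, and agreement extends to the right by
Lipschitz uniqueness. -/
lemma IsExp.eq_of_isLocalExp [T2Space M] (hex : IsExp f c ℓ ℓ')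
    (he : IsLocalExp (fun i => hv canonicalJ (inCotChart ℓ₀ (hamLift (f i)))) e U δ Ω)
    (hsm : ∀ i, ∀ z ∈ Ω, ContDiffAt ℝ ∞ (inCotChart ℓ₀ (hamLift (f i))) z)
    (hΩ : Ω ⊆ (cotChart ℓ₀).target) (hs : ℓ ∈ (cotChart ℓ₀).source) (hU : cotChart ℓ₀ ℓ ∈ U)
    (hc : c ∈ Metric.ball (0 : Fin m → ℝ) δ) :
    ℓ' = (cotChart ℓ₀).symm (e (cotChart ℓ₀ ℓ, c)) := by
  have hT2 : T2Space (Cotangent E M) := Bundle.totalSpace_t2Space _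
  obtain ⟨γ, h0, h1, hγ⟩ := hex
  set ζ : ℝ → E × (E →L[ℝ] ℝ) := fun t => e (cotChart ℓ₀ ℓ, t • c) with hζ
  set X : E × (E →L[ℝ] ℝ) → E × (E →L[ℝ] ℝ) :=
    fun z => ∑ i, c i • hv canonicalJ (inCotChart ℓ₀ (hamLift (f i))) z with hX
  have hζΩ : ∀ t ∈ Icc (0 : ℝ) 1, ζ t ∈ Ω := fun t ht =>
    he.mem (cotChart ℓ₀ ℓ, t • c) ⟨hU, smul_mem_ball_zero hc ht⟩
  have hζd : ∀ t ∈ Icc (0 : ℝ) 1, HasDerivAt ζ (X (ζ t)) t := fun t ht =>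
    he.deriv (cotChart ℓ₀ ℓ, c) ⟨hU, hc⟩ t ht
  have hγc : ContinuousOn γ (Icc 0 1) := fun t ht => (hγ t ht).continuousWithinAt
  have hηc : ContinuousOn (fun t => (cotChart ℓ₀).symm (ζ t)) (Icc 0 1) := fun t ht =>
    ((continuousAt_cotChart_symm (hΩ (hζΩ t ht))).comp
      (hζd t ht).continuousAt).continuousWithinAt
  have hsub : Icc (0 : ℝ) 1 ⊆ {t | γ t = (cotChart ℓ₀).symm (ζ t)} := by
    refine IsClosed.Icc_subset_of_forall_exists_gt ?_ ?_ ?_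
    · rw [inter_comm]
      exact isClosed_Icc.isClosed_eq hγc hηc
    · change γ 0 = (cotChart ℓ₀).symm (ζ 0)
      simp only [hζ, zero_smul, he.zero _ hU, h0]
      exact ((cotChart ℓ₀).left_inv hs).symm
    · rintro t ⟨ht, ht01⟩ y hy
      have ht' : t ∈ Icc (0 : ℝ) 1 := Ico_subset_Icc_self ht01
      have hz := hζΩ t ht'
      have hXs : ContDiffAt ℝ 1 X (ζ t) :=
        (ContDiffAt.sum fun i _ => (hsm i _ hz).hv.const_smul (c i)).of_le (by simp)
      obtain ⟨K, B, hB, hLip⟩ := hXs.exists_lipschitzOnWith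
      have hγt : γ t ∈ (cotChart ℓ₀).source := ht ▸ (cotChart ℓ₀).map_target (hΩ hz)
      have hΨγ : cotChart ℓ₀ (γ t) = ζ t := by rw [ht]; exact (cotChart ℓ₀).right_inv (hΩ hz)
      have hγW := hγc t ht'
      have hnear : ∀ᶠ τ in 𝓝[≥] t, τ ∈ Icc (0 : ℝ) 1 ∧ γ τ ∈ (cotChart ℓ₀).source ∧
          cotChart ℓ₀ (γ τ) ∈ B ∧ ζ τ ∈ B ∧ τ ≤ y := by
        have hle : 𝓝[≥] t ≤ 𝓝[Icc 0 1] t :=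
          nhdsWithin_le_of_mem (Icc_mem_nhdsGE_of_mem ht01)
        refine (Filter.Eventually.and (Icc_mem_nhdsGE_of_mem ht01) ?_)
        refine Filter.Eventually.and (hle (hγW (cotChart_source_mem_nhds hγt))) ?_
        refine Filter.Eventually.and (hle (((continuousAt_cotChart hγt).comp_continuousWithinAt
          hγW) (by
            change B ∈ 𝓝 (cotChart ℓ₀ (γ t))
            rwa [hΨγ]))) ?_
        refine Filter.Eventually.and
          (nhdsWithin_le_nhds ((hζd t ht').continuousAt.preimage_mem_nhds hB)) ?_
        exact nhdsWithin_le_nhds (Iic_mem_nhds hy)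
      obtain ⟨t', htt', hI⟩ := mem_nhdsGE_iff_exists_Icc_subset.1 hnear
      have htt : t < t' := htt'
      have hmem : ∀ τ ∈ Ico t t', τ ∈ Ico (0 : ℝ) 1 := fun τ hτ =>
        ⟨ht01.1.trans hτ.1, hτ.2.trans_le (hI ⟨htt.le, le_rfl⟩).1.2⟩
      have huniq : EqOn (fun τ => cotChart ℓ₀ (γ τ)) ζ (Icc t t') := by
        refine ODE_solution_unique_of_mem_Icc_right (v := fun _ => X) (s := fun _ => B) (K := K)
          (fun _ _ => hLip) (fun τ hτ => ?_) (fun τ hτ => ?_)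
          (fun τ hτ => (hI (Ico_subset_Icc_self hτ)).2.2.1) (fun τ hτ => ?_) (fun τ hτ => ?_)
          (fun τ hτ => (hI (Ico_subset_Icc_self hτ)).2.2.2.1) hΨγ
        · exact (continuousAt_cotChart (hI hτ).2.1).comp_continuousWithinAt
            ((hγc τ (hI hτ).1).mono fun σ hσ => (hI hσ).1)
        · have h1 := (hI (Ico_subset_Icc_self hτ)).2.1
          have h2 := hasDerivWithinAt_cotChart_comp (hγ τ (Ico_subset_Icc_self (hmem τ hτ))) h1
          rw [cotChartDeriv_sum_hamVec h1] at h2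
          exact h2.mono_of_mem_nhdsWithin (Icc_mem_nhdsGE_of_mem (hmem τ hτ))
        · exact (hζd τ (hI hτ).1).continuousAt.continuousWithinAt
        · exact (hζd τ (Ico_subset_Icc_self (hmem τ hτ))).hasDerivWithinAt
      have hend := hI ⟨htt.le, le_rfl⟩
      refine ⟨t', ?_, htt, hend.2.2.2.2⟩
      change γ t' = (cotChart ℓ₀).symm (ζ t')
      rw [← huniq ⟨htt.le, le_rfl⟩]
      exact ((cotChart ℓ₀).left_inv hend.2.1).symm
  rw [← h1, hsub ⟨zero_le_one, le_rfl⟩]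
  simp only [hζ, one_smul]

end Exp

end

end

/-! ### Local models near a point of `S` -/

noncomputable section

section

/-- Compactness of the unit sphere makes the neighbourhood uniform in `v`; homogeneity then covers
all nonzero vectors. -/
lemma eventually_negDef {P : Type*} [TopologicalSpace P] {m : ℕ} {L : Fin m → Fin m → P → ℝ}
    {z : P} (hc : ∀ i j, ContinuousAt (L i j) z)
    (h : ∀ v : Fin m → ℝ, v ≠ 0 → ∑ i, ∑ j, v i * v j * L i j z < 0) :
    ∀ᶠ y in 𝓝 z, ∀ v : Fin m → ℝ, v ≠ 0 → ∑ i, ∑ j, v i * v j * L i j y < 0 := by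
  have h1 : ∀ᶠ y in 𝓝 z, ∀ v ∈ Metric.sphere (0 : Fin m → ℝ) 1,
      ∑ i, ∑ j, v i * v j * L i j y < 0 := by
    refine (isCompact_sphere (0 : Fin m → ℝ) 1).eventually_forall_of_forall_eventually
      fun v hv => ?_
    have hv0 : v ≠ 0 := by
      rintro rfl
      simp at hv
    have hcont : ContinuousAt
        (fun p : P × (Fin m → ℝ) => ∑ i, ∑ j, p.2 i * p.2 j * L i j p.1) (z, v) := by
      refine tendsto_finsetSum _ fun i _ => tendsto_finsetSum _ fun j _ => ?_
      have hL : ContinuousAt (fun p : P × (Fin m → ℝ) => L i j p.1) (z, v) :=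
        ContinuousAt.comp (g := L i j) (hc i j) continuousAt_fst
      have hv : Continuous fun p : P × (Fin m → ℝ) => p.2 i * p.2 j := by fun_prop
      exact hv.continuousAt.mul hL
    exact hcont.eventually_lt_const (h v hv0)
  filter_upwards [h1] with y hy v hv
  have hn : 0 < ‖v‖ := norm_pos_iff.2 hv
  have h2 := hy (‖v‖⁻¹ • v) (by simp [norm_smul, hn.ne'])
  have h3 : ∑ i, ∑ j, (‖v‖⁻¹ • v) i * (‖v‖⁻¹ • v) j * L i j y =
      ‖v‖⁻¹ ^ 2 * ∑ i, ∑ j, v i * v j * L i j y := by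
    simp only [Finset.mul_sum, Pi.smul_apply, smul_eq_mul]
    exact Finset.sum_congr rfl fun i _ => Finset.sum_congr rfl fun j _ => by ring
  rw [h3] at h2
  by_contra hcon
  exact absurd h2 (not_lt.2 (mul_nonneg (by positivity) (not_lt.1 hcon)))

variable {E M : Type*} [NormedAddCommGroup E] [NormedSpace ℝ E] [FiniteDimensional ℝ E]
  [TopologicalSpace M] [ChartedSpace E M] [IsManifold 𝓘(ℝ, E) ∞ M] {m R : ℕ}

omit [FiniteDimensional ℝ E] in
lemma IsTangentVector.fderiv_eq_zero {A : Set (Cotangent E M)} {ℓ₀ ℓ : Cotangent E M}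
    {v : TangentSpace (cotModel E) ℓ} (h : IsTangentVector A ℓ v) (hs : ℓ ∈ (cotChart ℓ₀).source)
    {H : E × (E →L[ℝ] ℝ) → ℝ} (hH : DifferentiableAt ℝ H (cotChart ℓ₀ ℓ))
    (h0 : ∀ᶠ p in 𝓝 ℓ, p ∈ A → H (cotChart ℓ₀ p) = 0) :
    fderiv ℝ H (cotChart ℓ₀ ℓ) (cotChartDeriv ℓ₀ ℓ v) = 0 := by
  obtain ⟨γ, rfl, hγA, -, hγd⟩ := h
  have h1 := hasDerivWithinAt_cotChart_comp (s := univ) hγd.hasMFDerivWithinAt hs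
  rw [hasDerivWithinAt_univ] at h1
  have h2 : HasDerivAt (fun τ => H (cotChart ℓ₀ (γ τ))) _ 0 := hH.hasFDerivAt.comp_hasDerivAt 0 h1
  have h3 : (fun τ => H (cotChart ℓ₀ (γ τ))) =ᶠ[𝓝 0] fun _ => 0 := by
    filter_upwards [hγA, hγd.continuousAt.eventually h0] with τ h4 h5 using h5 h4
  exact h2.unique ((hasDerivAt_const 0 (0 : ℝ)).congr_of_eventuallyEq h3)

omit [FiniteDimensional ℝ E] in
lemma isTangentVector_of_hasDerivAt {A : Set (Cotangent E M)} {ℓ₀ ℓ : Cotangent E M}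
    {v : TangentSpace (cotModel E) ℓ} (hs : ℓ ∈ (cotChart ℓ₀).source)
    {ζ : ℝ → E × (E →L[ℝ] ℝ)} (h0 : ζ 0 = cotChart ℓ₀ ℓ)
    (hA : ∀ᶠ s in 𝓝 (0 : ℝ), (cotChart ℓ₀).symm (ζ s) ∈ A) (hζ : ContDiffAt ℝ ∞ ζ 0)
    (hd : HasDerivAt ζ (cotChartDeriv ℓ₀ ℓ v) 0) : IsTangentVector A ℓ v := by
  have hl : (cotChart ℓ₀).symm (ζ 0) = ℓ := by rw [h0]; exact (cotChart ℓ₀).left_inv hs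
  have ht : ζ 0 ∈ (cotChart ℓ₀).target := h0 ▸ cotChart_mem_target hs
  subst hl
  refine ⟨fun s => (cotChart ℓ₀).symm (ζ s), rfl, hA, ?_, ?_⟩
  · have h1 : ContMDiffAt 𝓘(ℝ, E × (E →L[ℝ] ℝ)) (cotModel E) ∞ (cotChart ℓ₀).symm (ζ 0) :=
      (contMDiffOn_extChartAt_symm (n := ∞) ℓ₀).contMDiffAt (cotChart_target_mem_nhds ht)
    exact ContMDiffAt.comp (0 : ℝ) h1 hζ.contMDiffAt
  · have := hasMFDerivWithinAt_cotChart_symm_comp (s := univ) hd.hasDerivWithinAt ht rfl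
    exact hasMFDerivWithinAt_univ.1 this

/-- The flows of the fields `F⃗ᵢ` near `ℓ₀`, read in the preferred chart at `ℓ₀`, together with
equations `G` of `Σ`. -/
structure IsLocalModel (f₀ : VField E M) (f : Fin m → VField E M) (ℓ₀ : Cotangent E M)
    (Ω : Set (E × (E →L[ℝ] ℝ))) (G : Fin R → E × (E →L[ℝ] ℝ) → ℝ)
    (e : (E × (E →L[ℝ] ℝ)) × (Fin m → ℝ) → E × (E →L[ℝ] ℝ)) (U : Set (E × (E →L[ℝ] ℝ)))
    (δ : ℝ) : Prop where
  mem : cotChart ℓ₀ ℓ₀ ∈ U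
  subset : U ⊆ Ω
  target : Ω ⊆ (cotChart ℓ₀).target
  frame : IsHamFrame canonicalJ Ω (inCotChart ℓ₀ (hamLift f₀))
    (fun i => inCotChart ℓ₀ (hamLift (f i))) G
  legendre : ∀ z ∈ Ω, ∀ v : Fin m → ℝ, v ≠ 0 → ∑ i, ∑ j, v i * v j *
    pb canonicalJ (inCotChart ℓ₀ (hamLift (f i)))
      (pb canonicalJ (inCotChart ℓ₀ (hamLift (f j))) (inCotChart ℓ₀ (hamLift f₀))) z < 0
  sigma : ∀ z ∈ Ω, (cotChart ℓ₀).symm z ∈ sigmaSet f ↔ ∀ k, G k z = 0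
  sing : ∀ z ∈ Ω, (cotChart ℓ₀).symm z ∈ singSet f₀ f ↔ (∀ k, G k z = 0) ∧
    ∀ k, pb canonicalJ (inCotChart ℓ₀ (hamLift f₀)) (G k) z = 0
  exp : IsLocalExp (fun i => hv canonicalJ (inCotChart ℓ₀ (hamLift (f i)))) e U δ Ω

lemma legendreForm_eq (f₀ : VField E M) (f : Fin m → VField E M) {ℓ₀ ℓ : Cotangent E M}
    (h : ℓ ∈ (cotChart ℓ₀).source) (v : Fin m → ℝ) :
    legendreForm f₀ f ℓ v = ∑ i, ∑ j, v i * v j *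
      pb canonicalJ (inCotChart ℓ₀ (hamLift (f i)))
        (pb canonicalJ (inCotChart ℓ₀ (hamLift (f j))) (inCotChart ℓ₀ (hamLift f₀)))
        (cotChart ℓ₀ ℓ) := by
  simp only [legendreForm, legendreMatrix, Matrix.of_apply, poisson_poisson_eq _ _ _ h]

/-- Existence of the local singular projection near a point of `S`. -/
lemma exists_isLocalModel {f₀ : VField E M} {f : Fin m → VField E M} (hf₀ : IsSmoothVField f₀)
    (hf : ∀ i, IsSmoothVField (f i)) {O : Set M} (hO : IsOpen O) (hreg : LieRegularOn f R O)
    {N : Set (Cotangent E M)} (hN : IsOpen N)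
    (hS : IsSubmanifoldOfCodimIn m (singSet f₀ f ∩ N) (sigmaSet f ∩ N))
    {ℓ₀ : Cotangent E M} (hℓ₀ : ℓ₀.1 ∈ O) (hℓ₀S : ℓ₀ ∈ singSet f₀ f) (hℓ₀N : ℓ₀ ∈ N)
    (hL : ∀ v : Fin m → ℝ, v ≠ 0 → legendreForm f₀ f ℓ₀ v < 0) :
    ∃ Ω, ∃ G : Fin R → E × (E →L[ℝ] ℝ) → ℝ, ∃ e U δ, IsLocalModel f₀ f ℓ₀ Ω G e U δ ∧
      ∃ θ : E × (E →L[ℝ] ℝ) → Fin m → ℝ, (∀ y ∈ U, ContDiffAt ℝ ∞ θ y) ∧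
      (∀ y ∈ U, ∀ c ∈ Metric.ball (0 : Fin m → ℝ) δ,
        (∀ i, pb canonicalJ (inCotChart ℓ₀ (hamLift f₀)) (inCotChart ℓ₀ (hamLift (f i)))
          (e (y, c)) = 0) ↔ θ y = c) ∧
      ∀ y ∈ U, (∀ k, G k y = 0) → (∀ i, pb canonicalJ (inCotChart ℓ₀ (hamLift f₀))
        (inCotChart ℓ₀ (hamLift (f i))) y = 0) →
        ∀ k, pb canonicalJ (inCotChart ℓ₀ (hamLift f₀)) (G k) y = 0 := by
  have hsrc : ℓ₀ ∈ (cotChart ℓ₀).source := mem_extChartAt_source ℓ₀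
  set z₀ := cotChart ℓ₀ ℓ₀ with hz₀
  have hsymm : (cotChart ℓ₀).symm z₀ = ℓ₀ := (cotChart ℓ₀).left_inv hsrc
  obtain ⟨Ω₁, G, hz₁, hΩ₁t, hfr₁, hsig₁, hsing₁⟩ := exists_isHamFrame hf₀ hf hO hreg hℓ₀
  have hleg : ∀ᶠ y in 𝓝 z₀, ∀ v : Fin m → ℝ, v ≠ 0 → ∑ i, ∑ j, v i * v j *
      pb canonicalJ (inCotChart ℓ₀ (hamLift (f i)))
      (pb canonicalJ (inCotChart ℓ₀ (hamLift (f j))) (inCotChart ℓ₀ (hamLift f₀))) y < 0 := by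
    refine eventually_negDef (fun i j => ?_) fun v hv => ?_
    · exact ((hfr₁.smooth i _ hz₁).pb ((hfr₁.smooth j _ hz₁).pb
        (hfr₁.smooth₀ _ hz₁))).continuousAt
    · rw [hz₀, ← legendreForm_eq f₀ f hsrc]
      exact hL v hv
  -- The form must be negative definite on all of `Ω`, not only at `z₀`: trajectories of the
  -- exponential range over `Ω`, and concavity is needed along them.
  obtain ⟨Ω, hΩ, hΩo, hzΩ⟩ := eventually_nhds_iff.1 (hleg.and (hfr₁.isOpen.mem_nhds hz₁))
  have hΩΩ : Ω ⊆ Ω₁ := fun z hz => (hΩ z hz).2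
  have hfr := hfr₁.mono hΩo hΩΩ
  have hΩt := hΩΩ.trans hΩ₁t
  have hsing : ∀ z ∈ Ω, _ := fun z hz => hsing₁ z (hΩΩ hz)
  have hsig : ∀ z ∈ Ω, _ := fun z hz => hsig₁ z (hΩΩ hz)
  obtain ⟨h0, h1⟩ := (hsing z₀ hzΩ).1 (hsymm.symm ▸ hℓ₀S)
  obtain ⟨W, hW, hℓ₀W, g, hg, hgS, hgs⟩ := hS.2 ℓ₀ ⟨hℓ₀S, hℓ₀N⟩
  have hnear : ∀ᶠ y in 𝓝 z₀, y ∈ Ω ∧ (cotChart ℓ₀).symm y ∈ W ∩ N := by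
    refine Filter.Eventually.and (hΩo.mem_nhds hzΩ) ?_
    refine (continuousAt_cotChart_symm (hΩt hzΩ)).preimage_mem_nhds ?_
    rw [hsymm]
    exact (hW.inter hN).mem_nhds ⟨hℓ₀W, hℓ₀N⟩
  have hgsm : ∀ᶠ y in 𝓝 z₀, ContDiffAt ℝ ∞ (inCotChart ℓ₀ g) y := by
    filter_upwards [hnear] with y hy
    have hyt := hΩt hy.1
    have := (contMDiffAt_iff_contDiffAt_inCotChart (F := g) ((cotChart ℓ₀).map_target hyt)).1
      (hg.contMDiffAt (hW.mem_nhds hy.2.1))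
    rwa [(cotChart ℓ₀).right_inv hyt] at this
  have hgsing : ∀ᶠ y in 𝓝 z₀, ((∀ k, G k y = 0) ∧
      ∀ k, pb canonicalJ (inCotChart ℓ₀ (hamLift f₀)) (G k) y = 0) ↔
      (∀ k, G k y = 0) ∧ inCotChart ℓ₀ g y = 0 := by
    filter_upwards [hnear] with y hy
    rw [← hsing y hy.1, ← hsig y hy.1]
    have := hgS _ hy.2.1
    simp only [mem_inter_iff, hy.2.2, and_true] at this
    exact this
  have hgsurj : ∀ w : Fin m → ℝ, ∃ v, (∀ k, fderiv ℝ (G k) z₀ v = 0) ∧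
      fderiv ℝ (inCotChart ℓ₀ g) z₀ v = w := by
    intro w
    obtain ⟨v, htan, hv⟩ := hgs ℓ₀ ⟨⟨hℓ₀S, hℓ₀N⟩, hℓ₀W⟩ w
    refine ⟨cotChartDeriv ℓ₀ ℓ₀ v, fun k => ?_, ?_⟩
    · refine htan.fderiv_eq_zero hsrc ((hfr.smoothG k _ hzΩ).differentiableAt (by simp)) ?_
      filter_upwards [cotChart_source_mem_nhds hsrc, (continuousAt_cotChart hsrc).preimage_mem_nhds
        (hΩo.mem_nhds hzΩ)] with p hp hpΩ hpA
      refine (hsig (cotChart ℓ₀ p) hpΩ).1 ?_ k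
      rw [(cotChart ℓ₀).left_inv hp]
      exact hpA.1
    · rw [← hv]
      exact (mfderiv_eq_fderiv_cotChart g hsrc v).symm
  obtain ⟨e, U, δ, θ, hzU, hUΩ, he, hθ, hθQ, hQ⟩ := hfr.exists_local_projection canonicalJ_skew
    (hΩ z₀ hzΩ).1 hzΩ h0 h1 hgsm hgsing hgsurj
  exact ⟨Ω, G, e, U, δ, ⟨hzU, hUΩ, hΩt, hfr, fun z hz => (hΩ z hz).1, hsig, hsing, he⟩, θ, hθ,
    hθQ, hQ⟩

end

end

/-! ### The super-Hamiltonian near a point of `S` -/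

noncomputable section

section

variable {E M : Type*} [NormedAddCommGroup E] [NormedSpace ℝ E] [FiniteDimensional ℝ E]
  [TopologicalSpace M] [ChartedSpace E M] [IsManifold 𝓘(ℝ, E) ∞ M] {m R : ℕ}
  {f₀ : VField E M} {f : Fin m → VField E M}

namespace IsLocalModel

variable {ℓ₀ ℓ ℓ' : Cotangent E M} {Ω : Set (E × (E →L[ℝ] ℝ))} {G : Fin R → E × (E →L[ℝ] ℝ) → ℝ}
  {e : (E × (E →L[ℝ] ℝ)) × (Fin m → ℝ) → E × (E →L[ℝ] ℝ)} {U : Set (E × (E →L[ℝ] ℝ))}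
  {δ : ℝ} {c : Fin m → ℝ}

lemma mem_source (h : IsLocalModel f₀ f ℓ₀ Ω G e U δ) :
    ℓ₀ ∈ (cotChart ℓ₀).source ∩ cotChart ℓ₀ ⁻¹' U :=
  ⟨mem_extChartAt_source ℓ₀, h.mem⟩

lemma isOpen (h : IsLocalModel f₀ f ℓ₀ Ω G e U δ) :
    IsOpen ((cotChart ℓ₀).source ∩ cotChart ℓ₀ ⁻¹' U) :=
  (continuousOn_extChartAt ℓ₀).isOpen_inter_preimage (isOpen_extChartAt_source ℓ₀) h.exp.isOpen

lemma exp_mem (h : IsLocalModel f₀ f ℓ₀ Ω G e U δ)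
    (hℓ : ℓ ∈ (cotChart ℓ₀).source ∩ cotChart ℓ₀ ⁻¹' U) (hc : c ∈ Metric.ball 0 δ) :
    e (cotChart ℓ₀ ℓ, c) ∈ Ω :=
  h.exp.mem (cotChart ℓ₀ ℓ, c) ⟨hℓ.2, hc⟩

lemma isExp_iff [T2Space M] (h : IsLocalModel f₀ f ℓ₀ Ω G e U δ)
    (hℓ : ℓ ∈ (cotChart ℓ₀).source ∩ cotChart ℓ₀ ⁻¹' U) (hc : c ∈ Metric.ball 0 δ) :
    IsExp f c ℓ ℓ' ↔ ℓ' = (cotChart ℓ₀).symm (e (cotChart ℓ₀ ℓ, c)) := by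
  refine ⟨fun hex => hex.eq_of_isLocalExp h.exp h.frame.smooth h.target hℓ.1 hℓ.2 hc, ?_⟩
  rintro rfl
  exact isExp_of_isLocalExp h.exp h.target hℓ.1 hℓ.2 hc

lemma sigma_iff (h : IsLocalModel f₀ f ℓ₀ Ω G e U δ)
    (hℓ : ℓ ∈ (cotChart ℓ₀).source ∩ cotChart ℓ₀ ⁻¹' U) :
    ℓ ∈ sigmaSet f ↔ ∀ k, G k (cotChart ℓ₀ ℓ) = 0 := by
  rw [← h.sigma _ (h.subset hℓ.2), (cotChart ℓ₀).left_inv hℓ.1]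

lemma sing_iff (h : IsLocalModel f₀ f ℓ₀ Ω G e U δ)
    (hℓ : ℓ ∈ (cotChart ℓ₀).source ∩ cotChart ℓ₀ ⁻¹' U) :
    ℓ ∈ singSet f₀ f ↔ (∀ k, G k (cotChart ℓ₀ ℓ) = 0) ∧
      ∀ k, pb canonicalJ (inCotChart ℓ₀ (hamLift f₀)) (G k) (cotChart ℓ₀ ℓ) = 0 := by
  rw [← h.sing _ (h.subset hℓ.2), (cotChart ℓ₀).left_inv hℓ.1]

lemma symm_mem_nhds (h : IsLocalModel f₀ f ℓ₀ Ω G e U δ)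
    (hℓ : ℓ ∈ (cotChart ℓ₀).source ∩ cotChart ℓ₀ ⁻¹' U) {V : Set (Cotangent E M)} (hV : V ∈ 𝓝 ℓ) :
    ∀ᶠ y in 𝓝 (cotChart ℓ₀ ℓ), y ∈ U ∧ (cotChart ℓ₀).symm y ∈ V := by
  refine Filter.Eventually.and (h.exp.isOpen.mem_nhds hℓ.2) ?_
  refine (continuousAt_cotChart_symm (cotChart_mem_target hℓ.1)).preimage_mem_nhds ?_
  rwa [(cotChart ℓ₀).left_inv hℓ.1]

/-- The properties of a super-Hamiltonian near a point of `S`. -/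
lemma exists_superHam_properties [T2Space M] (h : IsLocalModel f₀ f ℓ₀ Ω G e U δ) (hℓ₀ : ℓ₀ ∈ singSet f₀ f)
    {W : Set (Cotangent E M)} {θ : Cotangent E M → Fin m → ℝ}
    {φ : Cotangent E M → Cotangent E M} (hp : IsSingularProjection f₀ f W θ φ) (hW : ℓ₀ ∈ W) :
    ∃ V : Set (Cotangent E M), IsOpen V ∧ ℓ₀ ∈ V ∧ V ⊆ W ∧
      ContMDiffOn (cotModel E) 𝓘(ℝ, ℝ) ∞ (superHam f₀ φ) V ∧
      (∀ ℓ ∈ singSet f₀ f ∩ V, superHam f₀ φ ℓ = hamLift f₀ ℓ ∧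
        hamVec (superHam f₀ φ) ℓ = hamVec (hamLift f₀) ℓ) ∧
      (∀ ℓ ∈ sigmaSet f ∩ V,
        IsTangentVector (sigmaSet f) ℓ (hamVec (superHam f₀ φ) ℓ)) ∧
      (∀ ℓ ∈ sigmaSet f ∩ V, hamLift f₀ ℓ ≤ superHam f₀ φ ℓ) := by
  have : CompleteSpace E := FiniteDimensional.complete ℝ E
  have hθc : ContinuousOn θ W := continuousOn_pi.2 fun i => (hp.smooth i).continuousOn
  set D := (cotChart ℓ₀).source ∩ cotChart ℓ₀ ⁻¹' U with hD
  -- Since `θ` vanishes at `ℓ₀` and is continuous, the coefficients are small nearby, where `φ` must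
  -- coincide with the chart exponential.
  set V := D ∩ (W ∩ θ ⁻¹' Metric.ball 0 δ) with hVdef
  have hV : IsOpen V :=
    h.isOpen.inter (hθc.isOpen_inter_preimage hp.isOpen Metric.isOpen_ball)
  have hℓ₀V : ℓ₀ ∈ V := by
    refine ⟨h.mem_source, hW, ?_⟩
    rw [mem_preimage, hp.zero_sing ℓ₀ ⟨hℓ₀, hW⟩]
    exact Metric.mem_ball_self h.exp.pos
  set θ' := inCotChart ℓ₀ θ with hθ'
  set F₀ := inCotChart ℓ₀ (hamLift f₀) with hF₀
  have hφ : ∀ ℓ ∈ V, φ ℓ = (cotChart ℓ₀).symm (e (cotChart ℓ₀ ℓ, θ ℓ)) := fun ℓ hℓ =>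
    (h.isExp_iff hℓ.1 hℓ.2.2).1 (hp.flow ℓ hℓ.2.1)
  have hθℓ : ∀ ℓ ∈ V, θ' (cotChart ℓ₀ ℓ) = θ ℓ := fun ℓ hℓ => inCotChart_apply θ hℓ.1.1
  have hHℓ : ∀ ℓ ∈ V, superHam f₀ φ ℓ = F₀ (e (cotChart ℓ₀ ℓ, θ' (cotChart ℓ₀ ℓ))) := by
    intro ℓ hℓ
    rw [superHam, hφ ℓ hℓ, hθℓ ℓ hℓ]
    rfl
  have hH : ∀ ℓ ∈ V, inCotChart ℓ₀ (superHam f₀ φ) =ᶠ[𝓝 (cotChart ℓ₀ ℓ)]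
      fun y => F₀ (e (y, θ' y)) := by
    intro ℓ hℓ
    filter_upwards [h.symm_mem_nhds hℓ.1 (hV.mem_nhds hℓ)] with y hy
    have := hHℓ _ hy.2
    rwa [(cotChart ℓ₀).right_inv (h.target (h.subset hy.1))] at this
  have hθs : ∀ ℓ ∈ V, ContDiffAt ℝ ∞ θ' (cotChart ℓ₀ ℓ) := by
    intro ℓ hℓ
    refine contDiffAt_pi.2 fun i => ?_
    exact (contMDiffAt_iff_contDiffAt_inCotChart (F := fun p => θ p i) hℓ.1.1).1
      ((hp.smooth i).contMDiffAt (hp.isOpen.mem_nhds hℓ.2.1))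
  have hball : ∀ ℓ ∈ V, θ' (cotChart ℓ₀ ℓ) ∈ Metric.ball 0 δ := fun ℓ hℓ => by
    rw [hθℓ ℓ hℓ]
    exact hℓ.2.2
  have hmem : ∀ ℓ ∈ V, e (cotChart ℓ₀ ℓ, θ' (cotChart ℓ₀ ℓ)) ∈ Ω := fun ℓ hℓ =>
    h.exp_mem hℓ.1 (hball ℓ hℓ)
  have hsingφ : ∀ ℓ ∈ sigmaSet f ∩ V, (∀ k, G k (e (cotChart ℓ₀ ℓ, θ' (cotChart ℓ₀ ℓ))) = 0) ∧
      ∀ k, pb canonicalJ F₀ (G k) (e (cotChart ℓ₀ ℓ, θ' (cotChart ℓ₀ ℓ))) = 0 := by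
    rintro ℓ ⟨hs, hℓ⟩
    refine (h.sing _ (hmem ℓ hℓ)).1 ?_
    rw [hθℓ ℓ hℓ, ← hφ ℓ hℓ]
    exact hp.mapsTo_sing ⟨hs, hℓ.2.1⟩
  refine ⟨V, hV, hℓ₀V, fun ℓ hℓ => hℓ.2.1, fun ℓ hℓ => ?_, fun ℓ hℓ => ?_, fun ℓ hℓ => ?_,
    fun ℓ hℓ => ?_⟩
  · refine ContMDiffAt.contMDiffWithinAt ((contMDiffAt_iff_contDiffAt_inCotChart hℓ.1.1).2 ?_)
    exact (IsHamFrame.contDiffAt_exp h.exp hℓ.1.2 (hθs ℓ hℓ) (hball ℓ hℓ)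
      (h.frame.smooth₀ _ (hmem ℓ hℓ))).congr_of_eventuallyEq (hH ℓ hℓ)
  · obtain ⟨hs, hℓ⟩ := hℓ
    have hθ0 : θ' (cotChart ℓ₀ ℓ) = 0 := by
      rw [hθℓ ℓ hℓ, hp.zero_sing ℓ ⟨hs, hℓ.2.1⟩]
    obtain ⟨g0, g1⟩ := (h.sing_iff hℓ.1).1 hs
    have hzΩ := h.subset hℓ.1.2
    refine ⟨?_, (cotChartDeriv_bijective hℓ.1.1).injective ?_⟩
    · rw [hHℓ ℓ hℓ, hθ0, h.exp.zero _ hℓ.1.2]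
      exact inCotChart_apply _ hℓ.1.1
    · rw [cotChartDeriv_hamVec _ hℓ.1.1, cotChartDeriv_hamVec _ hℓ.1.1, hv, hv, (hH ℓ hℓ).fderiv_eq,
        h.frame.fderiv_superHam_of_sing canonicalJ_skew h.exp hℓ.1.2 hzΩ
          ((hθs ℓ hℓ).differentiableAt (by simp)) hθ0
          (h.frame.pb_eq_zero canonicalJ_skew hzΩ g0 g1)]
  · obtain ⟨g0, g1⟩ := hsingφ ℓ hℓ
    obtain ⟨hs, hℓ⟩ := hℓ
    have hG0 := (h.sigma_iff hℓ.1).1 hs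
    have hzΩ := h.subset hℓ.1.2
    -- Skewness exchanges `dG_k(H⃗₀)` for `-dH₀(G⃗_k)`, which vanishes because `φ ℓ` lies in `S`.
    have htan : ∀ k, fderiv ℝ (G k) (cotChart ℓ₀ ℓ)
        (cotChartDeriv ℓ₀ ℓ (hamVec (superHam f₀ φ) ℓ)) = 0 := by
      intro k
      rw [cotChartDeriv_hamVec _ hℓ.1.1]
      change pb canonicalJ _ (G k) _ = 0
      rw [pb_skew canonicalJ_skew, pb, (hH ℓ hℓ).fderiv_eq,
        h.frame.fderiv_superHam_eq_zero canonicalJ_skew h.exp hℓ.1.2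
          ((hθs ℓ hℓ).differentiableAt (by simp)) (hball ℓ hℓ) hG0 g1, neg_zero]
    obtain ⟨ζ, hζ0, hζG, hζs, hζd⟩ := h.frame.exists_curve hzΩ hG0 htan
    exact isTangentVector_of_hasDerivAt hℓ.1.1 hζ0
      (hζG.mono fun s hs => (h.sigma _ hs.1).2 hs.2) hζs hζd
  · obtain ⟨g0, g1⟩ := hsingφ ℓ hℓ
    obtain ⟨hs, hℓ⟩ := hℓ
    have := h.frame.le_exp canonicalJ_skew h.legendre h.exp hℓ.1.2 (hball ℓ hℓ)
      (h.frame.pb_eq_zero canonicalJ_skew (hmem ℓ hℓ) g0 g1)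
    rw [hHℓ ℓ hℓ]
    refine le_of_eq_of_le ?_ this
    exact (inCotChart_apply _ hℓ.1.1).symm

end IsLocalModel

end

end

/-! ### Chart-free local solutions `ϑ` and the formula for `dϑ` -/

noncomputable section

section

variable {E M : Type*} [NormedAddCommGroup E] [NormedSpace ℝ E] [FiniteDimensional ℝ E]
  [TopologicalSpace M] [ChartedSpace E M] [IsManifold 𝓘(ℝ, E) ∞ M] {m R : ℕ}
  {f₀ : VField E M} {f : Fin m → VField E M}

lemma poisson_hamLift {g h : VField E M} (hg : IsSmoothVField g) (hh : IsSmoothVField h)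
    (ℓ : Cotangent E M) : poisson (hamLift g) (hamLift h) ℓ =
      hamLift (VectorField.mlieBracket 𝓘(ℝ, E) g h) ℓ := by
  have hs : ℓ ∈ (cotChart ℓ).source := mem_extChartAt_source ℓ
  rw [poisson_eq _ _ hs, pb_hamLift hg hh (cotChart_mem_target hs), inCotChart_apply _ hs]

omit [FiniteDimensional ℝ E] in
lemma isExp_zero (ℓ : Cotangent E M) : IsExp f 0 ℓ ℓ := by
  refine ⟨fun _ => ℓ, rfl, rfl, fun t _ => ?_⟩
  have h := hasMFDerivWithinAt_const (I := 𝓘(ℝ, ℝ)) (I' := cotModel E) ℓ (s := Icc (0 : ℝ) 1) (x := t)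
  refine h.congr_mfderiv ?_
  refine ContinuousLinearMap.ext fun (r : ℝ) => ?_
  have h0 : (∑ i, (0 : Fin m → ℝ) i • hamVec (hamLift (f i)) ℓ) = 0 :=
    Finset.sum_eq_zero fun i _ => by simp
  refine ((smul_zero r).symm : (0 : TangentSpace (cotModel E) ℓ) = r • 0).trans ?_
  rw [← h0]
  rfl

/-- A nonzero kernel vector would give the form the value `0`, so the matrix is invertible. -/
lemma Matrix.eq_inv_mulVec_of_negDef {A : Matrix (Fin m) (Fin m) ℝ}
    (hA : ∀ v : Fin m → ℝ, v ≠ 0 → ∑ i, ∑ j, v i * v j * A i j < 0) {x y : Fin m → ℝ}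
    (h : A *ᵥ x = y) : x = A⁻¹ *ᵥ y := by
  have hdet : A.det ≠ 0 := by
    intro h0
    obtain ⟨v, hv, hAv⟩ := Matrix.exists_mulVec_eq_zero_iff.2 h0
    refine (hA v hv).ne ?_
    have h1 : ∀ i, ∑ j, v i * v j * A i j = v i * (A *ᵥ v) i := fun i => by
      rw [Matrix.mulVec, dotProduct, Finset.mul_sum]
      exact Finset.sum_congr rfl fun j _ => by ring
    simp [h1, hAv]
  rw [← h, Matrix.mulVec_mulVec, Matrix.nonsing_inv_mul _ (isUnit_iff_ne_zero.2 hdet),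
    Matrix.one_mulVec]

/-- On `V`, the flows `exp(∑ cᵢ F⃗ᵢ)` with `|c| < δ` exist and `ϑ` is the solution of
`{F₀, F i}(exp(∑ ϑⱼ F⃗ⱼ)) = 0`. -/
structure IsLocalSolution (f₀ : VField E M) (f : Fin m → VField E M) (V : Set (Cotangent E M))
    (δ : ℝ) (ϑ : Cotangent E M → Fin m → ℝ) (ε : Cotangent E M → (Fin m → ℝ) → Cotangent E M) :
    Prop where
  isOpen : IsOpen V
  pos : 0 < δ
  isExp_iff : ∀ ℓ ∈ V, ∀ c ∈ Metric.ball (0 : Fin m → ℝ) δ, ∀ ℓ', IsExp f c ℓ ℓ' ↔ ℓ' = ε ℓ c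
  smooth : ∀ ℓ ∈ V, ContMDiffAt (cotModel E) 𝓘(ℝ, Fin m → ℝ) ∞ ϑ ℓ
  eq_iff : ∀ ℓ ∈ V, ∀ c ∈ Metric.ball (0 : Fin m → ℝ) δ,
    (∀ i, poisson (hamLift f₀) (hamLift (f i)) (ε ℓ c) = 0) ↔ ϑ ℓ = c
  continuousAt : ∀ ℓ ∈ V, ϑ ℓ ∈ Metric.ball (0 : Fin m → ℝ) δ →
    ContinuousAt (fun p => ε p (ϑ p)) ℓ
  exp_mem : ∀ ℓ ∈ V, ℓ ∈ sigmaSet f → ∀ c ∈ Metric.ball (0 : Fin m → ℝ) δ, ε ℓ c ∈ sigmaSet f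
  mem_sing : ∀ ℓ ∈ V, ℓ ∈ sigmaSet f →
    (∀ i, poisson (hamLift f₀) (hamLift (f i)) ℓ = 0) → ℓ ∈ singSet f₀ f
  legendre : ∀ ℓ ∈ V, ∀ v : Fin m → ℝ, v ≠ 0 → legendreForm f₀ f ℓ v < 0
  diff : ∀ ℓ ∈ V, ℓ ∈ singSet f₀ f → ∀ v : TangentSpace (cotModel E) ℓ,
    (fun i => cotDiff (fun p => ϑ p i) ℓ v) = (legendreMatrix f₀ f ℓ)⁻¹ *ᵥ
      (fun i => cotDiff (poisson (hamLift f₀) (hamLift (f i))) ℓ v)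

lemma poisson_eq_zero_of_mem_singSet (hf₀ : IsSmoothVField f₀) (hf : ∀ i, IsSmoothVField (f i))
    {ℓ : Cotangent E M} (h : ℓ ∈ singSet f₀ f) (i : Fin m) :
    poisson (hamLift f₀) (hamLift (f i)) ℓ = 0 := by
  rw [poisson_hamLift hf₀ (hf i)]
  exact h.2 _ (.basic i)

lemma IsLocalModel.isLocalSolution [T2Space M] {ℓ₀ : Cotangent E M}
    {Ω : Set (E × (E →L[ℝ] ℝ))} {G : Fin R → E × (E →L[ℝ] ℝ) → ℝ}
    {e : (E × (E →L[ℝ] ℝ)) × (Fin m → ℝ) → E × (E →L[ℝ] ℝ)} {U : Set (E × (E →L[ℝ] ℝ))} {δ : ℝ}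
    (h : IsLocalModel f₀ f ℓ₀ Ω G e U δ) {θ : E × (E →L[ℝ] ℝ) → Fin m → ℝ}
    (hθ : ∀ y ∈ U, ContDiffAt ℝ ∞ θ y)
    (hθQ : ∀ y ∈ U, ∀ c ∈ Metric.ball (0 : Fin m → ℝ) δ,
      (∀ i, pb canonicalJ (inCotChart ℓ₀ (hamLift f₀)) (inCotChart ℓ₀ (hamLift (f i)))
        (e (y, c)) = 0) ↔ θ y = c)
    (hQ : ∀ y ∈ U, (∀ k, G k y = 0) → (∀ i, pb canonicalJ (inCotChart ℓ₀ (hamLift f₀))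
      (inCotChart ℓ₀ (hamLift (f i))) y = 0) →
      ∀ k, pb canonicalJ (inCotChart ℓ₀ (hamLift f₀)) (G k) y = 0) :
    IsLocalSolution f₀ f ((cotChart ℓ₀).source ∩ cotChart ℓ₀ ⁻¹' U) δ
      (fun ℓ => θ (cotChart ℓ₀ ℓ)) (fun ℓ c => (cotChart ℓ₀).symm (e (cotChart ℓ₀ ℓ, c))) := by
  have hpoi : ∀ ℓ ∈ (cotChart ℓ₀).source ∩ cotChart ℓ₀ ⁻¹' U, ∀ c ∈ Metric.ball (0 : Fin m → ℝ) δ,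
      ∀ i, poisson (hamLift f₀) (hamLift (f i)) ((cotChart ℓ₀).symm (e (cotChart ℓ₀ ℓ, c))) =
      pb canonicalJ (inCotChart ℓ₀ (hamLift f₀)) (inCotChart ℓ₀ (hamLift (f i)))
        (e (cotChart ℓ₀ ℓ, c)) := fun ℓ hℓ c hc i =>
    inCotChart_poisson _ _ (h.target (h.exp_mem hℓ hc))
  have hθℓ : ∀ ℓ ∈ (cotChart ℓ₀).source ∩ cotChart ℓ₀ ⁻¹' U,
      ContMDiffAt (cotModel E) 𝓘(ℝ, Fin m → ℝ) ∞ (fun ℓ => θ (cotChart ℓ₀ ℓ)) ℓ := by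
    intro ℓ hℓ
    refine (contMDiffAt_iff_contDiffAt_inCotChart hℓ.1).2 ?_
    refine (hθ _ hℓ.2).congr_of_eventuallyEq ?_
    filter_upwards [cotChart_target_mem_nhds (cotChart_mem_target hℓ.1)] with y hy
    exact congrArg θ ((cotChart ℓ₀).right_inv hy)
  refine
    { isOpen := h.isOpen
      pos := h.exp.pos
      isExp_iff := fun ℓ hℓ c hc ℓ' => h.isExp_iff hℓ hc
      smooth := hθℓ
      eq_iff := fun ℓ hℓ c hc => ?_
      continuousAt := fun ℓ hℓ hc => ?_
      exp_mem := fun ℓ hℓ hs c hc => ?_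
      mem_sing := fun ℓ hℓ hs hq => ?_
      legendre := fun ℓ hℓ v hv => ?_
      diff := fun ℓ hℓ hs v => ?_ }
  · rw [← hθQ _ hℓ.2 c hc]
    exact forall_congr' fun i => by rw [hpoi ℓ hℓ c hc]
  · refine ContinuousAt.comp (g := (cotChart ℓ₀).symm)
      (continuousAt_cotChart_symm (h.target (h.exp_mem hℓ hc))) ?_
    refine ContinuousAt.comp (g := e) (f := fun p => (cotChart ℓ₀ p, θ (cotChart ℓ₀ p)))
      (h.exp.smooth (cotChart ℓ₀ ℓ, θ (cotChart ℓ₀ ℓ)) ⟨hℓ.2, hc⟩).continuousAt ?_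
    exact (continuousAt_cotChart hℓ.1).prodMk (hθℓ ℓ hℓ).continuousAt
  · rw [h.sigma _ (h.exp_mem hℓ hc)]
    have := h.frame.flow_mem h.exp hℓ.2 hc ((h.sigma_iff hℓ).1 hs) 1 ⟨zero_le_one, le_rfl⟩
    simpa only [one_smul] using this
  · rw [h.sing_iff hℓ]
    have hG := (h.sigma_iff hℓ).1 hs
    refine ⟨hG, hQ _ hℓ.2 hG fun i => ?_⟩
    rw [← poisson_eq _ _ hℓ.1, hq]
  · rw [legendreForm_eq f₀ f hℓ.1]
    exact h.legendre _ (h.subset hℓ.2) v hv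
  · have hzΩ := h.subset hℓ.2
    obtain ⟨g0, g1⟩ := (h.sing_iff hℓ).1 hs
    set z := cotChart ℓ₀ ℓ with hz
    have hθ0 : θ z = 0 := by
      refine (hθQ z hℓ.2 0 (Metric.mem_ball_self h.exp.pos)).1 fun i => ?_
      rw [h.exp.zero z hℓ.2]
      exact h.frame.pb_eq_zero canonicalJ_skew hzΩ g0 g1 i
    have hev : ∀ᶠ y in 𝓝 z, ∀ i, pb canonicalJ (inCotChart ℓ₀ (hamLift f₀))
        (inCotChart ℓ₀ (hamLift (f i))) (e (y, θ y)) = 0 := by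
      have hb : Metric.ball (0 : Fin m → ℝ) δ ∈ 𝓝 (θ z) := by
        rw [hθ0]
        exact Metric.ball_mem_nhds _ h.exp.pos
      filter_upwards [h.exp.isOpen.mem_nhds hℓ.2,
        (hθ z hℓ.2).continuousAt.preimage_mem_nhds hb] with y h1 h2
      exact (hθQ y h1 _ h2).2 rfl
    refine Matrix.eq_inv_mulVec_of_negDef (fun w hw => ?_) (funext fun i => ?_)
    · have := h.legendre z hzΩ w hw
      rw [← legendreForm_eq f₀ f hℓ.1] at this
      exact this
    · have h1 := h.frame.fderiv_theta canonicalJ_skew h.exp hℓ.2 hzΩ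
        ((hθ z hℓ.2).differentiableAt (by simp)) hθ0 hev i (cotChartDeriv ℓ₀ ℓ v)
      have h2 : cotDiff (poisson (hamLift f₀) (hamLift (f i))) ℓ v =
          fderiv ℝ (pb canonicalJ (inCotChart ℓ₀ (hamLift f₀)) (inCotChart ℓ₀ (hamLift (f i)))) z
            (cotChartDeriv ℓ₀ ℓ v) := by
        rw [cotDiff_eq _ hℓ.1,
          (inCotChart_poisson_eventuallyEq _ _ (cotChart_mem_target hℓ.1)).fderiv_eq]
      have h3 : ∀ j, cotDiff (fun p => θ (cotChart ℓ₀ p) j) ℓ v =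
          fderiv ℝ θ z (cotChartDeriv ℓ₀ ℓ v) j := by
        intro j
        rw [cotDiff_eq _ hℓ.1]
        have h4 : inCotChart ℓ₀ (fun p => θ (cotChart ℓ₀ p) j) =ᶠ[𝓝 z] fun y => θ y j := by
          filter_upwards [cotChart_target_mem_nhds (cotChart_mem_target hℓ.1)] with y hy
          exact congrArg (fun y => θ y j) ((cotChart ℓ₀).right_inv hy)
        rw [h4.fderiv_eq]
        exact DFunLike.congr_fun (hasFDerivAt_pi'.1 ((hθ z hℓ.2).differentiableAt
          (by simp)).hasFDerivAt j).fderiv _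
      rw [h2, h1, Matrix.mulVec, dotProduct]
      refine Finset.sum_congr rfl fun j _ => ?_
      -- Differentiation produces the transposed Legendre matrix, which is the same on `S` by
      -- Jacobi.
      rw [h3, legendreMatrix, Matrix.of_apply, poisson_poisson_eq _ _ _ hℓ.1,
        h.frame.legendre_symm canonicalJ_skew hzΩ g0 g1 i j, mul_comm]

end

end

/-! ### Gluing along the compact extremal, and the extremal lies in `S` -/

noncomputable section

section

variable {E M : Type*} [NormedAddCommGroup E] [NormedSpace ℝ E] [FiniteDimensional ℝ E]
  [TopologicalSpace M] [ChartedSpace E M] [IsManifold 𝓘(ℝ, E) ∞ M] {m R : ℕ}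
  {f₀ : VField E M} {f : Fin m → VField E M}

/-- Local solutions near the points of a compact subset of `S` glue to a singular projection. -/
lemma exists_isSingularProjection (hf₀ : IsSmoothVField f₀)
    (hf : ∀ i, IsSmoothVField (f i)) {K : Set (Cotangent E M)} (hK : IsCompact K)
    (hKS : K ⊆ singSet f₀ f)
    (hloc : ∀ ℓ₀ ∈ K, ∃ V δ ϑ ε, ℓ₀ ∈ V ∧ IsLocalSolution f₀ f V δ ϑ ε) :
    ∃ (U : Set (Cotangent E M)) (θ : Cotangent E M → Fin m → ℝ)
      (φ : Cotangent E M → Cotangent E M), K ⊆ U ∧ IsSingularProjection f₀ f U θ φ := by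
  choose! V δ ϑ ε hmem hsol using hloc
  obtain ⟨t, htK, hcov⟩ := hK.elim_nhds_subcover V
    fun ℓ hℓ => (hsol ℓ hℓ).isOpen.mem_nhds (hmem ℓ hℓ)
  -- One radius within the uniqueness range of all the finitely many local solutions, so that they
  -- can be compared.
  obtain ⟨r, hrδ, hr⟩ : ∃ r : ℝ, (∀ i ∈ t, r ≤ δ i) ∧ 0 < r := by
    have h1 : ∀ᶠ r in 𝓝[>] (0 : ℝ), ∀ i ∈ t, r ≤ δ i :=
      (Filter.eventually_all_finset t).2 fun i hi =>
        nhdsWithin_le_nhds (Iic_mem_nhds (hsol i (htK i hi)).pos)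
    obtain ⟨r, h2, h3⟩ := (h1.and self_mem_nhdsWithin).exists
    exact ⟨r, h2, h3⟩
  set Q : Cotangent E M → Prop := fun ℓ => ∀ i, poisson (hamLift f₀) (hamLift (f i)) ℓ = 0 with hQ
  set W : Cotangent E M → Set (Cotangent E M) :=
    fun i => V i ∩ ϑ i ⁻¹' Metric.ball 0 r with hW
  have hball : ∀ i ∈ t, Metric.ball (0 : Fin m → ℝ) r ⊆ Metric.ball 0 (δ i) := fun i hi =>
    Metric.ball_subset_ball (hrδ i hi)
  have hWo : ∀ i ∈ t, IsOpen (W i) := fun i hi =>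
    ContinuousOn.isOpen_inter_preimage
      (fun ℓ hℓ => ((hsol i (htK i hi)).smooth ℓ hℓ).continuousAt.continuousWithinAt)
      (hsol i (htK i hi)).isOpen Metric.isOpen_ball
  have hε0 : ∀ i ∈ t, ∀ ℓ ∈ V i, ε i ℓ 0 = ℓ := fun i hi ℓ hℓ =>
    (((hsol i (htK i hi)).isExp_iff ℓ hℓ 0 (Metric.mem_ball_self (hsol i (htK i hi)).pos) ℓ).1
      (isExp_zero ℓ)).symm
  have hϑ0 : ∀ i ∈ t, ∀ ℓ ∈ V i, Q ℓ → ϑ i ℓ = 0 := fun i hi ℓ hℓ hq =>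
    ((hsol i (htK i hi)).eq_iff ℓ hℓ 0 (Metric.mem_ball_self (hsol i (htK i hi)).pos)).1
      (by rwa [hε0 i hi ℓ hℓ])
  have hQε : ∀ i ∈ t, ∀ ℓ ∈ W i, Q (ε i ℓ (ϑ i ℓ)) := fun i hi ℓ hℓ =>
    ((hsol i (htK i hi)).eq_iff ℓ hℓ.1 _ (hball i hi hℓ.2)).2 rfl
  -- The coefficients `ϑ i ℓ` have norm below `r ≤ δ j` and the same exponential in both models, so
  -- they also solve the equation of model `j`, whose small solution is unique.
  have hcons : ∀ i ∈ t, ∀ j ∈ t, ∀ ℓ ∈ W i, ℓ ∈ V j →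
      ϑ j ℓ = ϑ i ℓ ∧ ε j ℓ (ϑ j ℓ) = ε i ℓ (ϑ i ℓ) := by
    intro i hi j hj ℓ hℓ hℓj
    have h1 : IsExp f (ϑ i ℓ) ℓ (ε i ℓ (ϑ i ℓ)) :=
      ((hsol i (htK i hi)).isExp_iff ℓ hℓ.1 _ (hball i hi hℓ.2) _).2 rfl
    have h2 := ((hsol j (htK j hj)).isExp_iff ℓ hℓj _ (hball j hj hℓ.2) _).1 h1
    have h3 : ϑ j ℓ = ϑ i ℓ :=
      ((hsol j (htK j hj)).eq_iff ℓ hℓj _ (hball j hj hℓ.2)).1 (h2 ▸ hQε i hi ℓ hℓ)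
    exact ⟨h3, by rw [h3, h2]⟩
  set U₀ : Set (Cotangent E M) := ⋃ i ∈ t, W i with hU₀
  have hU₀m : ∀ {ℓ}, ℓ ∈ U₀ ↔ ∃ i ∈ t, ℓ ∈ W i := fun {ℓ} => by simp [hU₀]
  have hU₀o : IsOpen U₀ := isOpen_biUnion hWo
  have hsel : ∀ ℓ, ∃ i, ℓ ∈ U₀ → i ∈ t ∧ ℓ ∈ W i := fun ℓ => by
    by_cases h : ℓ ∈ U₀
    · obtain ⟨i, hi⟩ := hU₀m.1 h
      exact ⟨i, fun _ => hi⟩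
    · exact ⟨ℓ, fun h' => absurd h' h⟩
  choose s hs using hsel
  set θ : Cotangent E M → Fin m → ℝ := fun ℓ => ϑ (s ℓ) ℓ with hθ
  set φ : Cotangent E M → Cotangent E M := fun ℓ => ε (s ℓ) ℓ (ϑ (s ℓ) ℓ) with hφ
  have hloc : ∀ i ∈ t, ∀ ℓ ∈ W i, θ ℓ = ϑ i ℓ ∧ φ ℓ = ε i ℓ (ϑ i ℓ) := fun i hi ℓ hℓ =>
    have h := hs ℓ (hU₀m.2 ⟨i, hi, hℓ⟩)
    hcons i hi (s ℓ) h.1 ℓ hℓ h.2.1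
  have hQφ : ∀ ℓ ∈ U₀, Q (φ ℓ) := fun ℓ hℓ => hQε _ (hs ℓ hℓ).1 ℓ (hs ℓ hℓ).2
  have hφc : ContinuousOn φ U₀ := by
    intro ℓ hℓ
    obtain ⟨i, hi, hℓi⟩ := hU₀m.1 hℓ
    refine ContinuousAt.continuousWithinAt
      (((hsol i (htK i hi)).continuousAt ℓ hℓi.1 (hball i hi hℓi.2)).congr ?_)
    filter_upwards [(hWo i hi).mem_nhds hℓi] with p hp using (hloc i hi p hp).2.symm
  have hfix : ∀ ℓ ∈ U₀, Q ℓ → θ ℓ = 0 ∧ φ ℓ = ℓ := by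
    intro ℓ hℓ hq
    obtain ⟨i, hi, hℓi⟩ := hU₀m.1 hℓ
    have h0 := hϑ0 i hi ℓ hℓi.1 hq
    exact ⟨(hloc i hi ℓ hℓi).1.trans h0, by rw [(hloc i hi ℓ hℓi).2, h0, hε0 i hi ℓ hℓi.1]⟩
  have hQS : ∀ ℓ ∈ singSet f₀ f, Q ℓ := fun ℓ hℓ =>
    poisson_eq_zero_of_mem_singSet hf₀ hf hℓ
  have hKU₀ : K ⊆ U₀ := by
    intro ℓ hℓ
    obtain ⟨i, hi, hℓi⟩ := mem_iUnion₂.1 (hcov hℓ)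
    refine hU₀m.2 ⟨i, hi, hℓi, ?_⟩
    rw [mem_preimage, hϑ0 i hi ℓ hℓi (hQS ℓ (hKS hℓ))]
    exact Metric.mem_ball_self hr
  -- At `φ ℓ` the `{F₀, Fᵢ}` vanish, so `φ` fixes `φ ℓ` as soon as `φ ℓ ∈ U₀`. Hence this
  -- intersection is mapped into itself.
  refine ⟨U₀ ∩ φ ⁻¹' U₀, θ, φ, fun ℓ hℓ => ⟨hKU₀ hℓ, ?_⟩, ?_⟩
  · rw [mem_preimage, (hfix ℓ (hKU₀ hℓ) (hQS ℓ (hKS hℓ))).2]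
    exact hKU₀ hℓ
  refine
    { isOpen := hφc.isOpen_inter_preimage hU₀o hU₀o
      legendre := fun ℓ hℓ => (hsol _ (htK _ (hs ℓ hℓ.1).1)).legendre ℓ (hs ℓ hℓ.1).2.1
      smooth := fun j ℓ hℓ => ?_
      flow := fun ℓ hℓ => ?_
      mapsTo := fun ℓ hℓ => ⟨hℓ.2, ?_⟩
      mapsTo_sing := fun ℓ hℓ => ?_
      zero_sing := fun ℓ hℓ => (hfix ℓ hℓ.2.1 (hQS ℓ hℓ.1)).1
      diff_sing := fun ℓ hℓ v => ?_ }
  · obtain ⟨hi, hℓi⟩ := hs ℓ hℓ.1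
    have h1 := contMDiffAt_pi_space.1 ((hsol _ (htK _ hi)).smooth ℓ hℓi.1) j
    refine (h1.congr_of_eventuallyEq ?_).contMDiffWithinAt
    filter_upwards [(hWo _ hi).mem_nhds hℓi] with p hp
    exact congrFun (hloc _ hi p hp).1 j
  · obtain ⟨hi, hℓi⟩ := hs ℓ hℓ.1
    exact ((hsol _ (htK _ hi)).isExp_iff ℓ hℓi.1 _ (hball _ hi hℓi.2) _).2 rfl
  · rw [mem_preimage, (hfix (φ ℓ) hℓ.2 (hQφ ℓ hℓ.1)).2]
    exact hℓ.2
  · obtain ⟨hi, hℓi⟩ := hs ℓ hℓ.2.1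
    obtain ⟨hj, hℓj⟩ := hs (φ ℓ) hℓ.2.2
    exact (hsol _ (htK _ hj)).mem_sing _ hℓj.1
      ((hsol _ (htK _ hi)).exp_mem ℓ hℓi.1 hℓ.1 _ (hball _ hi hℓi.2)) (hQφ ℓ hℓ.2.1)
  · obtain ⟨hi, hℓi⟩ := hs ℓ hℓ.2.1
    rw [← (hsol _ (htK _ hi)).diff ℓ hℓi.1 hℓ.1 v]
    ext j
    have h1 : (fun p => θ p j) =ᶠ[𝓝 ℓ] fun p => ϑ (s ℓ) p j := by
      filter_upwards [(hWo _ hi).mem_nhds hℓi] with p hp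
      exact congrFun (hloc _ hi p hp).1 j
    rw [cotDiff, cotDiff, h1.mfderiv_eq]

/-- A singular extremal that satisfies the high order Goh condition lies in `S`. -/
lemma IsNormalSingularExtremal.mem_singSet (hf₀ : IsSmoothVField f₀)
    (hf : ∀ i, IsSmoothVField (f i)) {Uc : Set (EuclideanSpace ℝ (Fin m))} {T : ℝ}
    {u : ℝ → EuclideanSpace ℝ (Fin m)} {lam : ℝ → Cotangent E M}
    (hext : IsNormalSingularExtremal f₀ f Uc T u lam)
    (hsig : ∀ t ∈ Icc 0 T, lam t ∈ sigmaSet f) {t : ℝ} (ht : t ∈ Icc 0 T) :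
    lam t ∈ singSet f₀ f := by
  have : CompleteSpace E := FiniteDimensional.complete ℝ E
  refine ⟨hsig t ht, fun g hg => ?_⟩
  have hgs := hg.isSmoothVField hf
  have hB := hf₀.mlieBracket hgs
  have hcont : ContinuousOn (fun τ => hamLift (VectorField.mlieBracket 𝓘(ℝ, E) f₀ g) (lam τ))
      (Icc 0 T) := by
    intro τ hτ
    have hs : lam τ ∈ (cotChart (lam τ)).source := mem_extChartAt_source _
    have h1 := (contMDiffAt_iff_contDiffAt_inCotChart hs).2
      (hB.contDiffAt_hamLift (cotChart_mem_target hs))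
    exact h1.continuousAt.comp_continuousWithinAt (hext.cont τ hτ)
  -- The differential equation holds only almost everywhere; continuity extends the resulting
  -- identity to every time.
  refine Measure.eqOn_Icc_of_ae_eq volume hext.time_pos.ne ?_ hcont
    (continuousOn_const (c := (0 : ℝ))) ht
  have hode := hext.ode
  rw [← restrict_Ioo_eq_restrict_Icc] at hode ⊢
  filter_upwards [hode, ae_restrict_mem measurableSet_Ioo] with τ hτ hτI
  have hτ' := Ioo_subset_Icc_self hτI
  set ℓ := lam τ with hℓ
  have hs : ℓ ∈ (cotChart ℓ).source := mem_extChartAt_source _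
  have hz := cotChart_mem_target hs
  set Fu : Cotangent E M → ℝ := fun ℓ => hamLift f₀ ℓ + ∑ i, u τ i * hamLift (f i) ℓ with hFu
  have hg0 : pb canonicalJ (inCotChart ℓ Fu) (inCotChart ℓ (hamLift g)) (cotChart ℓ ℓ) = 0 := by
    have h1 := hasDerivWithinAt_cotChart_comp (s := univ) (ℓ₀ := ℓ) hτ.hasMFDerivWithinAt hs
    rw [hasDerivWithinAt_univ, cotChartDeriv_hamVec _ hs] at h1
    have hd := ((hgs.contDiffAt_hamLift hz).differentiableAt (by simp)).hasFDerivAt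
    have h2 := hd.comp_hasDerivAt τ h1
    have h3 : inCotChart ℓ (hamLift g) ∘ (fun σ => cotChart ℓ (lam σ)) =ᶠ[𝓝 τ] fun _ => 0 := by
      filter_upwards [Ioo_mem_nhds hτI.1 hτI.2,
        hτ.continuousAt.preimage_mem_nhds (cotChart_source_mem_nhds hs)] with σ h4 h5
      rw [Function.comp_apply, inCotChart_apply _ h5]
      exact hsig σ (Ioo_subset_Icc_self h4) g hg
    exact h2.unique ((hasDerivAt_const τ (0 : ℝ)).congr_of_eventuallyEq h3)
  have hFd : fderiv ℝ (inCotChart ℓ Fu) (cotChart ℓ ℓ) =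
      fderiv ℝ (inCotChart ℓ (hamLift f₀)) (cotChart ℓ ℓ) +
      ∑ i, u τ i • fderiv ℝ (inCotChart ℓ (hamLift (f i))) (cotChart ℓ ℓ) := by
    have h0 := ((hf₀.contDiffAt_hamLift hz).differentiableAt (by simp)).hasFDerivAt
    have hi := fun i => (((hf i).contDiffAt_hamLift hz).differentiableAt (by simp)).hasFDerivAt
    exact (h0.add (HasFDerivAt.fun_sum fun i (_ : i ∈ Finset.univ) =>
      (hi i).const_mul (u τ i))).fderiv
  rw [pb_skew canonicalJ_skew, pb, hFd] at hg0
  -- The control terms drop out because `[g, fᵢ]` belongs to `Lie(𝔣)` and the curve lies in `Σ`.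
  have hi0 : ∀ i, fderiv ℝ (inCotChart ℓ (hamLift (f i))) (cotChart ℓ ℓ)
      (hv canonicalJ (inCotChart ℓ (hamLift g)) (cotChart ℓ ℓ)) = 0 := by
    intro i
    change pb canonicalJ (inCotChart ℓ (hamLift g)) (inCotChart ℓ (hamLift (f i))) _ = 0
    rw [pb_hamLift hgs (hf i) hz, inCotChart_apply _ hs]
    exact hsig τ hτ' _ (hg.bracket (.basic i))
  have h00 : fderiv ℝ (inCotChart ℓ (hamLift f₀)) (cotChart ℓ ℓ)
      (hv canonicalJ (inCotChart ℓ (hamLift g)) (cotChart ℓ ℓ)) =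
      -hamLift (VectorField.mlieBracket 𝓘(ℝ, E) f₀ g) ℓ := by
    change pb canonicalJ (inCotChart ℓ (hamLift g)) (inCotChart ℓ (hamLift f₀)) _ = _
    rw [pb_skew canonicalJ_skew, pb_hamLift hf₀ hgs hz, inCotChart_apply _ hs]
  simp only [add_apply, sum_apply, smul_apply, hi0, h00, smul_zero, Finset.sum_const_zero,
    add_zero, neg_neg] at hg0
  exact hg0

end

end

/-! ### The theorem -/

theorem mainTheorem4 {E M : Type*} [NormedAddCommGroup E] [NormedSpace ℝ E]
    [FiniteDimensional ℝ E] [TopologicalSpace M] [T2Space M] [ChartedSpace E M]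
    [IsManifold 𝓘(ℝ, E) ∞ M] {m R : ℕ}
    (f₀ : VField E M) (f : Fin m → VField E M)
    (hf₀ : IsSmoothVField f₀) (hf : ∀ i, IsSmoothVField (f i))
    (Uc : Set (EuclideanSpace ℝ (Fin m))) (T : ℝ) (u : ℝ → EuclideanSpace ℝ (Fin m))
    (lam : ℝ → Cotangent E M)
    (hext : IsNormalSingularExtremal f₀ f Uc T u lam)
    (hLie : ∃ O : Set M, IsOpen O ∧ (∀ t ∈ Icc 0 T, (lam t).1 ∈ O) ∧ LieRegularOn f R O)
    (hHOGC : ∀ t ∈ Icc 0 T, ∀ g : VField E M, LieGen f g → hamLift g (lam t) = 0)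
    (hSGLC : ∃ c : ℝ, 0 < c ∧ ∀ t ∈ Icc 0 T, ∀ v : Fin m → ℝ,
      legendreForm f₀ f (lam t) v ≤ -c * ∑ i, v i ^ 2)
    (hS : ∃ N : Set (Cotangent E M), IsOpen N ∧ lam '' Icc 0 T ⊆ N ∧
      IsSubmanifoldOfCodimIn m (singSet f₀ f ∩ N) (sigmaSet f ∩ N)) :
    (∃ (U : Set (Cotangent E M)) (θ : Cotangent E M → Fin m → ℝ)
        (φ : Cotangent E M → Cotangent E M),
      lam '' Icc 0 T ⊆ U ∧ IsSingularProjection f₀ f U θ φ) ∧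
    ∀ (U : Set (Cotangent E M)) (θ : Cotangent E M → Fin m → ℝ)
        (φ : Cotangent E M → Cotangent E M),
      lam '' Icc 0 T ⊆ U → IsSingularProjection f₀ f U θ φ →
      ∃ U' : Set (Cotangent E M), IsOpen U' ∧ lam '' Icc 0 T ⊆ U' ∧ U' ⊆ U ∧
        ContMDiffOn (cotModel E) 𝓘(ℝ, ℝ) ∞ (superHam f₀ φ) U' ∧
        (∀ ℓ ∈ singSet f₀ f ∩ U', superHam f₀ φ ℓ = hamLift f₀ ℓ ∧
          hamVec (superHam f₀ φ) ℓ = hamVec (hamLift f₀) ℓ) ∧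
        (∀ ℓ ∈ sigmaSet f ∩ U',
          IsTangentVector (sigmaSet f) ℓ (hamVec (superHam f₀ φ) ℓ)) ∧
        (∀ ℓ ∈ sigmaSet f ∩ U', hamLift f₀ ℓ ≤ superHam f₀ φ ℓ) := by
  obtain ⟨O, hO, hlamO, hreg⟩ := hLie
  obtain ⟨N, hN, hlamN, hSN⟩ := hS
  obtain ⟨c, hc, hleg⟩ := hSGLC
  have hKS : lam '' Icc 0 T ⊆ singSet f₀ f := by
    rintro _ ⟨t, ht, rfl⟩
    exact hext.mem_singSet hf₀ hf hHOGC ht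
  have hK : IsCompact (lam '' Icc 0 T) := isCompact_Icc.image_of_continuousOn hext.cont
  have hmodel := fun ℓ₀ (hℓ₀ : ℓ₀ ∈ lam '' Icc 0 T) =>
    exists_isLocalModel (R := R) hf₀ hf hO hreg hN hSN (ℓ₀ := ℓ₀)
      (by obtain ⟨t, ht, rfl⟩ := hℓ₀; exact hlamO t ht) (hKS hℓ₀) (hlamN hℓ₀) (by
        obtain ⟨t, ht, rfl⟩ := hℓ₀
        intro v hv
        refine (hleg t ht v).trans_lt ?_
        obtain ⟨i, hi⟩ := Function.ne_iff.1 hv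
        have : 0 < ∑ i, v i ^ 2 :=
          Finset.sum_pos' (fun i _ => sq_nonneg _) ⟨i, Finset.mem_univ i, sq_pos_of_ne_zero hi⟩
        nlinarith)
  refine ⟨exists_isSingularProjection hf₀ hf hK hKS fun ℓ₀ hℓ₀ => ?_, fun U θ φ hKU hp => ?_⟩
  · obtain ⟨Ω, G, e, U, δ, h, θ, hθ, hθQ, hQ⟩ := hmodel ℓ₀ hℓ₀
    exact ⟨_, _, _, _, h.mem_source, h.isLocalSolution hθ hθQ hQ⟩
  · have hloc : ∀ ℓ₀ ∈ lam '' Icc 0 T, _ := fun ℓ₀ hℓ₀ =>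
      let ⟨_, _, _, _, _, h, _⟩ := hmodel ℓ₀ hℓ₀
      h.exists_superHam_properties (hKS hℓ₀) hp (hKU hℓ₀)
    -- All the conclusions are local in `ℓ`, so the union of these neighbourhoods serves as `U'`.
    choose! V hV hmem hVU hsm hsing htan hle using hloc
    refine ⟨⋃ ℓ₀ ∈ lam '' Icc 0 T, V ℓ₀, isOpen_biUnion hV,
      fun ℓ hℓ => mem_biUnion hℓ (hmem ℓ hℓ), iUnion₂_subset hVU, fun ℓ hℓ => ?_, ?_, ?_, ?_⟩
    · obtain ⟨p, hp, hℓp⟩ := mem_iUnion₂.1 hℓ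
      exact ((hsm p hp).contMDiffAt ((hV p hp).mem_nhds hℓp)).contMDiffWithinAt
    · rintro ℓ ⟨hs, hℓ⟩
      obtain ⟨p, hp, hℓp⟩ := mem_iUnion₂.1 hℓ
      exact hsing p hp ℓ ⟨hs, hℓp⟩
    · rintro ℓ ⟨hs, hℓ⟩
      obtain ⟨p, hp, hℓp⟩ := mem_iUnion₂.1 hℓ
      exact htan p hp ℓ ⟨hs, hℓp⟩
    · rintro ℓ ⟨hs, hℓ⟩
      obtain ⟨p, hp, hℓp⟩ := mem_iUnion₂.1 hℓ
      exact hle p hp ℓ ⟨hs, hℓp⟩
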